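/- **Setting.** Let $r,T\ge 1$, $\overline d,\overline s,\overline\mu\in\{1,2,\dots\}^r$. For a step $\overline\nu\in\mathbb Z^r$ (all components positive or all negative) the generalized multiple (GM) increment is $$\chi_{\overline\nu,\overline s}^{(d)}(\xi(m))=\prod_{i=1}^r(1-B_{\nu_i}^{s_i})^{d_i}\xi(m)=\sum_{l_1=0}^{d_1}\cdots\sum_{l_r=0}^{d_r}(-1)^{l_1+\dots+l_r}\binom{d_1}{l_1}\cdots\binom{d_r}{l_r}\,\xi(m-\nu_1s_1l_1-\dots-\nu_rs_rl_r).$$ Put $$\chi_{\overline\nu}^{(d)}(e^{-i\lambda})=\prod_{j=1}^r(1-e^{-i\lambda\nu_js_j})^{d_j},\qquad \beta^{(d)}(i\lambda)=\prod_{j=1}^r\ \prod_{k=-[s_j/2]}^{[s_j/2]}(i\lambda-2\pi ik/s_j)^{d_j},$$ $n(\gamma)=\sum_i\mu_is_id_i$ and $\prod_i(1-B^{\mu_is_i})^{d_i}=\sum_{k=0}^{n(\gamma)}e_\gamma(k)B^k$. Let $\vec\xi(m)$, $m\in\mathbb Z$, be a $T$-dimensional (complex-valued) sequence whose GM increments are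 square integrable, centred and jointly stationary for all steps, with spectral density $f$: $$\mathsf E\,\chi_{\overline\nu_1,\overline s}^{(d)}(\xi_p(m_0+m))\,\overline{\chi_{\overline\nu_2,\overline s}^{(d)}(\xi_q(m_0))}=\frac1{2\pi}\int_{-\pi}^{\pi}e^{i\lambda m}\,\frac{\chi_{\overline\nu_1}^{(d)}(e^{-i\lambda})\,\overline{\chi_{\overline\nu_2}^{(d)}(e^{-i\lambda})}}{|\beta^{(d)}(i\lambda)|^2}\,f_{pq}(\lambda)\,d\lambda .$$ Let $\vec\eta(m)$ be a centred stationary sequence, uncorrelated with (the increments of) $\vec\xi$, with spectral density $g$: $\mathsf E\eta_p(m_0+m)\overline{\eta_q(m_0)}=\frac1{2\pi}\int_{-\pi}^{\pi}e^{i\lambda m}g_{pq}(\lambda)d\lambda$. Here $f,g$ are integrable with positive semidefinite values. Put $\vec\zeta=\vec\xi+\vec\eta$ and $p(\lambda)=f(\lambda)+|\beta^{(d)}(i\lambda)|^2g(\lambda)$. Let $Z$ denote the spectral process of $\vec\zeta$: it has uncorrelated increments on $[-\pi,\pi)$ with spectral density $p$ (with respect to $d\lambda/2\pi$), and $\chi_{\overline\nu,\overline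 s}^{(d)}(\vec\zeta(m))=\int_{-\pi}^{\pi}e^{i\lambda m}\chi_{\overline\nu}^{(d)}(e^{-i\lambda})\beta^{(d)}(i\lambda)^{-1}dZ(\lambda)$ for all $m$ and all steps $\overline\nu$. $L_2(p)$ has the norm $\|h\|^2=\frac1{2\pi}\int h^\top p\,\overline h\,d\lambda$, and $L_2^0(p)$ is the closed span in it of $e^{i\lambda k}\chi_{\overline\mu}^{(d)}(e^{-i\lambda})\beta^{(d)}(i\lambda)^{-1}\vec\delta_l$, $k\le0$, $1\le l\le T$. **Problem.** Estimate $A\vec\xi=\sum_{k\ge0}\vec a(k)^\top\vec\xi(-k)$ from $\vec\zeta(0),\vec\zeta(-1),\dots$, where $\sum\|\vec a(k)\|<\infty$, $\sum(k+1)\|\vec a(k)\|^2<\infty$ and the series $A\vec\xi$ converges in probability. Put $A\vec\zeta=\sum_{k\ge0}\vec a(k)^\top\vec\zeta(-k)$ (the convergence is part of the conclusion). The linear estimates are the variables $A\vec\zeta-Y$ with $Y$ in the closed span in $L_2(\Omega)$ of $\chi_{\overline\mu,\overline s}^{(d)}(\zeta_l(k))$, $k\le0$, $1\le l\le T$. **Factorizations.**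 Assume that $p(\lambda)$ is invertible for a.e. $\lambda$, and that for a.e. $\lambda$ $$\frac{|\chi_{\overline\mu}^{(d)}(e^{-i\lambda})|^2}{|\beta^{(d)}(i\lambda)|^2}\,p(\lambda)=\Theta\Theta^*,\quad g(\lambda)=\Phi\Phi^*,\quad \Psi\Theta=E_q,\quad \frac{|\beta^{(d)}(i\lambda)|^2}{|\chi_{\overline\mu}^{(d)}(e^{-i\lambda})|^2}\,p(\lambda)^{-1}=\Psi^*\Psi,$$ where $\Theta=\sum_{k\ge0}\theta_{\overline\mu}(k)e^{-i\lambda k}$ ($T\times q$), $\Phi=\sum_{k\ge0}\phi(k)e^{-i\lambda k}$ ($T\times q'$), $\Psi=\sum_{k\ge0}\psi_{\overline\mu}(k)e^{-i\lambda k}$ ($q\times T$) converge in $L_2[-\pi,\pi)$. **Notation.** Let $g(k)=\frac1{2\pi}\int_{-\pi}^{\pi} g(\lambda)e^{-i\lambda k}d\lambda$, $\vec a_{-\overline\mu}(m)=\sum_{l=\max\{m,0\}}^{m+n(\gamma)}e_\gamma(l-m)\vec a(l)$ for $m\ge-n(\gamma)$, $\mathbf a=(\vec a(k))_{k\ge0}$,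 $\mathbf a_{-\overline\mu}=(\vec a_{-\overline\mu}(k))_{k\ge0}$, and $\mathbf b_{-\overline\mu}=(\vec b_{-\overline\mu}(k))_{k\ge0}$ with $\vec b_{-\overline\mu}(k)=\vec a_{-\overline\mu}(-k)$ for $1\le k\le n(\gamma)$ and $0$ otherwise. On sequences indexed by $k\ge0$ define block matrices $(\mathbf G^{-})_{l,k}=\overline{g(l-k)}$, $(\mathbf G^{+})_{l,k}=\overline{g(l+k)}$, $(\widetilde\Phi^{+})_{k,j}=\phi^\top(k+j)$, $(\widetilde\Phi)_{k,j}=\phi^\top(k-j)$ for $j\le k$ and $0$ for $j>k$, $(\widetilde\Psi_{\overline\mu})_{k,j}=\psi_{\overline\mu}^\top(k-j)$ for $j\le k$ and $0$ for $j>k$; a star denotes the adjoint block matrix. Assume that $\mathbf a_{-\overline\mu}$, $\mathbf b_{-\overline\mu}$ lie in the domains of $\mathbf G^-$, $\mathbf G^+$ as operators in $\ell_2$, i.e. $\mathbf G^-\mathbf a_{-\overline\mu}\in\ell_2$ and $\mathbf G^+\mathbf b_{-\overline\mu}\in\ell_2$ (automatic if $g$ is essentially bounded). Put $$\mathbf c^{-}_{\overline\mu,g}(m)=\sum_{k\ge0}\overline{g(m-k)}\,\vec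 a_{-\overline\mu}(k),\qquad \mathbf c^{+}_{\overline\mu,g}(m)=\sum_{k\ge0}\overline{g(m+k)}\,\vec b_{-\overline\mu}(k),\qquad (\overline\psi_{\overline\mu}\mathbf C^{\pm}_{\overline\mu,g})_m=\sum_{k\ge0}\overline{\psi_{\overline\mu}(k)}\,\mathbf c^{\pm}_{\overline\mu,g}(k+m).$$ **Theorem.** The spectral process $Z$ exists, all series below converge, and the optimal (mean square, a.s. unique) linear estimate of $A\vec\xi$ is $$\widehat A\vec\xi=A\vec\zeta-\int_{-\pi}^{\pi}\vec h_{\overline\mu}(\lambda)^\top dZ(\lambda),$$ with $\vec h_{\overline\mu}\in L_2^0(p)$ given by $$\vec h_{\overline\mu}(\lambda)=\frac{\chi_{\overline\mu}^{(d)}(e^{-i\lambda})}{\beta^{(d)}(i\lambda)}\Big(\sum_{k\ge0}\psi_{\overline\mu}^\top(k)e^{-i\lambda k}\Big)\sum_{m\ge0}x_me^{-i\lambda m},$$ $$x_m=\big(\widetilde\Psi_{\overline\mu}^*\mathbf G^-\mathbf a_{-\overline\mu}+\widetilde\Psi_{\overline\mu}^*\mathbf G^+\mathbf b_{-\overline\mu}\big)_m=\big(\overline\psi_{\overline\mu}\mathbf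 C^-_{\overline\mu,g}+\overline\psi_{\overline\mu}\mathbf C^+_{\overline\mu,g}\big)_m,\qquad (x_m)\in\ell_2 .$$ Moreover $$\mathbf c^{-}_{\overline\mu,g}(m)=\sum_{l\ge0}\overline{\phi(l)}\sum_{k=0}^{l+m}\phi^\top(l+m-k)\,\vec a_{-\overline\mu}(k)=\sum_{l\ge0}\overline{\phi(l)}\,(\widetilde\Phi\mathbf a_{-\overline\mu})_{l+m}=(\widetilde\Phi^*\widetilde\Phi\mathbf a_{-\overline\mu})_m,$$ $$\mathbf c^{+}_{\overline\mu,g}(m)=\sum_{l\ge0}\overline{\phi(l)}\sum_{k\ge0}\phi^\top(l+m+k)\,\vec b_{-\overline\mu}(k)=\sum_{l\ge0}\overline{\phi(l)}\,(\widetilde\Phi^+\mathbf b_{-\overline\mu})_{l+m}=(\widetilde\Phi^*\widetilde\Phi^+\mathbf b_{-\overline\mu})_m,$$ and the mean square error is $$\mathsf E|A\vec\xi-\widehat A\vec\xi|^2=\|\widetilde\Phi\mathbf a\|^2-\|\overline\psi_{\overline\mu}(\mathbf C^-_{\overline\mu,g}+\mathbf C^+_{\overline\mu,g})\|^2 .$$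 -/

import Mathlib

open MeasureTheory Filter Topology
open scoped Real ENNReal Matrix ComplexConjugate ComplexOrder

noncomputable section

namespace GMFilter

/-! ### Increments, their symbols and coefficients -/

/-- Steps `μ̄`: all components positive or all components negative. -/
def IsStep {r : ℕ} (μ : Fin r → ℤ) : Prop := (∀ i, 0 < μ i) ∨ (∀ i, μ i < 0)

/-- The generalized multiple increment `∏ᵢ (1 - B_{μᵢ}^{sᵢ})^{dᵢ} x (m)` of a scalar sequence,
`∑_{l₁ ≤ d₁} … ∑_{l_r ≤ d_r} (-1)^{l₁+…+l_r} ∏ᵢ C(dᵢ, lᵢ) x (m - ∑ᵢ μᵢ sᵢ lᵢ)`. -/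
def gmIncr {r : ℕ} {Ω : Type*} (μ : Fin r → ℤ) (s d : Fin r → ℕ) (x : ℤ → Ω → ℂ) (m : ℤ) :
    Ω → ℂ := fun ω =>
  ∑ l ∈ Fintype.piFinset (fun i => Finset.range (d i + 1)),
    (-1 : ℂ) ^ (∑ i, l i) * ((∏ i, (d i).choose (l i) : ℕ) : ℂ) *
      x (m - ∑ i, μ i * (s i : ℤ) * (l i : ℤ)) ω

/-- `χ_μ̄(e^{-iw}) = ∏ⱼ (1 - e^{-i w μⱼ sⱼ})^{dⱼ}`. -/
def chi {r : ℕ} (μ : Fin r → ℤ) (s d : Fin r → ℕ) (w : ℝ) : ℂ :=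
  ∏ j, (1 - Complex.exp (-(Complex.I * w * (μ j : ℂ) * (s j : ℂ)))) ^ d j

/-- `β(iw) = ∏ⱼ ∏_{k = -[sⱼ/2]}^{[sⱼ/2]} (iw - 2πik/sⱼ)^{dⱼ}`. -/
def beta {r : ℕ} (s d : Fin r → ℕ) (w : ℝ) : ℂ :=
  ∏ j, ∏ k ∈ Finset.Icc (-((s j / 2 : ℕ) : ℤ)) ((s j / 2 : ℕ) : ℤ),
    (Complex.I * w - 2 * π * Complex.I * (k : ℂ) / (s j : ℂ)) ^ d j

/-- `n(γ) = ∑ᵢ μᵢ sᵢ dᵢ`. -/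
def nGamma {r : ℕ} (μ s d : Fin r → ℕ) : ℕ := ∑ i, μ i * s i * d i

/-- `e_γ(k)`, the coefficient of `B ^ k` in `∏ᵢ (1 - B^{μᵢ sᵢ})^{dᵢ}`. -/
def eGamma {r : ℕ} (μ s d : Fin r → ℕ) (k : ℕ) : ℤ :=
  (∏ i, (1 - (Polynomial.X : Polynomial ℤ) ^ (μ i * s i)) ^ d i).coeff k

/-! ### Spectral densities

All spectral densities are taken with respect to `dw / 2π` on `[-π, π)`. -/

/-- The measure `dw / 2π` on `[-π, π)`. -/
def circ : Measure ℝ :=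
  ENNReal.ofReal (2 * π)⁻¹ • (volume.restrict (Set.Ico (-π) π))

/-- `w ↦ f w` is an integrable function with positive semidefinite values. -/
structure IsDensity {T : ℕ} (f : ℝ → Matrix (Fin T) (Fin T) ℂ) : Prop where
  integrable : ∀ i j, Integrable (fun w => f w i j) circ
  posSemidef : ∀ᵐ w ∂circ, (f w).PosSemidef

/-- `ξ` is a vector sequence with stationary GM increments (of zero mean) with spectral
density `f`: the increments for all steps are square integrable and centred, and the structural
function `E χ_{μ₁}(ξ_p(m₀+m)) conj (χ_{μ₂}(ξ_q(m₀)))` does not depend on `m₀` and equals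
`(1/2π) ∫ e^{iwm} χ_{μ₁}(e^{-iw}) χ_{μ₂}(e^{iw}) |β(iw)|⁻² f_{pq}(w) dw`. -/
structure HasGMSpectralDensity {Ω : Type*} [MeasurableSpace Ω] (P : Measure Ω) {r T : ℕ}
    (s d : Fin r → ℕ) (ξ : ℤ → Fin T → Ω → ℂ) (f : ℝ → Matrix (Fin T) (Fin T) ℂ) : Prop where
  isDensity : IsDensity f
  measurable : ∀ m p, AEStronglyMeasurable (ξ m p) P
  memLp : ∀ μ, IsStep μ → ∀ m p, MemLp (gmIncr μ s d (fun k => ξ k p) m) 2 P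
  mean : ∀ μ, IsStep μ → ∀ m p, ∫ ω, gmIncr μ s d (fun k => ξ k p) m ω ∂P = 0
  structural : ∀ μ₁ μ₂, IsStep μ₁ → IsStep μ₂ → ∀ (m₀ m : ℤ) (p q : Fin T),
    ∫ ω, gmIncr μ₁ s d (fun k => ξ k p) (m₀ + m) ω *
        conj (gmIncr μ₂ s d (fun k => ξ k q) m₀ ω) ∂P =
      ∫ w, Complex.exp (Complex.I * w * (m : ℂ)) *
        (chi μ₁ s d w * conj (chi μ₂ s d w) / ((‖beta s d w‖ ^ 2 : ℝ) : ℂ)) * f w p q ∂circ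

/-- `η` is a centred wide sense stationary vector sequence with spectral density `g`. -/
structure HasSpectralDensity {Ω : Type*} [MeasurableSpace Ω] (P : Measure Ω) {T : ℕ}
    (η : ℤ → Fin T → Ω → ℂ) (g : ℝ → Matrix (Fin T) (Fin T) ℂ) : Prop where
  isDensity : IsDensity g
  memLp : ∀ m p, MemLp (η m p) 2 P
  mean : ∀ m p, ∫ ω, η m p ω ∂P = 0
  covariance : ∀ (m₀ m : ℤ) (p q : Fin T),
    ∫ ω, η (m₀ + m) p ω * conj (η m₀ q ω) ∂P =
      ∫ w, Complex.exp (Complex.I * w * (m : ℂ)) * g w p q ∂circ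

/-- The spectral density `p = f + |β|² g` of `ξ + η`. -/
def pDensity {r T : ℕ} (s d : Fin r → ℕ) (f g : ℝ → Matrix (Fin T) (Fin T) ℂ) (w : ℝ) :
    Matrix (Fin T) (Fin T) ℂ :=
  f w + ((‖beta s d w‖ ^ 2 : ℝ) : ℂ) • g w

/-! ### The space `L₂(p)`, stochastic integrals and the spectral process -/

/-- The squared norm `(1/2π) ∫ hᵀ p h̄ dw` of `L₂(p)`. -/
def specNormSq {T : ℕ} (p : ℝ → Matrix (Fin T) (Fin T) ℂ) (h : ℝ → Fin T → ℂ) : ℝ≥0∞ :=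
  ∫⁻ w, ENNReal.ofReal (h w ⬝ᵥ (p w *ᵥ star (h w))).re ∂circ

/-- The function `e^{iwk} χ_μ̄(e^{-iw}) β(iw)⁻¹ δ_l`. -/
def incrFun {r T : ℕ} (μ : Fin r → ℤ) (s d : Fin r → ℕ) (k : ℤ) (l : Fin T) (w : ℝ) :
    Fin T → ℂ :=
  Pi.single l (Complex.exp (Complex.I * w * (k : ℂ)) * (chi μ s d w / beta s d w))

/-- Membership in `L₂⁰(p)`, the closed span in `L₂(p)` of the functions
`e^{iwk} χ_μ̄(e^{-iw}) β(iw)⁻¹ δ_l`, `k ≤ 0`. -/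
def MemL20 {r T : ℕ} (μ : Fin r → ℤ) (s d : Fin r → ℕ) (p : ℝ → Matrix (Fin T) (Fin T) ℂ)
    (h : ℝ → Fin T → ℂ) : Prop :=
  AEStronglyMeasurable h circ ∧ ∀ ε : ℝ≥0∞, 0 < ε → ∃ c : (ℕ × Fin T) →₀ ℂ,
    specNormSq p
      (fun w => h w - c.sum fun kl z => z • incrFun μ s d (-(kl.1 : ℤ)) kl.2 w) < ε

/-- `Y = ∫ hᵀ dZ` for a process `Z` on `[-π, π)` with uncorrelated increments and spectral
density `p`: the integral of a step function `∑ c_{t,l} 1_{[-π,t)} δ_l` is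
`∑ c_{t,l} (Z_l(t) - Z_l(-π))`, and `Y` is the mean square limit of the integrals of step functions
that converge to `h` in `L₂(p)`. -/
def IsStochInt {Ω : Type*} [MeasurableSpace Ω] (P : Measure Ω) {T : ℕ}
    (p : ℝ → Matrix (Fin T) (Fin T) ℂ) (Z : ℝ → Fin T → Ω → ℂ)
    (h : ℝ → Fin T → ℂ) (Y : Ω → ℂ) : Prop :=
  AEStronglyMeasurable h circ ∧ MemLp Y 2 P ∧
    ∀ ε : ℝ≥0∞, 0 < ε → ∃ c : (Set.Ico (-π) π × Fin T) →₀ ℂ,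
      specNormSq p (fun w => h w - c.sum fun tl z =>
        z • (Pi.single tl.2 ((Set.Ico (-π) (tl.1 : ℝ)).indicator (fun _ => (1 : ℂ)) w) :
          Fin T → ℂ)) < ε ∧
      eLpNorm (fun ω => Y ω - c.sum fun tl z =>
        z * (Z (tl.1 : ℝ) tl.2 ω - Z (-π) tl.2 ω)) 2 P < ε

/-- `Z` is the spectral process of the GM increments of `ζ`: it has uncorrelated increments on
`[-π, π)` with spectral density `p`, and
`χ_ν̄(ζ_l(m)) = ∫ e^{iwm} χ_ν̄(e^{-iw}) β(iw)⁻¹ dZ_l(w)` for all steps `ν̄`, all `m` and `l`. -/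
structure IsSpectralProcess {Ω : Type*} [MeasurableSpace Ω] (P : Measure Ω) {r T : ℕ}
    (s d : Fin r → ℕ) (ζ : ℤ → Fin T → Ω → ℂ) (p : ℝ → Matrix (Fin T) (Fin T) ℂ)
    (Z : ℝ → Fin T → Ω → ℂ) : Prop where
  memLp : ∀ t₁ ∈ Set.Ico (-π) π, ∀ t₂ ∈ Set.Ico (-π) π, ∀ i,
    MemLp (fun ω => Z t₂ i ω - Z t₁ i ω) 2 P
  covariance : ∀ t₁ t₂, -π ≤ t₁ → t₁ < t₂ → t₂ < π → ∀ i j,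
    ∫ ω, (Z t₂ i ω - Z t₁ i ω) * conj (Z t₂ j ω - Z t₁ j ω) ∂P =
      ∫ w in Set.Ico t₁ t₂, p w i j ∂circ
  uncorrelated : ∀ t₁ t₂ t₃ t₄, -π ≤ t₁ → t₁ < t₂ → t₂ ≤ t₃ → t₃ < t₄ → t₄ < π → ∀ i j,
    ∫ ω, (Z t₂ i ω - Z t₁ i ω) * conj (Z t₄ j ω - Z t₃ j ω) ∂P = 0
  representation : ∀ ν, IsStep ν → ∀ (m : ℤ) (l : Fin T),
    IsStochInt P p Z (incrFun ν s d m l) (gmIncr ν s d (fun k => ζ k l) m)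

/-! ### Canonical factorizations -/

/-- `F(w) = ∑_{k ≥ 0} c(k) e^{-iwk}`, with convergence in `L₂[-π, π)`. -/
def IsL2Series (c : ℕ → ℂ) (F : ℝ → ℂ) : Prop :=
  MemLp F 2 circ ∧
    Tendsto (fun N => eLpNorm (fun w => F w - ∑ k ∈ Finset.range N,
      c k * Complex.exp (-(Complex.I * w * (k : ℂ)))) 2 circ) atTop (𝓝 0)

/-- The factorizations
`|χ|² |β|⁻² p = Θ Θ*`, `g = Φ Φ*`, `Ψ Θ = E_q`, `|β|² |χ|⁻² p⁻¹ = Ψ* Ψ`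
with `Θ = ∑ θ(k) e^{-iwk}`, `Φ = ∑ φ(k) e^{-iwk}`, `Ψ = ∑ ψ(k) e^{-iwk}`. -/
structure CanonicalFactorizations {r T q q' : ℕ} (μ : Fin r → ℤ) (s d : Fin r → ℕ)
    (f g : ℝ → Matrix (Fin T) (Fin T) ℂ)
    (θ : ℕ → Matrix (Fin T) (Fin q) ℂ) (Θ : ℝ → Matrix (Fin T) (Fin q) ℂ)
    (φ : ℕ → Matrix (Fin T) (Fin q') ℂ) (Φ : ℝ → Matrix (Fin T) (Fin q') ℂ)
    (ψ : ℕ → Matrix (Fin q) (Fin T) ℂ) (Ψ : ℝ → Matrix (Fin q) (Fin T) ℂ) : Prop where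
  series_theta : ∀ i j, IsL2Series (fun k => θ k i j) (fun w => Θ w i j)
  series_phi : ∀ i j, IsL2Series (fun k => φ k i j) (fun w => Φ w i j)
  series_psi : ∀ i j, IsL2Series (fun k => ψ k i j) (fun w => Ψ w i j)
  fact_p : ∀ᵐ w ∂circ,
    ((‖chi μ s d w‖ ^ 2 / ‖beta s d w‖ ^ 2 : ℝ) : ℂ) • pDensity s d f g w = Θ w * (Θ w)ᴴ
  fact_g : ∀ᵐ w ∂circ, g w = Φ w * (Φ w)ᴴ
  left_inv : ∀ᵐ w ∂circ, Ψ w * Θ w = 1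
  p_invertible : ∀ᵐ w ∂circ, IsUnit (pDensity s d f g w).det
  fact_p_inv : ∀ᵐ w ∂circ,
    ((‖beta s d w‖ ^ 2 / ‖chi μ s d w‖ ^ 2 : ℝ) : ℂ) • (pDensity s d f g w)⁻¹ =
      (Ψ w)ᴴ * Ψ w

/-! ### Vectors, block matrices and coefficients -/

/-- Euclidean norm on `ℂⁿ`. -/
def vnorm {n : ℕ} (v : Fin n → ℂ) : ℝ := Real.sqrt (∑ i, ‖v i‖ ^ 2)

/-- Entrywise complex conjugate `M̄`. -/
def mconj {m n : ℕ} (M : Matrix (Fin m) (Fin n) ℂ) : Matrix (Fin m) (Fin n) ℂ :=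
  M.map (starRingEnd ℂ)

/-- The image of a sequence of vectors under an infinite block matrix,
`(M x)_l = ∑_{k ≥ 0} M_{l,k} x_k`. -/
def blockApply {m n : ℕ} (M : ℕ → ℕ → Matrix (Fin m) (Fin n) ℂ) (x : ℕ → Fin n → ℂ) :
    ℕ → Fin m → ℂ :=
  fun l => ∑' k, M l k *ᵥ x k

/-- All series in `M x` converge. -/
def BlockSummable {m n : ℕ} (M : ℕ → ℕ → Matrix (Fin m) (Fin n) ℂ) (x : ℕ → Fin n → ℂ) :
    Prop :=
  ∀ l, Summable fun k => M l k *ᵥ x k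

/-- The adjoint block matrix. -/
def blockAdj {m n : ℕ} (M : ℕ → ℕ → Matrix (Fin m) (Fin n) ℂ) :
    ℕ → ℕ → Matrix (Fin n) (Fin m) ℂ :=
  fun l k => (M k l)ᴴ

/-- The Fourier coefficients `g(k)` in `g(w) = ∑_{k ∈ ℤ} g(k) e^{iwk}`. -/
def gCoeff {T : ℕ} (g : ℝ → Matrix (Fin T) (Fin T) ℂ) (k : ℤ) : Matrix (Fin T) (Fin T) ℂ :=
  fun i j => ∫ w, g w i j * Complex.exp (-(Complex.I * w * (k : ℂ))) ∂circ

/-- `(G⁻)_{l,k} = conj g(l - k)`. -/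
def opGminus {T : ℕ} (g : ℝ → Matrix (Fin T) (Fin T) ℂ) (l k : ℕ) :
    Matrix (Fin T) (Fin T) ℂ :=
  mconj (gCoeff g ((l : ℤ) - (k : ℤ)))

/-- `(G⁺)_{l,k} = conj g(l + k)`. -/
def opGplus {T : ℕ} (g : ℝ → Matrix (Fin T) (Fin T) ℂ) (l k : ℕ) :
    Matrix (Fin T) (Fin T) ℂ :=
  mconj (gCoeff g ((l : ℤ) + (k : ℤ)))

/-- The operators `Φ̃` and `Ψ̃`: the block matrix with entries `c(k - j)ᵀ` for `j ≤ k` and `0`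
for `k < j`. -/
def opTilde {m n : ℕ} (c : ℕ → Matrix (Fin m) (Fin n) ℂ) (k j : ℕ) :
    Matrix (Fin n) (Fin m) ℂ :=
  if j ≤ k then (c (k - j))ᵀ else 0

/-- The operator `Φ̃⁺` with entries `φ(k + j)ᵀ`. -/
def opTildePlus {m n : ℕ} (c : ℕ → Matrix (Fin m) (Fin n) ℂ) (k j : ℕ) :
    Matrix (Fin n) (Fin m) ℂ :=
  (c (k + j))ᵀ

/-- `(ψ̄ C)_m = ∑_{k ≥ 0} conj ψ(k) c(k + m)` for a sequence of vectors `c`. -/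
def psiBarC {q T : ℕ} (ψ : ℕ → Matrix (Fin q) (Fin T) ℂ) (c : ℕ → Fin T → ℂ) (m : ℕ) :
    Fin q → ℂ :=
  ∑' k, mconj (ψ k) *ᵥ c (k + m)

/-- `a_{-μ̄}(m) = ∑_{l = max(m,0)}^{m + n(γ)} e_γ(l - m) a(l)`. -/
def aNeg {r T : ℕ} (μ s d : Fin r → ℕ) (a : ℕ → Fin T → ℂ) (m : ℤ) : Fin T → ℂ :=
  ∑ l ∈ Finset.Icc (max m 0) (m + (nGamma μ s d : ℤ)),
    (eGamma μ s d (l - m).toNat : ℂ) • a l.toNat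

/-- The sequence `a_{-μ̄}(k)`, `k ≥ 0`. -/
def aMinus {r T : ℕ} (μ s d : Fin r → ℕ) (a : ℕ → Fin T → ℂ) (k : ℕ) : Fin T → ℂ :=
  aNeg μ s d a (k : ℤ)

/-- `b_{-μ̄}(k) = a_{-μ̄}(-k)` for `1 ≤ k ≤ n(γ)`, and `0` for all other `k ≥ 0`. -/
def bMinus {r T : ℕ} (μ s d : Fin r → ℕ) (a : ℕ → Fin T → ℂ) (k : ℕ) : Fin T → ℂ :=
  if 1 ≤ k ∧ k ≤ nGamma μ s d then aNeg μ s d a (-(k : ℤ)) else 0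

/-! ### The filtering problem -/

/-- `A = ∑_{k ≥ 0} a(k)ᵀ x(-k)`, with convergence in probability. -/
def IsFunctional {Ω : Type*} [MeasurableSpace Ω] (P : Measure Ω) {T : ℕ}
    (a : ℕ → Fin T → ℂ) (x : ℤ → Fin T → Ω → ℂ) (A : Ω → ℂ) : Prop :=
  TendstoInMeasure P
    (fun N ω => ∑ k ∈ Finset.range N, ∑ p, a k p * x (-(k : ℤ)) p ω) atTop A

/-- Linear estimates based on `ζ(0), ζ(-1), …`: the random variables `Aζ - Y`, where `Y`
lies in the closed span in `L₂(Ω)` of the increments `χ_μ̄(ζ_l(k))`, `k ≤ 0`. -/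
def IsLinearEstimate {Ω : Type*} [MeasurableSpace Ω] (P : Measure Ω) {r T : ℕ}
    (μ : Fin r → ℤ) (s d : Fin r → ℕ) (ζ : ℤ → Fin T → Ω → ℂ) (Aζ Ahat : Ω → ℂ) : Prop :=
  ∃ Y : Ω → ℂ, MemLp Y 2 P ∧
    (∀ ε : ℝ≥0∞, 0 < ε → ∃ c : (ℕ × Fin T) →₀ ℂ,
      eLpNorm (fun ω => Y ω - c.sum fun kl z =>
        z * gmIncr μ s d (fun k => ζ k kl.2) (-(kl.1 : ℤ)) ω) 2 P < ε) ∧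
    Ahat =ᵐ[P] fun ω => Aζ ω - Y ω

/-- `Ahat` is the mean square optimal linear estimate of `Aξ` (unique up to null sets). -/
def IsOptimalEstimate {Ω : Type*} [MeasurableSpace Ω] (P : Measure Ω) {r T : ℕ}
    (μ : Fin r → ℤ) (s d : Fin r → ℕ) (ζ : ℤ → Fin T → Ω → ℂ) (Aξ Aζ Ahat : Ω → ℂ) : Prop :=
  IsLinearEstimate P μ s d ζ Aζ Ahat ∧
    MemLp (fun ω => Aξ ω - Ahat ω) 2 P ∧
    ∀ B : Ω → ℂ, IsLinearEstimate P μ s d ζ Aζ B →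
      eLpNorm (fun ω => Aξ ω - Ahat ω) 2 P ≤ eLpNorm (fun ω => Aξ ω - B ω) 2 P ∧
      (eLpNorm (fun ω => Aξ ω - B ω) 2 P = eLpNorm (fun ω => Aξ ω - Ahat ω) 2 P →
        B =ᵐ[P] Ahat)

end GMFilter

end

open GMFilter

/-! Since Aξ = Aζ − Aη, the error of an estimate Aζ − Y is Y − Aη, so Aξ drops out and the best Y is
the orthogonal projection of Aη on the closed span H of the observed increments. The series Aη
converges in L₂(Ω) because Σ‖a(k)‖ < ∞.

Everything is carried to vector functions in L₂[-π, π). By uncorrelatedness, the increments of ζ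
have the same Gram matrix as the functions e^{iwm} χ_ν β⁻¹ δ_l in L₂(p). The map h ↦ (β/χ_μ) Θᵀ h is
an isometry of L₂(p) into `VecL2 q`, with dense range because ΨΘ = 1. It sends the increments with
step μ to rows of Θ multiplied by e^{-iwk}. This gives an isometry U of `VecL2 q` into L₂(Ω)
(`exists_isometry_obsIncr`). The images of indicators of [-π, t) under U form the process Z. An
integral with respect to any spectral process is determined by the increments, through closedness of
the integration relation (`mem_of_graph`). In the same way η corresponds to the shifted rows of Φ,
and Aη to Σ a(k)ᵀ e^{-iwk} Φ (`synth`).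

Let X be the pullback of the projection of Aη. It lies in the closed span of e^{-iwk} times the rows
of Θ, k ≥ 0, so its entries are in the Hardy space. The normal equations say that the coefficients
of order k ≥ 0 of Σ_j conj Θ_{lj} X_j are c⁻(k) + c⁺(k). Here moving χ_μ to the other side of the
inner product replaces a by its correlation with e_γ, whose nonnegative part is a_{-μ} and whose
negative part gives b_{-μ} (`inner_incrRow_synth`).

To solve them one multiplies by conj Ψ: it contains only the frequencies e^{iwk}, k ≥ 0, so
coefficients of order m ≥ 0 of the product should depend only on coefficients of order ≥ m of the
data. The result is x_m = Σ conj ψ(k) c(k+m) (`coef_eq_sum_inner`). The difficulty is integrability: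
Ψ, Θ and X are only square integrable, and a triple product need not be integrable, though the
relevant sum is, since ΨΘ = 1. The vanishing theorem `integral_sum_conj_mul_eq_zero` deals with
this. It multiplies by bounded outer functions (`exists_outer`, prediction errors for an integrable
weight), for which all products become harmless, and lets these multipliers tend to 1.

Finally h = (χ_μ/β) Ψᵀ X is the preimage of X, and the error is ‖Aη‖² − ‖X‖², where Parseval
evaluates both norms. -/

noncomputable section

namespace GMFilter

/-! ### Fourier analysis on `[-π, π)` -/

/-- The character `e^{-iwk}`. -/
def ez (k : ℤ) (w : ℝ) : ℂ := Complex.exp (-(Complex.I * w * (k : ℂ)))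

lemma continuous_ez (k : ℤ) : Continuous (ez k) := by unfold ez; fun_prop

@[simp] lemma norm_ez (k : ℤ) (w : ℝ) : ‖ez k w‖ = 1 := by
  have : ez k w = Complex.exp (((-(w * k) : ℝ) : ℂ) * Complex.I) := by
    unfold ez; push_cast; ring_nf
  rw [this, Complex.norm_exp_ofReal_mul_I]

@[simp] lemma ez_zero (w : ℝ) : ez 0 w = 1 := by simp [ez]

lemma ez_add (k l : ℤ) (w : ℝ) : ez (k + l) w = ez k w * ez l w := by
  simp only [ez, ← Complex.exp_add]; push_cast; ring_nf

lemma conj_ez (k : ℤ) (w : ℝ) : conj (ez k w) = ez (-k) w := by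
  simp only [ez, ← Complex.exp_conj]; simp

instance isProbabilityMeasure_circ : IsProbabilityMeasure circ := by
  constructor
  have : (0 : ℝ) < 2 * π := by positivity
  simp only [circ, Measure.smul_apply, Measure.restrict_apply_univ, Real.volume_Ico, smul_eq_mul]
  rw [← ENNReal.ofReal_mul (by positivity)]
  rw [show (2 * π)⁻¹ * (π - -π) = 1 by field_simp; ring]
  simp

lemma circ_absolutelyContinuous : circ ≪ volume :=
  (Measure.absolutelyContinuous_of_le Measure.restrict_le_self).smul_left _

instance nullSingletonClass_circ : NullSingletonClass circ := ⟨fun x => circ_absolutelyContinuous (by simp)⟩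

lemma ae_circ_of_restrict {p : ℝ → Prop} (h : ∀ᵐ w ∂(volume.restrict (Set.Ico (-π) π)), p w) :
    ∀ᵐ w ∂circ, p w :=
  (Measure.AbsolutelyContinuous.rfl.smul_left _ :
    circ ≪ volume.restrict (Set.Ico (-π) π)).ae_le h

lemma integral_circ {E : Type*} [NormedAddCommGroup E] [NormedSpace ℝ E] (f : ℝ → E) :
    ∫ w, f w ∂circ = (2 * π)⁻¹ • ∫ w in Set.Ico (-π) π, f w := by
  rw [circ, integral_smul_measure, ENNReal.toReal_ofReal (by positivity)]

lemma integrable_circ_iff {E : Type*} [NormedAddCommGroup E] (f : ℝ → E) :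
    Integrable f circ ↔ IntegrableOn f (Set.Ico (-π) π) := by
  rw [circ, integrable_smul_measure _ ENNReal.ofReal_ne_top, IntegrableOn]
  simp [Real.pi_pos]

lemma ae_mem_Ico : ∀ᵐ w ∂circ, w ∈ Set.Ico (-π) π :=
  ae_circ_of_restrict (ae_restrict_mem measurableSet_Ico)

lemma integral_ez (k : ℤ) : ∫ w, ez k w ∂circ = if k = 0 then 1 else 0 := by
  split_ifs with h
  · subst h; simp
  · rw [integral_circ, integral_Ico_eq_integral_Ioc,
      ← intervalIntegral.integral_of_le (by linarith [Real.pi_pos])]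
    have : ∀ w : ℝ, ez k w = Complex.exp ((-(Complex.I * k)) * w) := by
      intro w; unfold ez; ring_nf
    simp_rw [this]
    rw [integral_exp_mul_complex (by simp [h])]
    have h1 : Complex.exp (-(Complex.I * k) * (π : ℝ)) = Complex.exp (-(Complex.I * k) * (-π : ℝ)) := by
      rw [Complex.exp_eq_exp_iff_exists_int]
      exact ⟨-k, by push_cast; ring⟩
    rw [h1]; simp

/-- An integrable function on `[-π, π)` is determined by its Fourier coefficients. -/
lemma ae_eq_zero_of_integral_ez_mul {f : ℝ → ℂ} (hf : Integrable f circ)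
    (h : ∀ k : ℤ, ∫ w, ez k w * f w ∂circ = 0) : f =ᵐ[circ] 0 := by
  have hT : Fact (0 < 2 * π) := ⟨by positivity⟩
  have hint : ∀ Φ : C(AddCircle (2 * π), ℂ), Integrable (fun w : ℝ => Φ w * f w) circ := fun Φ =>
    hf.bdd_mul (c := ‖Φ‖)
      ((Φ.continuous.comp (AddCircle.continuous_mk' _)).aestronglyMeasurable)
      (ae_of_all _ fun w => Φ.norm_coe_le_norm _)
  let Λ : C(AddCircle (2 * π), ℂ) →L[ℂ] ℂ := LinearMap.mkContinuous
    { toFun := fun Φ => ∫ w : ℝ, Φ w * f w ∂circ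
      map_add' := fun Φ Φ' => by
        rw [← integral_add (hint _) (hint _)]; simp [add_mul]
      map_smul' := fun c Φ => by
        simp only [RingHom.id_apply, smul_eq_mul, ← integral_const_mul, ContinuousMap.smul_apply,
          mul_assoc] }
    (∫ w, ‖f w‖ ∂circ) (fun Φ => by
      rw [mul_comm (∫ w, ‖f w‖ ∂circ), ← integral_const_mul]
      refine norm_integral_le_of_norm_le (hf.norm.const_mul _) (ae_of_all _ fun w => ?_)
      rw [norm_mul]
      gcongr
      exact Φ.norm_coe_le_norm _)
  -- Trigonometric polynomials are dense in the continuous functions on the circle, so the bounded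
  -- functional `Λ` vanishes identically.
  have hΛ : Λ = 0 := by
    refine ContinuousLinearMap.ext_on (s := Set.range (@fourier (2 * π))) ?_ ?_
    · rw [dense_iff_closure_eq, ← Submodule.topologicalClosure_coe, span_fourier_closure_eq_top]
      rfl
    · rintro _ ⟨n, rfl⟩
      change ∫ w : ℝ, fourier n (w : AddCircle (2 * π)) * f w ∂circ = 0
      rw [← h (-n)]
      congr 1; ext w
      rw [fourier_coe_apply, ez]
      congr 2; push_cast; field_simp
  have hloc : IntegrableOn f (Set.Ico (-π) π) := (integrable_circ_iff f).1 hf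
  -- Test functions supported in the open interval vanish at both endpoints, so they extend to
  -- continuous functions on the circle, where `Λ = 0` applies. The point -π is null.
  have hU : ∀ᵐ w, w ∈ Set.Ioo (-π) π → f w = 0 := by
    refine isOpen_Ioo.ae_eq_zero_of_integral_contDiff_smul_eq_zero
      ((hloc.mono_set Set.Ioo_subset_Ico_self).locallyIntegrableOn) ?_
    intro φ hφ _ hsupp
    have h0 : ∀ w, w ∉ Set.Ioo (-π) π → φ w = 0 := fun w hw =>
      image_eq_zero_of_notMem_tsupport fun h' => hw (hsupp h')
    have hcont : Continuous (AddCircle.liftIco (2 * π) (-π) (fun w => (φ w : ℂ))) := by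
      refine AddCircle.liftIco_continuous ?_ ?_
      · rw [h0 _ (by simp), h0 _ (by rw [show -π + 2 * π = π by ring]; simp)]
      · exact (Complex.continuous_ofReal.comp hφ.continuous).continuousOn
    have := congrArg (fun L => L (⟨_, hcont⟩ : C(AddCircle (2 * π), ℂ))) hΛ
    change ∫ w : ℝ, AddCircle.liftIco (2 * π) (-π) (fun w => (φ w : ℂ)) w * f w ∂circ = 0 at this
    rw [integral_circ, smul_eq_zero_iff_right (by positivity)] at this
    rw [← setIntegral_eq_integral_of_forall_compl_eq_zero (s := Set.Ico (-π) π)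
      (fun w hw => by rw [h0 w (fun h' => hw (Set.Ioo_subset_Ico_self h'))]; simp), ← this]
    refine setIntegral_congr_fun measurableSet_Ico fun w hw => ?_
    rw [AddCircle.liftIco_coe_apply (by rwa [show -π + 2 * π = π by ring])]
    simp
  have h1 := circ_absolutelyContinuous.ae_le hU
  filter_upwards [h1, ae_mem_Ico, compl_mem_ae_iff.2 (measure_singleton (μ := circ) (-π))]
    with w hw hw' hw''
  exact hw ⟨lt_of_le_of_ne hw'.1 (Ne.symm hw''), hw'.2⟩

/-- An integrable function on `[-π, π)` with zero integrals over all `[-π, t)` vanishes. -/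
lemma ae_eq_zero_of_integral_Ico {f : ℝ → ℂ} (hf : Integrable f circ)
    (h : ∀ t ∈ Set.Ico (-π) π, ∫ w in Set.Ico (-π) t, f w ∂circ = 0) : f =ᵐ[circ] 0 := by
  have hempty : ∀ t ≤ -π, circ.restrict (Set.Iio t) = 0 := fun t ht => by
    rw [Measure.restrict_eq_zero, ← nonpos_iff_eq_zero]
    refine (measure_mono (fun w hw => ?_)).trans (ae_mem_Ico : circ (Set.Ico (-π) π)ᶜ = 0).le
    exact fun h' => absurd h'.1 (not_le.2 (lt_of_lt_of_le hw ht))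
  have hIio : ∀ t < π, ∫ w in Set.Iio t, f w ∂circ = 0 := by
    intro t ht
    rcases le_or_gt t (-π) with ht' | ht'
    · simp [hempty t ht']
    · rw [← h t ⟨ht'.le, ht⟩]
      refine setIntegral_congr_set ?_
      filter_upwards [ae_mem_Ico] with w hw
      exact propext ⟨fun h' => ⟨hw.1, h'⟩, fun h' => h'.2⟩
  -- The hypothesis stops short of t = π; the total integral is recovered by exhausting (-∞, π) with
  -- smaller half-lines.
  have hfull : ∫ w, f w ∂circ = 0 := by
    have h1 : Tendsto (fun n : ℕ => ∫ w in Set.Iio (π - 1 / (n + 1 : ℝ)), f w ∂circ) atTop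
        (𝓝 (∫ w in ⋃ n : ℕ, Set.Iio (π - 1 / (n + 1 : ℝ)), f w ∂circ)) := by
      refine tendsto_setIntegral_of_monotone (fun _ => measurableSet_Iio) ?_ hf.integrableOn
      intro m n hmn
      apply Set.Iio_subset_Iio
      have := Nat.one_div_le_one_div (α := ℝ) hmn
      linarith
    have h2 : (⋃ n : ℕ, Set.Iio (π - 1 / (n + 1 : ℝ))) = Set.Iio π := by
      ext w
      simp only [Set.mem_iUnion, Set.mem_Iio]
      constructor
      · rintro ⟨n, hn⟩
        have : (0 : ℝ) < 1 / (n + 1 : ℝ) := by positivity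
        linarith
      · intro hw
        obtain ⟨n, hn⟩ := exists_nat_one_div_lt (sub_pos.2 hw)
        exact ⟨n, by linarith⟩
    have h3 : ∀ n : ℕ, ∫ w in Set.Iio (π - 1 / (n + 1 : ℝ)), f w ∂circ = 0 := fun n =>
      hIio _ (by have : (0 : ℝ) < 1 / (n + 1 : ℝ) := by positivity
                 linarith)
    simp only [h3, h2] at h1
    have h4 := tendsto_nhds_unique h1 tendsto_const_nhds
    rw [← h4, ← setIntegral_univ (μ := circ) (f := f)]
    refine setIntegral_congr_set ?_
    filter_upwards [ae_mem_Ico] with w hw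
    exact propext ⟨fun _ => hw.2, fun _ => trivial⟩
  have hIio' : ∀ t, ∫ w in Set.Iio t, f w ∂circ = 0 := by
    intro t
    rcases lt_or_ge t π with ht | ht
    · exact hIio t ht
    · rw [← hfull, ← setIntegral_univ (μ := circ) (f := f)]
      refine setIntegral_congr_set ?_
      filter_upwards [ae_mem_Ico] with w hw
      exact propext ⟨fun _ => trivial, fun _ => lt_of_lt_of_le hw.2 ht⟩
  -- The half-lines `Set.Iio t` are a π-system generating the Borel sets, and sets with zero
  -- integral are stable under complements and disjoint unions.
  refine hf.ae_eq_zero_of_forall_setIntegral_eq_zero fun s hs hs' => ?_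
  clear hs'
  induction s, hs using MeasurableSpace.induction_on_inter
    (BorelSpace.measurable_eq.trans (borel_eq_generateFrom_Iio ℝ)) isPiSystem_Iio with
  | empty => simp
  | basic u hu => obtain ⟨t, rfl⟩ := hu; exact hIio' t
  | compl u hu ih => rw [setIntegral_compl hu hf, hfull, ih, sub_zero]
  | iUnion F hd hm ih =>
    rw [integral_iUnion hm hd hf.integrableOn]; simp [ih]

/-! ### The space `L₂[-π, π)` and its Hardy subspace -/

lemma inner_Lp_eq {α : Type*} [MeasurableSpace α] {ν : Measure α} (x y : Lp ℂ 2 ν) :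
    inner ℂ x y = ∫ w, conj (x w) * y w ∂ν := by
  rw [L2.inner_def]
  refine integral_congr_ae (ae_of_all _ fun w => ?_)
  simp [mul_comm]

lemma inner_eq_integral_of_ae {α : Type*} [MeasurableSpace α] {ν : Measure α} {x y : Lp ℂ 2 ν}
    {F G : α → ℂ} (hx : x =ᵐ[ν] F) (hy : y =ᵐ[ν] G) :
    inner ℂ x y = ∫ w, conj (F w) * G w ∂ν := by
  rw [inner_Lp_eq]
  refine integral_congr_ae ?_
  filter_upwards [hx, hy] with w h1 h2
  rw [h1, h2]

lemma memLp_bdd_mul {α : Type*} [MeasurableSpace α] {ν : Measure α} {m F : α → ℂ}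
    (hm : AEStronglyMeasurable m ν) (C : ℝ) (hC : ∀ᵐ w ∂ν, ‖m w‖ ≤ C) (hF : MemLp F 2 ν) :
    MemLp (fun w => m w * F w) 2 ν := by
  refine hF.of_le_mul (c := C) (hm.mul hF.1) ?_
  filter_upwards [hC] with w hw
  rw [norm_mul]; gcongr

lemma memLp_ez_mul {F : ℝ → ℂ} (k : ℤ) (hF : MemLp F 2 circ) :
    MemLp (fun w => ez k w * F w) 2 circ :=
  memLp_bdd_mul (continuous_ez k).aestronglyMeasurable 1 (ae_of_all _ fun w => by simp) hF

lemma integrable_conj_mul {α : Type*} [MeasurableSpace α] {ν : Measure α} {F G : α → ℂ}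
    (hF : MemLp F 2 ν) (hG : MemLp G 2 ν) : Integrable (fun w => conj (F w) * G w) ν :=
  hF.star.integrable_mul hG

lemma memLp_ez (k : ℤ) : MemLp (ez k) 2 circ :=
  MemLp.of_bound (continuous_ez k).aestronglyMeasurable 1 (ae_of_all _ fun w => by simp)

/-- Multiplication by `e^{-iwk}` on `L₂[-π, π)`. -/
def mulEz (k : ℤ) : Lp ℂ 2 circ →ₗᵢ[ℂ] Lp ℂ 2 circ where
  toFun x := (memLp_ez_mul k (Lp.memLp x)).toLp
  map_add' x y := by
    rw [← MemLp.toLp_add]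
    refine MemLp.toLp_congr _ _ ?_
    filter_upwards [Lp.coeFn_add x y] with w hw
    rw [hw, Pi.add_apply, mul_add]; rfl
  map_smul' c x := by
    rw [RingHom.id_apply, ← MemLp.toLp_const_smul]
    refine MemLp.toLp_congr _ _ ?_
    filter_upwards [Lp.coeFn_smul c x] with w hw
    simp only [hw, Pi.smul_apply, smul_eq_mul]; ring
  norm_map' x := by
    simp only [LinearMap.coe_mk, AddHom.coe_mk]
    rw [Lp.norm_toLp, Lp.norm_def]
    congr 1
    exact eLpNorm_congr_norm_ae (ae_of_all _ fun w => by simp)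

lemma coeFn_mulEz (k : ℤ) (x : Lp ℂ 2 circ) : mulEz k x =ᵐ[circ] fun w => ez k w * x w :=
  (memLp_ez_mul k (Lp.memLp x)).coeFn_toLp

lemma mulEz_toLp (k : ℤ) {F : ℝ → ℂ} (hF : MemLp F 2 circ) :
    mulEz k (hF.toLp) = (memLp_ez_mul k hF).toLp := by
  ext1
  filter_upwards [coeFn_mulEz k hF.toLp, hF.coeFn_toLp, (memLp_ez_mul k hF).coeFn_toLp]
    with w h1 h2 h3
  rw [h1, h2, h3]

/-- The closed span in `L₂[-π, π)` of `e^{-iwk}`, `k ≥ 0`. -/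
def hardy : Submodule ℂ (Lp ℂ 2 circ) :=
  (Submodule.span ℂ (Set.range fun k : ℕ => (memLp_ez (k : ℤ)).toLp)).topologicalClosure

lemma isClosed_hardy : IsClosed (hardy : Set (Lp ℂ 2 circ)) :=
  Submodule.isClosed_topologicalClosure _

lemma ez_mem_hardy (k : ℕ) : (memLp_ez (k : ℤ)).toLp ∈ hardy :=
  Submodule.le_topologicalClosure _ (Submodule.subset_span ⟨k, rfl⟩)

lemma mulEz_ez (k l : ℤ) : mulEz k ((memLp_ez l).toLp) = (memLp_ez (k + l)).toLp := by
  rw [mulEz_toLp]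
  exact MemLp.toLp_congr _ _ (ae_of_all _ fun w => (ez_add k l w).symm)

lemma mulEz_mem_hardy (k : ℕ) {x : Lp ℂ 2 circ} (hx : x ∈ hardy) : mulEz k x ∈ hardy := by
  have : hardy ≤ hardy.comap (mulEz (k : ℤ)).toLinearMap := by
    refine Submodule.topologicalClosure_minimal _ ?_
      (isClosed_hardy.preimage (mulEz (k : ℤ)).continuous)
    rw [Submodule.span_le]
    rintro _ ⟨j, rfl⟩
    change mulEz k ((memLp_ez (j : ℤ)).toLp) ∈ hardy
    rw [mulEz_ez]
    exact_mod_cast ez_mem_hardy (k + j)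
  exact this hx

instance : CompleteSpace hardy := isClosed_hardy.completeSpace_coe

/-- A closed subspace is its own double orthogonal complement; this tests membership without
constructing approximating polynomials. -/
lemma mem_hardy_of_forall {x : Lp ℂ 2 circ}
    (h : ∀ y : Lp ℂ 2 circ, (∀ z ∈ hardy, inner ℂ z y = 0) → inner ℂ x y = 0) : x ∈ hardy := by
  rw [← Submodule.orthogonal_orthogonal hardy, Submodule.mem_orthogonal']
  exact fun y hy => h y fun z hz => (Submodule.mem_orthogonal _ _).1 hy z hz

lemma inner_eq_zero_of_mem_hardy {x y : Lp ℂ 2 circ} (hx : x ∈ hardy)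
    (h : ∀ k : ℕ, inner ℂ ((memLp_ez (k : ℤ)).toLp) y = 0) : inner ℂ x y = 0 := by
  have : hardy ≤ LinearMap.ker (innerSL ℂ y).toLinearMap := by
    refine Submodule.topologicalClosure_minimal _ ?_ (innerSL ℂ y).isClosed_ker
    rw [Submodule.span_le]
    rintro _ ⟨k, rfl⟩
    have := h k
    rw [← inner_conj_symm, map_eq_zero] at this
    simpa using this
  have h2 := this hx
  rw [← inner_conj_symm, map_eq_zero]
  simpa using h2

/-! ### Outer multipliers and the vanishing theorem of Smirnov type -/

/-- For an integrable weight `ω = σ² ≥ 1` there is `e` in the closed span of `e^{-iwk}`, `k ≥ 0`, in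
the weighted `L₂` space, close to `1` when `∫ ω` is, with `|e|² ω` constant. -/
lemma exists_outer {σ : ℝ → ℝ} (hσ : MemLp (fun w => (σ w : ℂ)) 2 circ) (h1 : ∀ w, 1 ≤ σ w) :
    ∃ (e : ℝ → ℂ) (c : ℝ), AEStronglyMeasurable e circ ∧
      (∀ᵐ w ∂circ, ‖e w‖ ^ 2 * σ w ^ 2 = c) ∧ c ≤ ∫ w, σ w ^ 2 ∂circ ∧
      ∫ w, ‖e w - 1‖ ^ 2 ∂circ ≤ ∫ w, σ w ^ 2 ∂circ - 1 ∧
      ∀ V : ℝ → ℂ, MemLp (fun w => V w / σ w) 2 circ →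
        (∀ k : ℕ, ∫ w, conj (ez k w) * V w ∂circ = 0) → ∫ w, conj (e w) * V w ∂circ = 0 := by
  have h0 : ∀ w, (0 : ℝ) < σ w := fun w => lt_of_lt_of_le one_pos (h1 w)
  have h0' : ∀ w, (σ w : ℂ) ≠ 0 := fun w => by exact_mod_cast (h0 w).ne'
  obtain ⟨u, hu, hmul⟩ : ∃ u : ℕ → Lp ℂ 2 circ, (∀ k, u k =ᵐ[circ] fun w => ez k w * σ w) ∧
      ∀ k j : ℕ, mulEz k (u j) = u (k + j) := by
    refine ⟨fun k => (memLp_ez_mul (k : ℤ) hσ).toLp, fun k => MemLp.coeFn_toLp _, fun k j => ?_⟩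
    rw [mulEz_toLp]
    refine MemLp.toLp_congr _ _ (ae_of_all _ fun w => ?_)
    simp only [Nat.cast_add, ez_add, mul_assoc]
  -- One-step prediction for the weight σ²: the future `K` is spanned by e^{-iwk}σ with k ≥ 1, and
  -- `E` is the part of σ orthogonal to it. The multiplier will be E/σ.
  obtain ⟨K, hK⟩ : ∃ K, K = (Submodule.span ℂ (Set.range fun k : ℕ => u (k + 1))).topologicalClosure :=
    ⟨_, rfl⟩
  have hKc : IsClosed (K : Set (Lp ℂ 2 circ)) := by
    rw [hK]; exact Submodule.isClosed_topologicalClosure _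
  have hKmin : ∀ M : Submodule ℂ (Lp ℂ 2 circ), IsClosed (M : Set (Lp ℂ 2 circ)) →
      (∀ k, u (k + 1) ∈ M) → K ≤ M := fun M hM h => by
    rw [hK]
    refine Submodule.topologicalClosure_minimal _ ?_ hM
    rw [Submodule.span_le]
    rintro _ ⟨k, rfl⟩
    exact h k
  have : CompleteSpace K := hKc.completeSpace_coe
  have huK : ∀ k, u (k + 1) ∈ K := fun k => hK ▸
    Submodule.le_topologicalClosure _ (Submodule.subset_span ⟨k, rfl⟩)
  obtain ⟨E, hE⟩ : ∃ E, E = u 0 - K.starProjection (u 0) := ⟨_, rfl⟩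
  have hEK : ∀ y ∈ K, inner ℂ y E = 0 := fun y hy => hE ▸
    Submodule.inner_right_of_mem_orthogonal hy (K.sub_starProjection_mem_orthogonal (u 0))
  have hPK : K.starProjection (u 0) ∈ K := K.starProjection_apply_mem _
  -- `E` is orthogonal to `K` while its proper shifts lie in `K`. Hence every nonzero Fourier
  -- coefficient of |E|² vanishes and |E|² is constant.
  have hshift : ∀ k : ℕ, mulEz ((k + 1 : ℕ) : ℤ) E ∈ K := by
    intro k
    have hle : K ≤ K.comap (mulEz ((k + 1 : ℕ) : ℤ)).toLinearMap := by
      refine hKmin _ (hKc.preimage (mulEz ((k + 1 : ℕ) : ℤ)).continuous) fun j => ?_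
      change mulEz ((k + 1 : ℕ) : ℤ) (u (j + 1)) ∈ K
      rw [hmul, ← add_assoc]; exact huK _
    rw [hE, map_sub]
    refine K.sub_mem ?_ (hle hPK)
    rw [hmul]; exact huK k
  have hEmem : MemLp E 2 circ := Lp.memLp E
  have hsq : Integrable (fun w => ‖E w‖ ^ 2) circ := hEmem.integrable_norm_pow (by norm_num)
  have hcoef : ∀ k : ℕ, ∫ w, conj (ez ((k + 1 : ℕ) : ℤ) w) * ((‖E w‖ ^ 2 : ℝ) : ℂ) ∂circ = 0 := by
    intro k
    rw [← hEK _ (hshift k), inner_eq_integral_of_ae (coeFn_mulEz _ E) (ae_eq_refl _)]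
    refine integral_congr_ae (ae_of_all _ fun w => ?_)
    simp only [map_mul, mul_assoc, Complex.conj_mul']
    norm_cast
  let c : ℝ := ∫ w, ‖E w‖ ^ 2 ∂circ
  have hconst : ∀ᵐ w ∂circ, ‖E w‖ ^ 2 = c := by
    have : (fun w => ((‖E w‖ ^ 2 : ℝ) : ℂ) - (c : ℂ)) =ᵐ[circ] 0 := by
      refine ae_eq_zero_of_integral_ez_mul (hsq.ofReal.sub (integrable_const _)) fun k => ?_
      have hsub : ∫ w, ez k w * (((‖E w‖ ^ 2 : ℝ) : ℂ) - (c : ℂ)) ∂circ =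
          ∫ w, ez k w * ((‖E w‖ ^ 2 : ℝ) : ℂ) ∂circ - (∫ w, ez k w ∂circ) * c := by
        rw [← integral_mul_const, ← integral_sub]
        · simp only [mul_sub]
        · exact hsq.ofReal.bdd_mul (c := 1) (continuous_ez k).aestronglyMeasurable
            (ae_of_all _ fun w => by simp)
        · exact ((memLp_ez k).integrable (by norm_num)).mul_const _
      rw [hsub, integral_ez]
      rcases lt_trichotomy k 0 with hk | hk | hk
      · have := hcoef (-k - 1).toNat
        rw [show (((-k - 1).toNat + 1 : ℕ) : ℤ) = -k by omega] at this
        simp only [conj_ez, neg_neg] at this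
        rw [this, if_neg hk.ne]; simp
      · subst hk
        simp only [ez_zero, one_mul, if_true, c]
        rw [integral_complex_ofReal, sub_self]
      · have := congrArg conj (hcoef (k - 1).toNat)
        rw [show (((k - 1).toNat + 1 : ℕ) : ℤ) = k by omega, ← integral_conj] at this
        simp only [map_mul, Complex.conj_conj, Complex.conj_ofReal, map_zero] at this
        rw [this, if_neg hk.ne']; simp
    filter_upwards [this] with w hw
    simp only [Pi.zero_apply, sub_eq_zero] at hw
    exact_mod_cast hw
  have hnorm : ‖E‖ ^ 2 = c := by
    have := inner_self_eq_norm_sq_to_K (𝕜 := ℂ) E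
    rw [inner_Lp_eq] at this
    simp only [Complex.conj_mul'] at this
    have h2 : ∫ w, ((‖E w‖ : ℂ)) ^ 2 ∂circ = ((c : ℝ) : ℂ) := by
      simp only [c]
      rw [← integral_complex_ofReal]; norm_cast
    rw [h2] at this
    change (c : ℂ) = ((‖E‖ : ℝ) : ℂ) ^ 2 at this
    rw [← Complex.ofReal_pow] at this
    exact (Complex.ofReal_injective this).symm
  have hnorm0 : ‖u 0‖ ^ 2 = ∫ w, σ w ^ 2 ∂circ := by
    have := inner_self_eq_norm_sq_to_K (𝕜 := ℂ) (u 0)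
    rw [inner_eq_integral_of_ae (hu 0) (hu 0)] at this
    simp only [Nat.cast_zero, ez_zero, one_mul, Complex.conj_ofReal, ← Complex.ofReal_mul] at this
    rw [integral_complex_ofReal] at this
    change _ = ((‖u 0‖ : ℝ) : ℂ) ^ 2 at this
    rw [← Complex.ofReal_pow] at this
    have h2 : ∫ w, σ w * σ w ∂circ = ‖u 0‖ ^ 2 := Complex.ofReal_injective this
    rw [← h2]; simp only [sq]
  have hcle : c ≤ ∫ w, σ w ^ 2 ∂circ := by
    rw [← hnorm, ← hnorm0]
    have : ‖E‖ ≤ ‖u 0‖ := by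
      have h2 : E = Kᗮ.starProjection (u 0) := by
        rw [Submodule.starProjection_orthogonal', hE]; simp
      rw [h2]; exact Submodule.norm_starProjection_apply_le _ _
    gcongr
  have hinv : MemLp (fun w => ((σ w)⁻¹ : ℂ)) 2 circ := by
    refine MemLp.of_bound (hσ.1.aemeasurable.inv.aestronglyMeasurable) 1 (ae_of_all _ fun w => ?_)
    rw [norm_inv, Complex.norm_real, Real.norm_of_nonneg (h0 w).le]
    exact inv_le_one_of_one_le₀ (h1 w)
  -- A vector orthogonal to `K` does not see the projection, so it pairs with `E` as with `u 0`.
  -- Taking 1/σ shows that E/σ has mean one; taking V/σ gives the last assertion.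
  have hdual : ∀ (y : Lp ℂ 2 circ), (∀ k, inner ℂ (u (k + 1)) y = 0) →
      inner ℂ E y = inner ℂ (u 0) y := by
    intro y hy
    have hle : K ≤ LinearMap.ker (innerSL ℂ y).toLinearMap := by
      refine hKmin _ (innerSL ℂ y).isClosed_ker fun k => ?_
      have := hy k
      rw [← inner_conj_symm, map_eq_zero] at this
      simpa using this
    have h2 : inner ℂ y (K.starProjection (u 0)) = 0 := by simpa using hle hPK
    rw [hE, inner_sub_left, ← inner_conj_symm (K.starProjection (u 0)), h2]
    simp
  have hmean : ∫ w, E w / σ w ∂circ = 1 := by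
    have h2 := hdual hinv.toLp (fun k => by
      rw [inner_eq_integral_of_ae (hu _) hinv.coeFn_toLp]
      have : ∀ w, conj (ez ((k + 1 : ℕ) : ℤ) w * (σ w : ℂ)) * ((σ w : ℂ))⁻¹ =
          ez (-((k + 1 : ℕ) : ℤ)) w := fun w => by
        rw [map_mul, Complex.conj_ofReal, conj_ez, mul_assoc, mul_inv_cancel₀ (h0' w), mul_one]
      simp only [this, integral_ez]
      rw [if_neg (by omega)])
    rw [inner_eq_integral_of_ae (ae_eq_refl _) hinv.coeFn_toLp,
      inner_eq_integral_of_ae (hu _) hinv.coeFn_toLp] at h2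
    have h3 : ∀ w, conj (ez ((0 : ℕ) : ℤ) w * (σ w : ℂ)) * ((σ w : ℂ))⁻¹ = 1 := fun w => by
      simp [h0' w]
    simp only [h3, integral_const, probReal_univ, one_smul] at h2
    have h4 := congrArg conj h2
    rw [← integral_conj] at h4
    simpa [div_eq_mul_inv] using h4
  have hee : MemLp (fun w => E w / σ w) 2 circ := by
    refine hEmem.mono (hEmem.1.mul hinv.1) (ae_of_all _ fun w => ?_)
    rw [norm_div, Complex.norm_real, Real.norm_of_nonneg (h0 w).le]
    exact div_le_self (norm_nonneg _) (h1 w)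
  refine ⟨fun w => E w / σ w, c, hee.1, ?_, hcle, ?_, ?_⟩
  · filter_upwards [hconst] with w hw
    rw [norm_div, Complex.norm_real, Real.norm_of_nonneg (h0 w).le, div_pow,
      div_mul_cancel₀ _ (by have := h0 w; positivity), hw]
  -- As e = E/σ has mean one, ∫|e − 1|² = ∫|e|² − 1, and |e| ≤ |E| because σ ≥ 1.
  · have hi1 : Integrable (fun w => ‖E w / σ w‖ ^ 2) circ := hee.integrable_norm_pow (by norm_num)
    have hi2 : Integrable (fun w => (E w / σ w).re) circ :=
      (hee.integrable (by norm_num)).re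
    have hpt : ∀ w, ‖E w / σ w - 1‖ ^ 2 = ‖E w / σ w‖ ^ 2 - 2 * (E w / σ w).re + 1 := fun w => by
      rw [Complex.sq_norm, Complex.sq_norm, Complex.normSq_sub]
      simp; ring
    simp only [hpt]
    rw [integral_add (f := fun w => ‖E w / σ w‖ ^ 2 - 2 * (E w / σ w).re)
      (hi1.sub (hi2.const_mul 2)) (integrable_const _), integral_sub hi1 (hi2.const_mul 2), integral_const_mul]
    have hre : ∫ w, (E w / σ w).re ∂circ = 1 := by
      have := integral_re (hee.integrable (by norm_num))
      simp only [RCLike.re_to_complex] at this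
      rw [this, hmean]; simp
    have hle : ∫ w, ‖E w / σ w‖ ^ 2 ∂circ ≤ c := by
      refine integral_mono hi1 hsq fun w => ?_
      simp only
      rw [norm_div, Complex.norm_real, Real.norm_of_nonneg (h0 w).le]
      exact pow_le_pow_left₀ (div_nonneg (norm_nonneg _) (h0 w).le)
        (div_le_self (norm_nonneg (E w)) (h1 w)) 2
    rw [hre]
    simp only [integral_const, probReal_univ, one_smul]
    linarith
  · intro V hV hV0
    have huV : ∀ k : ℕ, inner ℂ (u k) hV.toLp = 0 := fun k => by
      rw [← hV0 k, inner_eq_integral_of_ae (hu _) hV.coeFn_toLp]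
      refine integral_congr_ae (ae_of_all _ fun w => ?_)
      have := h0' w
      simp only [map_mul, Complex.conj_ofReal]
      field_simp
    have := hdual hV.toLp fun k => huV _
    rw [huV 0, inner_eq_integral_of_ae (ae_eq_refl _) hV.coeFn_toLp] at this
    rw [← this]
    refine integral_congr_ae (ae_of_all _ fun w => ?_)
    simp only [map_div₀, Complex.conj_ofReal]
    ring

lemma memLp_two_of_sq {V : ℝ → ℂ} (hV : AEStronglyMeasurable V circ) {G : ℝ → ℝ}
    (hG : Integrable G circ) (h : ∀ᵐ w ∂circ, ‖V w‖ ^ 2 ≤ G w) : MemLp V 2 circ := by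
  rw [memLp_two_iff_integrable_sq_norm hV]
  refine hG.mono' (hV.norm.pow 2) ?_
  filter_upwards [h] with w hw
  simpa using hw

/-- Bounded outer multipliers remove the integrability defect of products of `L₂` functions. -/
lemma integral_conj_outer_cube_mul_eq_zero {σ : ℝ → ℝ} (hσ : MemLp (fun w => (σ w : ℂ)) 2 circ)
    (h1 : ∀ w, 1 ≤ σ w) {e : ℝ → ℂ} {c C : ℝ} (he : AEStronglyMeasurable e circ)
    (hec : ∀ᵐ w ∂circ, ‖e w‖ ^ 2 * σ w ^ 2 = c)
    (hdual : ∀ V : ℝ → ℂ, MemLp (fun w => V w / σ w) 2 circ →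
        (∀ k : ℕ, ∫ w, conj (ez k w) * V w ∂circ = 0) → ∫ w, conj (e w) * V w ∂circ = 0)
    {N f : ℝ → ℂ} (hN : Integrable N circ) (hN0 : ∀ k : ℕ, ∫ w, conj (ez k w) * N w ∂circ = 0)
    (hf : MemLp f 2 circ) (hfh : hf.toLp ∈ hardy)
    (hNC : ∀ᵐ w ∂circ, ‖N w‖ ≤ C * σ w ^ 2) (hfC : ∀ᵐ w ∂circ, ‖f w‖ ^ 2 ≤ C * σ w ^ 2) :
    Integrable (fun w => conj (e w) ^ 3 * (conj (f w) * N w)) circ ∧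
      ∫ w, conj (e w) ^ 3 * (conj (f w) * N w) ∂circ = 0 := by
  have h0 : ∀ w, (0 : ℝ) < σ w := fun w => lt_of_lt_of_le one_pos (h1 w)
  have hσm : AEStronglyMeasurable (fun w => (σ w : ℂ)⁻¹) circ :=
    hσ.1.aemeasurable.inv.aestronglyMeasurable
  have hebd : ∀ᵐ w ∂circ, ‖e w‖ ^ 2 ≤ c := by
    filter_upwards [hec] with w hw
    rw [← hw]
    exact le_mul_of_one_le_right (by positivity) (one_le_pow₀ (h1 w))
  have hc : 0 ≤ c := by
    obtain ⟨w, hw⟩ := hec.exists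
    rw [← hw]; positivity
  have heN : ∀ᵐ w ∂circ, ‖e w‖ ^ 2 * ‖N w‖ ≤ C * c := by
    filter_upwards [hec, hNC] with w hw hw'
    calc ‖e w‖ ^ 2 * ‖N w‖ ≤ ‖e w‖ ^ 2 * (C * σ w ^ 2) := by gcongr
      _ = C * (‖e w‖ ^ 2 * σ w ^ 2) := by ring
      _ = C * c := by rw [hw]
  have hconj : AEStronglyMeasurable (fun w => conj (e w)) circ := he.star
  -- division by `σ` of a function `V` with `|V|² ≤ D |N|²`
  have hdiv : ∀ V : ℝ → ℂ, AEStronglyMeasurable V circ → ∀ D : ℝ, 0 ≤ D →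
      (∀ᵐ w ∂circ, ‖V w‖ ^ 2 ≤ D * ‖N w‖ ^ 2) → MemLp (fun w => V w / σ w) 2 circ := by
    intro V hV D hD hVN
    refine memLp_two_of_sq (by simp only [div_eq_mul_inv]; exact hV.mul hσm)
      (hN.norm.const_mul (D * C)) ?_
    filter_upwards [hVN, hNC] with w hw hw'
    have := h0 w
    rw [norm_div, Complex.norm_real, Real.norm_of_nonneg (h0 w).le, div_pow,
      div_le_iff₀ (by positivity)]
    calc ‖V w‖ ^ 2 ≤ D * ‖N w‖ ^ 2 := hw
      _ = D * (‖N w‖ * ‖N w‖) := by ring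
      _ ≤ D * ((C * σ w ^ 2) * ‖N w‖) := by gcongr
      _ = D * C * ‖N w‖ * σ w ^ 2 := by ring
  -- Two of the three factors conj e go to `N`, one at a time because each use of `hdual` needs V/σ
  -- in L₂. Since |e|²σ² is constant and |N| ≤ Cσ², the product conj(e)²N is bounded. The third goes
  -- to `f`, and the integral becomes an inner product of a Hardy function with an L₂ function
  -- having no coefficients of order k ≥ 0.
  have step1 : ∀ k : ℕ, ∫ w, conj (ez k w) * (conj (e w) * N w) ∂circ = 0 := by
    intro k
    rw [← hdual (fun w => conj (ez k w) * N w)]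
    · congr 1; ext w; ring
    · refine hdiv _ ((continuous_ez k).star.aestronglyMeasurable.mul hN.1) 1 zero_le_one
        (ae_of_all _ fun w => by simp)
    · intro j
      rw [← hN0 (j + k)]
      congr 1; ext w
      rw [Nat.cast_add, ez_add, map_mul, mul_assoc]
  have step2 : ∀ k : ℕ, ∫ w, conj (ez k w) * (conj (e w) ^ 2 * N w) ∂circ = 0 := by
    intro k
    rw [← hdual (fun w => conj (ez k w) * (conj (e w) * N w))]
    · congr 1; ext w; ring
    · refine hdiv _ ((continuous_ez k).star.aestronglyMeasurable.mul (hconj.mul hN.1)) c hc ?_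
      filter_upwards [hebd] with w hw
      simp only [norm_mul, RCLike.norm_conj, norm_ez, one_mul, mul_pow]
      gcongr
    · intro j
      rw [← step1 (j + k)]
      congr 1; ext w
      rw [Nat.cast_add, ez_add, map_mul, mul_assoc]
  have hV2 : MemLp (fun w => conj (e w) ^ 2 * N w) 2 circ := by
    refine MemLp.of_bound ((hconj.pow 2).mul hN.1) (C * c) ?_
    filter_upwards [heN] with w hw
    simpa [norm_mul, norm_pow] using hw
  have hef : MemLp (fun w => e w * f w) 2 circ := by
    refine memLp_bdd_mul he (Real.sqrt c) ?_ hf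
    filter_upwards [hebd] with w hw
    exact Real.le_sqrt_of_sq_le hw
  -- For y orthogonal to the Hardy space, V = conj f · y is orthogonal to each e^{-iwk}, k ≥ 0,
  -- because e^{-iwk} f is again Hardy; and |V|² ≤ Cσ²|y|² makes V/σ square integrable.
  have hefh : hef.toLp ∈ hardy := by
    refine mem_hardy_of_forall fun y hy => ?_
    rw [inner_eq_integral_of_ae hef.coeFn_toLp (ae_eq_refl _)]
    rw [← hdual (fun w => conj (f w) * y w)]
    · congr 1; ext w; rw [map_mul]; ring
    · refine memLp_two_of_sq ?_ ((Lp.memLp y).integrable_norm_pow (by norm_num) |>.const_mul C) ?_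
      · simp only [div_eq_mul_inv]; exact (hf.1.star.mul (Lp.memLp y).1).mul hσm
      · filter_upwards [hfC] with w hw
        have := h0 w
        rw [norm_div, Complex.norm_real, Real.norm_of_nonneg (h0 w).le, div_pow,
          div_le_iff₀ (by positivity), norm_mul, RCLike.norm_conj, mul_pow]
        calc ‖f w‖ ^ 2 * ‖y w‖ ^ 2 ≤ C * σ w ^ 2 * ‖y w‖ ^ 2 := by gcongr
          _ = _ := by ring
    · intro k
      rw [← hy _ (mulEz_mem_hardy k hfh), mulEz_toLp,
        inner_eq_integral_of_ae (MemLp.coeFn_toLp _) (ae_eq_refl _)]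
      congr 1; ext w; rw [map_mul, mul_assoc]
  have hint := integrable_conj_mul hef hV2
  have heq : ∀ w, conj (e w * f w) * (conj (e w) ^ 2 * N w) =
      conj (e w) ^ 3 * (conj (f w) * N w) := fun w => by rw [map_mul]; ring
  simp only [heq] at hint
  refine ⟨hint, ?_⟩
  have := inner_eq_zero_of_mem_hardy (y := hV2.toLp) hefh fun k => by
    rw [inner_eq_integral_of_ae (MemLp.coeFn_toLp _) hV2.coeFn_toLp]; exact step2 k
  rw [inner_eq_integral_of_ae hef.coeFn_toLp hV2.coeFn_toLp] at this
  simpa only [heq] using this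

/-- If `N_l` are integrable with vanishing Fourier coefficients of nonnegative order and `f_l` are
in the Hardy space, then `∑ conj f_l N_l` has mean zero as soon as it is integrable. -/
theorem integral_sum_conj_mul_eq_zero {ι : Type*} [Fintype ι] {N f : ι → ℝ → ℂ}
    (hN : ∀ l, Integrable (N l) circ)
    (hN0 : ∀ l, ∀ k : ℕ, ∫ w, conj (ez k w) * N l w ∂circ = 0)
    (hf : ∀ l, MemLp (f l) 2 circ) (hfh : ∀ l, (hf l).toLp ∈ hardy)
    (hsum : Integrable (fun w => ∑ l, conj (f l w) * N l w) circ) :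
    ∫ w, ∑ l, conj (f l w) * N l w ∂circ = 0 := by
  -- A single product conj f_l N_l need not be integrable, only the sum is. `S` dominates every
  -- |f_l|² and |N_l|, so (n+1)σ_n² = n + 1 + S controls them for each n, while ∫σ_n² → 1 forces the
  -- multipliers e_n to 1.
  let S : ℝ → ℝ := fun w => ∑ l, (‖f l w‖ ^ 2 + ‖N l w‖)
  have hS0 : ∀ w, 0 ≤ S w := fun w => Finset.sum_nonneg fun l _ => by positivity
  have hS : Integrable S circ := integrable_finsetSum _ fun l _ =>
    ((hf l).integrable_norm_pow (by norm_num)).add (hN l).norm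
  let σ : ℕ → ℝ → ℝ := fun n w => Real.sqrt (1 + S w / (n + 1))
  have hσ1 : ∀ n w, 1 ≤ σ n w := fun n w => by
    rw [Real.one_le_sqrt]
    have := hS0 w
    have : 0 ≤ S w / (n + 1) := by positivity
    linarith
  have hσsq : ∀ n w, σ n w ^ 2 = 1 + S w / (n + 1) := fun n w => by
    rw [Real.sq_sqrt]
    have := hS0 w
    positivity
  have hσint : ∀ n, Integrable (fun w => 1 + S w / (n + 1 : ℝ)) circ := fun n =>
    (integrable_const _).add (hS.div_const _)
  have hσ : ∀ n, MemLp (fun w => (σ n w : ℂ)) 2 circ := fun n => by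
    refine memLp_two_of_sq ?_ (hσint n) (ae_of_all _ fun w => ?_)
    · exact Complex.continuous_ofReal.comp_aestronglyMeasurable
        (Real.continuous_sqrt.comp_aestronglyMeasurable (hσint n).1)
    · rw [Complex.norm_real, Real.norm_of_nonneg (zero_le_one.trans (hσ1 n w)), hσsq]
  choose e c he hec hcle hmean hdual using fun n => exists_outer (hσ n) (hσ1 n)
  have hI : ∀ n : ℕ, ∫ w, σ n w ^ 2 ∂circ = 1 + (∫ w, S w ∂circ) / (n + 1) := fun n => by
    simp only [hσsq]
    rw [integral_add (integrable_const _) (hS.div_const _), integral_div]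
    simp
  have hIS : 0 ≤ ∫ w, S w ∂circ := integral_nonneg hS0
  have hcbd : ∀ n, c n ≤ 1 + ∫ w, S w ∂circ := fun n => by
    refine (hcle n).trans ?_
    rw [hI]
    gcongr
    exact div_le_self hIS (by linarith [Nat.cast_nonneg (α := ℝ) n])
  have hzero : ∀ n, ∫ w, conj (e n w) ^ 3 * ∑ l, conj (f l w) * N l w ∂circ = 0 := by
    intro n
    have key := fun l => integral_conj_outer_cube_mul_eq_zero (C := n + 1) (hσ n) (hσ1 n) (he n)
      (hec n) (hdual n) (hN l) (hN0 l) (hf l) (hfh l)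
      (ae_of_all _ fun w => by
        rw [hσsq, mul_add, mul_div_cancel₀ _ (by positivity)]
        have := Finset.single_le_sum (f := fun l => ‖f l w‖ ^ 2 + ‖N l w‖)
          (fun l _ => by positivity) (Finset.mem_univ l)
        have h2 : 0 ≤ ‖f l w‖ ^ 2 := by positivity
        have h3 : (0 : ℝ) ≤ (n + 1) * 1 := by positivity
        simp only [S] at *; linarith)
      (ae_of_all _ fun w => by
        rw [hσsq, mul_add, mul_div_cancel₀ _ (by positivity)]
        have := Finset.single_le_sum (f := fun l => ‖f l w‖ ^ 2 + ‖N l w‖)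
          (fun l _ => by positivity) (Finset.mem_univ l)
        have h2 : 0 ≤ ‖N l w‖ := by positivity
        have h3 : (0 : ℝ) ≤ (n + 1) * 1 := by positivity
        simp only [S] at *; linarith)
    simp only [Finset.mul_sum]
    rw [integral_finsetSum _ fun l _ => (key l).1]
    exact Finset.sum_eq_zero fun l _ => (key l).2
  have hebd : ∀ n, ∀ᵐ w ∂circ, ‖e n w‖ ^ 2 ≤ 1 + ∫ w, S w ∂circ := fun n => by
    filter_upwards [hec n] with w hw
    refine le_trans ?_ (hcbd n)
    rw [← hw]
    exact le_mul_of_one_le_right (by positivity) (one_le_pow₀ (hσ1 n w))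
  have hL1 : Tendsto (fun n => eLpNorm (fun w => e n w - 1) 2 circ) atTop (𝓝 0) := by
    have hmem : ∀ n, MemLp (fun w => e n w - 1) 2 circ := fun n => by
      refine MemLp.sub (MemLp.of_bound (he n) (Real.sqrt (1 + ∫ w, S w ∂circ)) ?_) (memLp_const 1)
      filter_upwards [hebd n] with w hw
      exact Real.le_sqrt_of_sq_le hw
    have hform : ∀ n, eLpNorm (fun w => e n w - 1) 2 circ =
        ENNReal.ofReal ((∫ w, ‖e n w - 1‖ ^ 2 ∂circ) ^ (1 / 2 : ℝ)) := fun n => by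
      rw [(hmem n).eLpNorm_eq_integral_rpow_norm (by norm_num) (by norm_num)]
      simp
    simp only [hform]
    rw [← ENNReal.ofReal_zero]
    refine (ENNReal.continuous_ofReal.tendsto 0).comp ?_
    have : Tendsto (fun n => ∫ w, ‖e n w - 1‖ ^ 2 ∂circ) atTop (𝓝 0) := by
      refine squeeze_zero (g := fun n : ℕ => (∫ w, S w ∂circ) / (n + 1))
        (fun n => integral_nonneg fun w => by positivity) (fun n => ?_) ?_
      · refine (hmean n).trans ?_
        rw [hI]; simp
      · exact tendsto_const_div_atTop_nhds_zero_nat (∫ w, S w ∂circ) |>.comp (tendsto_add_atTop_nat 1) |>.congr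
          fun n => by simp
    have h2 := this.rpow_const (p := (1 / 2 : ℝ)) (Or.inr (by norm_num))
    rwa [Real.zero_rpow (by norm_num)] at h2
  have hTM : TendstoInMeasure circ e atTop (fun _ => (1 : ℂ)) :=
    tendstoInMeasure_of_tendsto_eLpNorm (by norm_num) he aestronglyMeasurable_const hL1
  -- Along an a.e. convergent subsequence conj(e_n)³ tends to 1 with a uniform bound, and the
  -- integrable sum itself provides the dominating function.
  obtain ⟨ns, -, hns⟩ := hTM.exists_seq_tendsto_ae
  have hlim : Tendsto (fun i => ∫ w, conj (e (ns i) w) ^ 3 * ∑ l, conj (f l w) * N l w ∂circ) atTop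
      (𝓝 (∫ w, ∑ l, conj (f l w) * N l w ∂circ)) := by
    refine tendsto_integral_of_dominated_convergence
      (fun w => Real.sqrt (1 + ∫ w, S w ∂circ) ^ 3 * ‖∑ l, conj (f l w) * N l w‖)
      (fun i => ((he _).star.pow 3).mul hsum.1) (hsum.norm.const_mul _) (fun i => ?_) ?_
    · filter_upwards [hebd (ns i)] with w hw
      rw [norm_mul, norm_pow, RCLike.norm_conj]
      gcongr
      exact Real.le_sqrt_of_sq_le hw
    · filter_upwards [hns] with w hw
      have := ((Complex.continuous_conj.tendsto _).comp hw).pow 3 |>.mul_const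
        (∑ l, conj (f l w) * N l w)
      simpa using this
  simp only [hzero] at hlim
  exact (tendsto_nhds_unique hlim tendsto_const_nhds)

/-! ### Fourier coefficients -/

lemma coeFn_sum_smul {ι α : Type*} [MeasurableSpace α] {ν : Measure α} (s : Finset ι) (c : ι → ℂ)
    {x : ι → Lp ℂ 2 ν} {F : ι → α → ℂ} (h : ∀ i, x i =ᵐ[ν] F i) :
    ⇑(∑ i ∈ s, c i • x i) =ᵐ[ν] fun w => ∑ i ∈ s, c i * F i w := by
  classical
  induction s using Finset.induction_on with
  | empty =>
    simp only [Finset.sum_empty]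
    exact Lp.coeFn_zero ℂ 2 ν
  | insert i s hi ih =>
    simp only [Finset.sum_insert hi]
    filter_upwards [ih, Lp.coeFn_add (c i • x i) (∑ i ∈ s, c i • x i), Lp.coeFn_smul (c i) (x i),
      h i] with w h1 h2 h3 h4
    rw [h2, Pi.add_apply, h1, h3, Pi.smul_apply, h4, smul_eq_mul]

/-- The Fourier coefficient of `e^{-iwk}`. -/
def coef (k : ℤ) (x : Lp ℂ 2 circ) : ℂ := inner ℂ ((memLp_ez k).toLp) x

lemma coef_eq_of_ae (k : ℤ) {x : Lp ℂ 2 circ} {F : ℝ → ℂ} (h : x =ᵐ[circ] F) :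
    coef k x = ∫ w, conj (ez k w) * F w ∂circ :=
  inner_eq_integral_of_ae (MemLp.coeFn_toLp _) h

lemma orthonormal_ez : Orthonormal ℂ fun k : ℤ => (memLp_ez k).toLp := by
  rw [orthonormal_iff_ite]
  intro k l
  rw [inner_eq_integral_of_ae (MemLp.coeFn_toLp _) (MemLp.coeFn_toLp _)]
  simp only [conj_ez, ← ez_add, integral_ez]
  congr 1
  rw [eq_iff_iff]; constructor <;> intro h <;> omega

/-- The Hilbert basis of characters. -/
def ezBasis : HilbertBasis ℤ ℂ (Lp ℂ 2 circ) :=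
  HilbertBasis.mkOfOrthogonalEqBot orthonormal_ez (by
    rw [Submodule.eq_bot_iff]
    intro x hx
    rw [Lp.eq_zero_iff_ae_eq_zero]
    refine ae_eq_zero_of_integral_ez_mul ((Lp.memLp x).integrable (by norm_num)) fun k => ?_
    have := (Submodule.mem_orthogonal _ _).1 hx _ (Submodule.subset_span ⟨-k, rfl⟩)
    rw [inner_eq_integral_of_ae (MemLp.coeFn_toLp _) (ae_eq_refl _)] at this
    simpa only [conj_ez, neg_neg] using this)

@[simp] lemma ezBasis_apply (k : ℤ) : ezBasis k = (memLp_ez k).toLp := by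
  simp [ezBasis]

lemma hasSum_coef_mul_coef (x y : Lp ℂ 2 circ) :
    HasSum (fun k : ℤ => conj (coef k x) * coef k y) (inner ℂ x y) := by
  have := ezBasis.hasSum_inner_mul_inner x y
  simp only [ezBasis_apply] at this
  simpa only [coef, inner_conj_symm] using this

lemma coef_mulEz (k j : ℤ) (x : Lp ℂ 2 circ) : coef k (mulEz j x) = coef (k - j) x := by
  rw [coef, coef, show (memLp_ez k).toLp = mulEz j ((memLp_ez (k - j)).toLp) by
    rw [mulEz_ez]; congr; ring]
  exact (mulEz j).inner_map_map _ _

lemma coef_add (k : ℤ) (x y : Lp ℂ 2 circ) : coef k (x + y) = coef k x + coef k y :=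
  inner_add_right _ _ _

lemma coef_of_mem_hardy {x : Lp ℂ 2 circ} (hx : x ∈ hardy) {k : ℤ} (hk : k < 0) :
    coef k x = 0 := by
  rw [coef, ← inner_conj_symm, map_eq_zero]
  refine inner_eq_zero_of_mem_hardy hx fun j => ?_
  have := (orthonormal_iff_ite.1 orthonormal_ez) (j : ℤ) k
  rw [this, if_neg (by omega)]

lemma mem_hardy_of_coef {x : Lp ℂ 2 circ} (h : ∀ k < 0, coef k x = 0) : x ∈ hardy := by
  refine mem_hardy_of_forall fun y hy => ?_
  refine (hasSum_coef_mul_coef x y).unique ?_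
  convert hasSum_zero with k
  rcases lt_or_ge k 0 with hk | hk
  · simp [h k hk]
  · obtain ⟨n, rfl⟩ := Int.eq_ofNat_of_zero_le hk
    have : coef n y = 0 := hy _ (ez_mem_hardy n)
    rw [this, mul_zero]

lemma hasSum_nat_of_mem_hardy {x : Lp ℂ 2 circ} (hx : x ∈ hardy) (y : Lp ℂ 2 circ) :
    HasSum (fun k : ℕ => conj (coef k x) * coef k y) (inner ℂ x y) := by
  refine (Function.Injective.hasSum_iff (f := fun k : ℤ => conj (coef k x) * coef k y)
    Nat.cast_injective ?_).2 (hasSum_coef_mul_coef x y)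
  intro k hk
  have : k < 0 := by
    by_contra h
    exact hk ⟨k.toNat, by simp; omega⟩
  simp [coef_of_mem_hardy hx this]

lemma hasSum_norm_sq_of_mem_hardy {x : Lp ℂ 2 circ} (hx : x ∈ hardy) :
    HasSum (fun k : ℕ => ‖coef k x‖ ^ 2) (‖x‖ ^ 2) := by
  have := hasSum_nat_of_mem_hardy hx x
  rw [inner_self_eq_norm_sq_to_K] at this
  simp only [Complex.conj_mul', ← Complex.ofReal_pow] at this
  change HasSum _ ((‖x‖ : ℂ) ^ 2) at this
  rw [← Complex.ofReal_pow] at this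
  exact Complex.hasSum_ofReal.1 this

lemma IsL2Series.tendsto {c : ℕ → ℂ} {F : ℝ → ℂ} (h : IsL2Series c F) :
    Tendsto (fun n => ∑ k ∈ Finset.range n, c k • (memLp_ez (k : ℤ)).toLp) atTop (𝓝 h.1.toLp) := by
  rw [Lp.tendsto_Lp_iff_tendsto_eLpNorm']
  refine h.2.congr fun n => ?_
  rw [eLpNorm_sub_comm]
  refine eLpNorm_congr_ae ?_
  have h2 := coeFn_sum_smul (Finset.range n) c fun k : ℕ => (memLp_ez (k : ℤ)).coeFn_toLp
  filter_upwards [h.1.coeFn_toLp, h2] with w h3 h4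
  simp only [Pi.sub_apply]
  rw [h3, h4]
  simp [ez]

lemma IsL2Series.mem_hardy {c : ℕ → ℂ} {F : ℝ → ℂ} (h : IsL2Series c F) : h.1.toLp ∈ hardy :=
  isClosed_hardy.mem_of_tendsto h.tendsto (Eventually.of_forall fun _ =>
    Submodule.sum_mem _ fun k _ => Submodule.smul_mem _ _ (ez_mem_hardy k))

lemma IsL2Series.coef {c : ℕ → ℂ} {F : ℝ → ℂ} (h : IsL2Series c F) (k : ℕ) :
    coef k h.1.toLp = c k := by
  have h1 : Tendsto (fun n => GMFilter.coef k
      (∑ k ∈ Finset.range n, c k • (memLp_ez (k : ℤ)).toLp)) atTop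
      (𝓝 (GMFilter.coef k h.1.toLp)) :=
    ((innerSL ℂ ((memLp_ez (k : ℤ)).toLp)).continuous.tendsto _).comp h.tendsto
  refine tendsto_nhds_unique h1 (tendsto_const_nhds.congr' ?_)
  filter_upwards [eventually_gt_atTop k] with n hn
  have := orthonormal_iff_ite.1 orthonormal_ez
  simp only [GMFilter.coef, inner_sum, inner_smul_right, this, Nat.cast_inj]
  simp [hn]

lemma isL2Series_of_mem_hardy {x : Lp ℂ 2 circ} (hx : x ∈ hardy) :
    IsL2Series (fun k => coef k x) x := by
  refine ⟨Lp.memLp x, ?_⟩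
  have h1 : HasSum (fun k : ℕ => coef k x • (memLp_ez (k : ℤ)).toLp) x := by
    have := ezBasis.hasSum_repr x
    simp only [ezBasis_apply, HilbertBasis.repr_apply_apply] at this
    refine (Function.Injective.hasSum_iff (f := fun k : ℤ => coef k x • (memLp_ez k).toLp)
      Nat.cast_injective ?_).2 this
    intro k hk
    have : k < 0 := by
      by_contra h
      exact hk ⟨k.toNat, by simp; omega⟩
    simp [coef_of_mem_hardy hx this]
  have h2 := h1.tendsto_sum_nat
  rw [Lp.tendsto_Lp_iff_tendsto_eLpNorm'] at h2
  refine h2.congr fun n => ?_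
  rw [eLpNorm_sub_comm]
  refine eLpNorm_congr_ae ?_
  have h2 := coeFn_sum_smul (Finset.range n) (fun k : ℕ => coef k x)
    fun k : ℕ => (memLp_ez (k : ℤ)).coeFn_toLp
  filter_upwards [h2] with w h4
  simp only [Pi.sub_apply]
  rw [h4]
  simp [ez]

/-- Riesz–Fischer. It converts the ℓ₂ hypotheses on G⁻a_{-μ} and G⁺b_{-μ} into functions that can be
multiplied by conj Ψ. -/
lemma exists_mem_hardy_of_summable {c : ℕ → ℂ} (hc : Summable fun k => ‖c k‖ ^ 2) :
    ∃ x ∈ hardy, ∀ k : ℕ, coef k x = c k := by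
  let c' : ℤ → ℂ := fun k => if 0 ≤ k then c k.toNat else 0
  have hc' : Memℓp c' 2 := by
    refine memℓp_gen ?_
    rw [← Function.Injective.summable_iff (g := fun n : ℕ => (n : ℤ)) Nat.cast_injective]
    · simpa [Function.comp_def, c'] using hc
    · intro k hk
      have : ¬ 0 ≤ k := fun h => hk ⟨k.toNat, by simp; omega⟩
      simp [c', this]
  have hcoef : ∀ k, coef k (ezBasis.repr.symm ⟨c', hc'⟩) = c' k := fun k => by
    have := ezBasis.repr_apply_apply (ezBasis.repr.symm ⟨c', hc'⟩) k
    rw [ezBasis_apply, LinearIsometryEquiv.apply_symm_apply] at this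
    exact this.symm
  refine ⟨ezBasis.repr.symm ⟨c', hc'⟩, mem_hardy_of_coef fun k hk => ?_, fun k => ?_⟩
  · rw [hcoef]; simp [c', hk]
  · rw [hcoef]; simp [c']

/-! ### Isometries defined by Gram matrices -/

/-- A family with dense span and the Gram matrix of another family extends to an isometry. -/
lemma exists_linearIsometry_of_gram {ι E F : Type*} [NormedAddCommGroup E] [InnerProductSpace ℂ E]
    [NormedAddCommGroup F] [InnerProductSpace ℂ F] [CompleteSpace F] (v : ι → E) (y : ι → F)
    (hgram : ∀ i j, inner ℂ (v i) (v j) = inner ℂ (y i) (y j))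
    (hdense : (Submodule.span ℂ (Set.range v)).topologicalClosure = ⊤) :
    ∃ U : E →ₗᵢ[ℂ] F, ∀ i, U (v i) = y i := by
  let a := Finsupp.linearCombination ℂ v
  let b := Finsupp.linearCombination ℂ y
  have hinner : ∀ c, inner ℂ (a c) (a c) = inner ℂ (b c) (b c) := fun c => by
    simp only [a, b, Finsupp.linearCombination_apply, Finsupp.sum, sum_inner, inner_sum,
      inner_smul_left, inner_smul_right, hgram]
  have hnorm : ∀ c, ‖b c‖ = ‖a c‖ := fun c => by
    rw [@norm_eq_sqrt_re_inner ℂ, @norm_eq_sqrt_re_inner ℂ _ _ _ _ (a c), hinner]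
  have hd : DenseRange a := by
    have : Set.range a = (Submodule.span ℂ (Set.range v) : Set E) := by
      rw [← Finsupp.range_linearCombination]; rfl
    rw [DenseRange, this, ← Submodule.dense_iff_topologicalClosure_eq_top] at *
    exact hdense
  have hex : ∃ C, ∀ x, ‖b x‖ ≤ C * ‖a x‖ := ⟨1, fun x => by rw [hnorm, one_mul]⟩
  refine ⟨⟨(b.extendOfNorm a).toLinearMap, fun x => ?_⟩, fun i => ?_⟩
  · refine hd.induction_on (p := fun x => ‖b.extendOfNorm a x‖ = ‖x‖) x
      (isClosed_eq (by fun_prop) (by fun_prop)) fun c => ?_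
    rw [LinearMap.extendOfNorm_eq hd hex, hnorm]
  · have := LinearMap.extendOfNorm_eq hd hex (Finsupp.single i 1)
    simpa [a, b] using this

/-! ### The symbols `χ` and `β` -/

lemma continuous_chi {r : ℕ} (ν : Fin r → ℤ) (s d : Fin r → ℕ) : Continuous (chi ν s d) := by
  unfold chi; fun_prop

lemma continuous_beta {r : ℕ} (s d : Fin r → ℕ) : Continuous (beta s d) := by
  unfold beta; fun_prop

lemma ez_nat_mul (k : ℕ) (m : ℤ) (w : ℝ) : ez (m * k) w = ez m w ^ k := by
  rw [ez, ez, ← Complex.exp_nat_mul]; push_cast; ring_nf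

lemma ez_sum {ι : Type*} (t : Finset ι) (m : ι → ℤ) (w : ℝ) :
    ez (∑ i ∈ t, m i) w = ∏ i ∈ t, ez (m i) w := by
  simp only [ez, ← Complex.exp_sum]; push_cast
  rw [Finset.mul_sum, Finset.sum_neg_distrib]

lemma chi_eq_prod_ez {r : ℕ} (ν : Fin r → ℤ) (s d : Fin r → ℕ) (w : ℝ) :
    chi ν s d w = ∏ j, (1 - ez (ν j * s j) w) ^ d j := by
  unfold chi ez; push_cast; simp only [mul_assoc]

/-- The coefficients of the increment operator. -/
def incrCoef {r : ℕ} (d : Fin r → ℕ) (l : Fin r → ℕ) : ℂ :=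
  (-1 : ℂ) ^ (∑ i, l i) * ((∏ i, (d i).choose (l i) : ℕ) : ℂ)

lemma chi_eq_sum {r : ℕ} (ν : Fin r → ℤ) (s d : Fin r → ℕ) (w : ℝ) :
    chi ν s d w = ∑ l ∈ Fintype.piFinset (fun i => Finset.range (d i + 1)),
      incrCoef d l * ez (∑ i, ν i * (s i : ℤ) * (l i : ℤ)) w := by
  have h : ∀ j, (1 - ez (ν j * s j) w) ^ d j = ∑ k ∈ Finset.range (d j + 1),
      (-1 : ℂ) ^ k * ((d j).choose k : ℂ) * ez (ν j * s j * k) w := fun j => by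
    rw [sub_eq_neg_add, add_pow]
    refine Finset.sum_congr rfl fun k _ => ?_
    rw [ez_nat_mul k (ν j * s j), neg_pow]; ring
  rw [chi_eq_prod_ez]
  simp only [h]
  rw [Finset.prod_univ_sum]
  refine Finset.sum_congr rfl fun l _ => ?_
  rw [ez_sum, Finset.prod_mul_distrib, Finset.prod_mul_distrib, incrCoef,
    Finset.prod_pow_eq_pow_sum]
  push_cast; ring

lemma gmIncr_eq {r : ℕ} {Ω : Type*} (ν : Fin r → ℤ) (s d : Fin r → ℕ) (x : ℤ → Ω → ℂ) (m : ℤ)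
    (ω : Ω) : gmIncr ν s d x m ω = ∑ l ∈ Fintype.piFinset (fun i => Finset.range (d i + 1)),
      incrCoef d l * x (m - ∑ i, ν i * (s i : ℤ) * (l i : ℤ)) ω := rfl

lemma chi_eq_sum_eGamma {r : ℕ} (μ s d : Fin r → ℕ) (w : ℝ) :
    chi (fun i => (μ i : ℤ)) s d w =
      ∑ k ∈ Finset.range (nGamma μ s d + 1), (eGamma μ s d k : ℂ) * ez k w := by
  let p : Polynomial ℤ := ∏ i, (1 - (Polynomial.X : Polynomial ℤ) ^ (μ i * s i)) ^ d i
  have h1 : chi (fun i => (μ i : ℤ)) s d w = p.eval₂ (Int.castRingHom ℂ) (ez 1 w) := by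
    rw [chi_eq_prod_ez, Polynomial.eval₂_finsetProd]
    refine Finset.prod_congr rfl fun i _ => ?_
    rw [Polynomial.eval₂_pow, Polynomial.eval₂_sub, Polynomial.eval₂_one, Polynomial.eval₂_pow,
      Polynomial.eval₂_X, ← ez_nat_mul]
    push_cast; rw [one_mul]
  have hdeg : p.natDegree < nGamma μ s d + 1 := by
    rw [Nat.lt_succ_iff]
    refine (Polynomial.natDegree_prod_le _ _).trans (Finset.sum_le_sum fun i _ => ?_)
    refine Polynomial.natDegree_pow_le.trans ?_
    rw [mul_comm]
    gcongr
    refine (Polynomial.natDegree_sub_le _ _).trans ?_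
    simp
  rw [h1, Polynomial.eval₂_eq_sum_range' _ hdeg]
  refine Finset.sum_congr rfl fun k _ => ?_
  rw [← ez_nat_mul, one_mul]; rfl

/-- The zeros lie in the countable set of points 2πn/(ν_j s_j). -/
lemma ae_chi_ne_zero {r : ℕ} {ν : Fin r → ℤ} (hν : ∀ i, ν i ≠ 0) {s : Fin r → ℕ}
    (hs : ∀ i, 0 < s i) (d : Fin r → ℕ) : ∀ᵐ w ∂circ, chi ν s d w ≠ 0 := by
  have hc : (⋃ j : Fin r, Set.range fun n : ℤ => 2 * π * n / (ν j * s j : ℝ)).Countable :=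
    Set.countable_iUnion fun j => Set.countable_range _
  filter_upwards [hc.ae_notMem circ] with w hw h
  refine hw ?_
  rw [chi, Finset.prod_eq_zero_iff] at h
  obtain ⟨j, -, hj⟩ := h
  have hj := eq_zero_of_pow_eq_zero hj
  rw [sub_eq_zero, eq_comm, Complex.exp_eq_one_iff] at hj
  obtain ⟨n, hn⟩ := hj
  refine Set.mem_iUnion.2 ⟨j, -n, ?_⟩
  have h1 : (ν j : ℝ) ≠ 0 := by exact_mod_cast hν j
  have h2 : (s j : ℝ) ≠ 0 := by exact_mod_cast (hs j).ne'
  have h3 : -((w * ν j * s j : ℝ) : ℂ) = ((n * (2 * π) : ℝ) : ℂ) := by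
    apply mul_left_cancel₀ Complex.I_ne_zero
    push_cast
    linear_combination hn
  have h4 : -(w * ν j * s j) = n * (2 * π) := by exact_mod_cast h3
  simp only
  rw [div_eq_iff (mul_ne_zero h1 h2)]
  push_cast
  linarith

/-- The factors vanish at 2πk/s, points spaced by 2δ with δ = π/s. Within δ of one of them the left
side is at most |ν|s times the distance, by periodicity of the exponential, and the other 2[s/2]
factors are at least δ. Away from all of them the left side is at most 2 and every factor is at
least δ. The constant is the sum of those from the two cases. -/
lemma norm_one_sub_exp_le (ν : ℤ) {s : ℕ} (hs : 0 < s) : ∃ C : ℝ, 0 ≤ C ∧ ∀ w : ℝ,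
    ‖1 - Complex.exp (-(Complex.I * w * (ν : ℂ) * (s : ℂ)))‖ ≤
      C * ∏ k ∈ Finset.Icc (-((s / 2 : ℕ) : ℤ)) ((s / 2 : ℕ) : ℤ),
        ‖Complex.I * w - 2 * π * Complex.I * (k : ℂ) / (s : ℂ)‖ := by
  have hs' : (0 : ℝ) < s := by exact_mod_cast hs
  have hsC : (s : ℂ) ≠ 0 := by exact_mod_cast hs.ne'
  set n := s / 2
  set δ : ℝ := π / s
  have hδ : 0 < δ := by have := Real.pi_pos; positivity
  have hcard : (Finset.Icc (-(n : ℤ)) n).card = 2 * n + 1 := by simp; omega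
  have hnorm : ∀ (w : ℝ) (k : ℤ), ‖Complex.I * w - 2 * π * Complex.I * (k : ℂ) / (s : ℂ)‖ =
      |w - 2 * π * k / s| := fun w k => by
    rw [show Complex.I * w - 2 * π * Complex.I * (k : ℂ) / (s : ℂ) =
      Complex.I * ((w - 2 * π * k / s : ℝ) : ℂ) by push_cast; ring]
    rw [norm_mul, Complex.norm_I, one_mul, Complex.norm_real, Real.norm_eq_abs]
  simp only [hnorm]
  refine ⟨|(ν : ℝ)| * s * (δ ^ (2 * n))⁻¹ + 2 * (δ ^ (2 * n + 1))⁻¹, by positivity, fun w => ?_⟩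
  rw [add_mul]
  have hprod : 0 ≤ ∏ k ∈ Finset.Icc (-(n : ℤ)) n, |w - 2 * π * k / s| :=
    Finset.prod_nonneg fun _ _ => abs_nonneg _
  by_cases h : ∃ k ∈ Finset.Icc (-(n : ℤ)) n, |w - 2 * π * k / s| < δ
  · obtain ⟨k, hk, hkδ⟩ := h
    have h1 : ‖1 - Complex.exp (-(Complex.I * w * (ν : ℂ) * (s : ℂ)))‖ ≤
        |(ν : ℝ)| * s * |w - 2 * π * k / s| := by
      have : Complex.exp (-(Complex.I * w * (ν : ℂ) * (s : ℂ))) =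
          Complex.exp (Complex.I * ((-((w - 2 * π * k / s) * ν * s) : ℝ) : ℂ)) := by
        rw [Complex.exp_eq_exp_iff_exists_int]
        refine ⟨-(k * ν), ?_⟩
        push_cast
        field_simp
        ring
      rw [this, norm_sub_rev]
      refine (Real.norm_exp_I_mul_ofReal_sub_one_le).trans ?_
      rw [norm_neg, norm_mul, norm_mul, Real.norm_eq_abs, Real.norm_eq_abs, Real.norm_natCast]
      exact le_of_eq (by ring)
    have h2 : δ ^ (2 * n) ≤ ∏ j ∈ (Finset.Icc (-(n : ℤ)) n).erase k, |w - 2 * π * j / s| := by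
      have hc : ((Finset.Icc (-(n : ℤ)) n).erase k).card = 2 * n := by
        rw [Finset.card_erase_of_mem hk, hcard]; rfl
      rw [← hc, ← Finset.prod_const]
      refine Finset.prod_le_prod (fun _ _ => hδ.le) fun j hj => ?_
      have hjk : (1 : ℝ) ≤ |(j : ℝ) - k| := by
        have : (1 : ℤ) ≤ |j - k| := Int.one_le_abs (sub_ne_zero.2 (Finset.ne_of_mem_erase hj))
        exact_mod_cast this
      have h3 : |2 * π * j / s - 2 * π * k / s| = 2 * δ * |(j : ℝ) - k| := by
        rw [show 2 * π * j / s - 2 * π * k / s = 2 * δ * ((j : ℝ) - k) by simp only [δ]; ring,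
          abs_mul, abs_of_pos (by positivity)]
      have h4 : 2 * δ ≤ |2 * π * j / s - 2 * π * k / s| := by
        rw [h3]; exact le_mul_of_one_le_right (by positivity) hjk
      have h5 := abs_sub_le (2 * π * j / s) w (2 * π * k / s)
      rw [abs_sub_comm (2 * π * j / s) w] at h5
      linarith
    have h3 : |(ν : ℝ)| * s * |w - 2 * π * k / s| ≤
        |(ν : ℝ)| * s * (δ ^ (2 * n))⁻¹ * ∏ k ∈ Finset.Icc (-(n : ℤ)) n, |w - 2 * π * k / s| := by
      rw [← Finset.mul_prod_erase _ _ hk]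
      calc |(ν : ℝ)| * s * |w - 2 * π * k / s| =
          |(ν : ℝ)| * s * (δ ^ (2 * n))⁻¹ * (|w - 2 * π * k / s| * δ ^ (2 * n)) := by
            field_simp
        _ ≤ _ := by gcongr
    have : 0 ≤ 2 * (δ ^ (2 * n + 1))⁻¹ * ∏ k ∈ Finset.Icc (-(n : ℤ)) n, |w - 2 * π * k / s| := by
      positivity
    linarith
  · push Not at h
    have h1 : ‖1 - Complex.exp (-(Complex.I * w * (ν : ℂ) * (s : ℂ)))‖ ≤ 2 := by
      refine (norm_sub_le _ _).trans ?_
      have := norm_ez (ν * s) w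
      rw [ez] at this; push_cast at this
      rw [mul_assoc, this]; norm_num
    have h2 : δ ^ (2 * n + 1) ≤ ∏ k ∈ Finset.Icc (-(n : ℤ)) n, |w - 2 * π * k / s| := by
      rw [← hcard, ← Finset.prod_const]
      exact Finset.prod_le_prod (fun _ _ => hδ.le) h
    have h3 : 2 ≤ 2 * (δ ^ (2 * n + 1))⁻¹ * ∏ k ∈ Finset.Icc (-(n : ℤ)) n, |w - 2 * π * k / s| := by
      calc (2 : ℝ) = 2 * (δ ^ (2 * n + 1))⁻¹ * δ ^ (2 * n + 1) := by field_simp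
        _ ≤ _ := by gcongr
    have : 0 ≤ |(ν : ℝ)| * s * (δ ^ (2 * n))⁻¹ *
        ∏ k ∈ Finset.Icc (-(n : ℤ)) n, |w - 2 * π * k / s| := by positivity
    linarith

lemma exists_norm_chi_le {r : ℕ} (ν : Fin r → ℤ) {s : Fin r → ℕ} (hs : ∀ i, 0 < s i)
    (d : Fin r → ℕ) : ∃ C : ℝ, 0 ≤ C ∧ ∀ w, ‖chi ν s d w‖ ≤ C * ‖beta s d w‖ := by
  choose C hC h using fun j => norm_one_sub_exp_le (ν j) (hs j)
  refine ⟨∏ j, C j ^ d j, Finset.prod_nonneg fun j _ => pow_nonneg (hC j) _, fun w => ?_⟩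
  simp only [chi, beta, norm_prod, norm_pow, Finset.prod_pow]
  rw [← Finset.prod_mul_distrib]
  refine Finset.prod_le_prod (fun j _ => by positivity) fun j _ => ?_
  rw [← mul_pow]
  gcongr
  exact h j w

/-- This boundedness puts the increment functions in L₂(p) in spite of the zeros of β. -/
lemma exists_norm_chi_div_beta_le {r : ℕ} (ν : Fin r → ℤ) {s : Fin r → ℕ} (hs : ∀ i, 0 < s i)
    (d : Fin r → ℕ) : ∃ C : ℝ, 0 ≤ C ∧ ∀ w, ‖chi ν s d w / beta s d w‖ ≤ C := by
  obtain ⟨C, hC, h⟩ := exists_norm_chi_le ν hs d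
  refine ⟨C, hC, fun w => ?_⟩
  rw [norm_div]
  exact div_le_of_le_mul₀ (norm_nonneg _) hC (h w)

lemma aestronglyMeasurable_chi_div_beta {r : ℕ} (ν : Fin r → ℤ) (s d : Fin r → ℕ) :
    AEStronglyMeasurable (fun w => chi ν s d w / beta s d w) circ :=
  ((continuous_chi ν s d).measurable.div (continuous_beta s d).measurable).aestronglyMeasurable

/-- By |χ| ≤ C|β|, zeros of β are zeros of χ for the unit step, which form a null set. -/
lemma ae_beta_ne_zero {r : ℕ} {s : Fin r → ℕ} (hs : ∀ i, 0 < s i) (d : Fin r → ℕ) :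
    ∀ᵐ w ∂circ, beta s d w ≠ 0 := by
  obtain ⟨C, -, h⟩ := exists_norm_chi_le (fun _ => 1) hs d
  filter_upwards [ae_chi_ne_zero (ν := fun _ => 1) (fun _ => one_ne_zero) hs d] with w hw h0
  have := h w
  rw [h0, norm_zero, mul_zero] at this
  exact hw (norm_le_zero_iff.1 this)

lemma IsStep.ne_zero {r : ℕ} {ν : Fin r → ℤ} (h : IsStep ν) (i : Fin r) : ν i ≠ 0 := by
  rcases h with h | h
  · exact (h i).ne'
  · exact (h i).ne

/-! ### Vector functions and the space `L₂(p)` -/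

/-- The space of square integrable functions on `[-π, π)` with values in `ℂⁿ`. -/
abbrev VecL2 (n : ℕ) : Type := PiLp 2 fun _ : Fin n => Lp ℂ 2 circ

/-- The element `x` is the class of the vector function `F`. -/
def IsRep {n : ℕ} (F : ℝ → Fin n → ℂ) (x : VecL2 n) : Prop :=
  ∀ j, x j =ᵐ[circ] fun w => F w j

/-- The class of a square integrable vector function. -/
def toVecL2 {n : ℕ} (F : ℝ → Fin n → ℂ) (hF : ∀ j, MemLp (fun w => F w j) 2 circ) : VecL2 n :=
  WithLp.toLp 2 fun j => (hF j).toLp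

lemma isRep_toVecL2 {n : ℕ} (F : ℝ → Fin n → ℂ) (hF : ∀ j, MemLp (fun w => F w j) 2 circ) :
    IsRep F (toVecL2 F hF) := fun j => (hF j).coeFn_toLp

lemma IsRep.memLp {n : ℕ} {F : ℝ → Fin n → ℂ} {x : VecL2 n} (h : IsRep F x) (j : Fin n) :
    MemLp (fun w => F w j) 2 circ := (memLp_congr_ae (h j)).1 (Lp.memLp _)

lemma IsRep.inner_eq {n : ℕ} {F G : ℝ → Fin n → ℂ} {x y : VecL2 n} (hx : IsRep F x)
    (hy : IsRep G y) : inner ℂ x y = ∫ w, ∑ j, conj (F w j) * G w j ∂circ := by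
  rw [PiLp.inner_apply, integral_finsetSum]
  · exact Finset.sum_congr rfl fun j _ => inner_eq_integral_of_ae (hx j) (hy j)
  · exact fun j _ => integrable_conj_mul (hx.memLp j) (hy.memLp j)

lemma IsRep.norm_sq_eq {n : ℕ} {F : ℝ → Fin n → ℂ} {x : VecL2 n} (h : IsRep F x) :
    ‖x‖ ^ 2 = ∫ w, ∑ j, ‖F w j‖ ^ 2 ∂circ := by
  have := inner_self_eq_norm_sq_to_K (𝕜 := ℂ) x
  rw [h.inner_eq h] at this
  simp only [Complex.conj_mul', ← Complex.ofReal_pow, ← Complex.ofReal_sum] at this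
  rw [integral_complex_ofReal] at this
  change _ = ((‖x‖ : ℝ) : ℂ) ^ 2 at this
  rw [← Complex.ofReal_pow] at this
  exact (Complex.ofReal_injective this).symm

lemma IsRep.ofReal_norm_sq_eq {n : ℕ} {F : ℝ → Fin n → ℂ} {x : VecL2 n} (h : IsRep F x) :
    ENNReal.ofReal (‖x‖ ^ 2) = ∫⁻ w, ENNReal.ofReal (∑ j, ‖F w j‖ ^ 2) ∂circ := by
  rw [h.norm_sq_eq, ofReal_integral_eq_lintegral_ofReal]
  · exact integrable_finsetSum _ fun j _ => (h.memLp j).integrable_norm_pow (by norm_num)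
  · exact ae_of_all _ fun w => Finset.sum_nonneg fun j _ => by positivity

lemma IsRep.sub_sum {ι : Type*} {n : ℕ} {F : ℝ → Fin n → ℂ} {G : ι → ℝ → Fin n → ℂ} {x : VecL2 n}
    {v : ι → VecL2 n} (hx : IsRep F x) (hv : ∀ i, IsRep (G i) (v i)) (c : ι →₀ ℂ) :
    IsRep (fun w => F w - c.sum fun i z => z • G i w) (x - c.sum fun i z => z • v i) := by
  intro j
  have h1 : (x - c.sum fun i z => z • v i) j = x j - ∑ i ∈ c.support, c i • v i j := by
    rw [PiLp.sub_apply, Finsupp.sum]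
    simp
  rw [h1]
  filter_upwards [hx j, coeFn_sum_smul c.support c (fun i => hv i j),
    Lp.coeFn_sub (x j) (∑ i ∈ c.support, c i • v i j)] with w h2 h3 h4
  rw [h4, Pi.sub_apply, h2, h3]
  simp [Finsupp.sum]

/-- The vector function `b Θᵀ h`. -/
def specMap {T q : ℕ} (b : ℝ → ℂ) (Θ : ℝ → Matrix (Fin T) (Fin q) ℂ) (h : ℝ → Fin T → ℂ) :
    ℝ → Fin q → ℂ := fun w => b w • ((Θ w)ᵀ *ᵥ h w)

/-- The density `p` is integrable and factors as `|b|² Θ Θ*`. -/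
structure IsFactor {T q : ℕ} (p : ℝ → Matrix (Fin T) (Fin T) ℂ) (b : ℝ → ℂ)
    (Θ : ℝ → Matrix (Fin T) (Fin q) ℂ) : Prop where
  integrable : ∀ i j, Integrable (fun w => p w i j) circ
  measurable_scalar : AEStronglyMeasurable b circ
  measurable : ∀ i j, AEStronglyMeasurable (fun w => Θ w i j) circ
  fact : ∀ᵐ w ∂circ, p w = ((‖b w‖ ^ 2 : ℝ) : ℂ) • (Θ w * (Θ w)ᴴ)

lemma specMap_single {T q : ℕ} (b : ℝ → ℂ) (Θ : ℝ → Matrix (Fin T) (Fin q) ℂ) (l : Fin T)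
    (m : ℝ → ℂ) (w : ℝ) (j : Fin q) :
    specMap b Θ (fun w => Pi.single l (m w)) w j = b w * (m w * Θ w l j) := by
  simp [specMap, Matrix.mulVec_single, mul_comm]

lemma IsFactor.apply {T q : ℕ} {p : ℝ → Matrix (Fin T) (Fin T) ℂ} {b : ℝ → ℂ}
    {Θ : ℝ → Matrix (Fin T) (Fin q) ℂ} (hp : IsFactor p b Θ) :
    ∀ᵐ w ∂circ, ∀ k l, p w k l = ∑ j, (b w * Θ w k j) * conj (b w * Θ w l j) := by
  filter_upwards [hp.fact] with w hw k l
  rw [hw, Matrix.smul_apply, Matrix.mul_apply, smul_eq_mul, Finset.mul_sum]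
  refine Finset.sum_congr rfl fun j _ => ?_
  rw [Matrix.conjTranspose_apply, map_mul, Complex.ofReal_pow, ← Complex.mul_conj']
  simp only [RCLike.star_def]
  ring

/-- Pointwise hᵀ p h̄ = |bΘᵀh|², so h ↦ bΘᵀh embeds L₂(p) isometrically in `VecL2 q`, where all
approximation questions are settled. The lemma is used with b = β/χ_μ. -/
lemma IsFactor.specNormSq_eq {T q : ℕ} {p : ℝ → Matrix (Fin T) (Fin T) ℂ} {b : ℝ → ℂ}
    {Θ : ℝ → Matrix (Fin T) (Fin q) ℂ} (hp : IsFactor p b Θ) (h : ℝ → Fin T → ℂ) :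
    specNormSq p h = ∫⁻ w, ENNReal.ofReal (∑ j, ‖specMap b Θ h w j‖ ^ 2) ∂circ := by
  refine lintegral_congr_ae ?_
  filter_upwards [hp.apply] with w hw
  congr 1
  have : h w ⬝ᵥ (p w *ᵥ star (h w)) = ∑ j, specMap b Θ h w j * conj (specMap b Θ h w j) := by
    simp only [specMap, Pi.smul_apply, smul_eq_mul, Matrix.mulVec, dotProduct, hw,
      Matrix.transpose_apply, Pi.star_apply, RCLike.star_def, map_mul, map_sum]
    simp only [Finset.sum_mul, Finset.mul_sum]
    rw [Finset.sum_comm (s := (Finset.univ : Finset (Fin q)))]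
    simp only [Finset.sum_comm (s := (Finset.univ : Finset (Fin q)))]
    rw [Finset.sum_comm]
    refine Finset.sum_congr rfl fun k _ => Finset.sum_congr rfl fun l _ =>
      Finset.sum_congr rfl fun j _ => ?_
    ring
  rw [this, Complex.re_sum]
  refine Finset.sum_congr rfl fun j _ => ?_
  rw [Complex.mul_conj', ← Complex.ofReal_pow, Complex.ofReal_re]

lemma IsFactor.memLp_specMap_single {T q : ℕ} {p : ℝ → Matrix (Fin T) (Fin T) ℂ} {b : ℝ → ℂ}
    {Θ : ℝ → Matrix (Fin T) (Fin q) ℂ} (hp : IsFactor p b Θ) (l : Fin T) {m : ℝ → ℂ}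
    (hm : AEStronglyMeasurable m circ) {C : ℝ} (hC : ∀ w, ‖m w‖ ≤ C) (j : Fin q) :
    MemLp (fun w => specMap b Θ (fun w => Pi.single l (m w)) w j) 2 circ := by
  simp only [specMap_single]
  refine memLp_two_of_sq (hp.measurable_scalar.mul (hm.mul (hp.measurable l j)))
    ((hp.integrable l l).norm.const_mul (C ^ 2)) ?_
  filter_upwards [hp.apply] with w hw
  have h1 : ‖p w l l‖ = ∑ j, ‖b w * Θ w l j‖ ^ 2 := by
    rw [hw]
    simp only [Complex.mul_conj', ← Complex.ofReal_pow, ← Complex.ofReal_sum]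
    rw [Complex.norm_real, Real.norm_of_nonneg (Finset.sum_nonneg fun j _ => by positivity)]
  rw [h1, show b w * (m w * Θ w l j) = m w * (b w * Θ w l j) by ring, norm_mul, mul_pow]
  gcongr
  · exact hC w
  · exact Finset.single_le_sum (f := fun j => ‖b w * Θ w l j‖ ^ 2) (fun _ _ => by positivity)
      (Finset.mem_univ j)

lemma IsFactor.inner_eq {T q : ℕ} {p : ℝ → Matrix (Fin T) (Fin T) ℂ} {b : ℝ → ℂ}
    {Θ : ℝ → Matrix (Fin T) (Fin q) ℂ} (hp : IsFactor p b Θ) {k l : Fin T} {m n : ℝ → ℂ}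
    {x y : VecL2 q} (hx : IsRep (specMap b Θ fun w => Pi.single k (m w)) x)
    (hy : IsRep (specMap b Θ fun w => Pi.single l (n w)) y) :
    inner ℂ x y = ∫ w, conj (m w) * n w * p w l k ∂circ := by
  rw [hx.inner_eq hy]
  refine integral_congr_ae ?_
  filter_upwards [hp.apply] with w hw
  rw [hw, Finset.mul_sum]
  refine Finset.sum_congr rfl fun j _ => ?_
  simp only [specMap_single, map_mul]
  ring

lemma specMap_sub_sum {ι : Type*} {T q : ℕ} (b : ℝ → ℂ) (Θ : ℝ → Matrix (Fin T) (Fin q) ℂ)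
    (h : ℝ → Fin T → ℂ) (k : ι → ℝ → Fin T → ℂ) (c : ι →₀ ℂ) :
    specMap b Θ (fun w => h w - c.sum fun i z => z • k i w) =
      fun w => specMap b Θ h w - c.sum fun i z => z • specMap b Θ (k i) w := by
  funext w
  simp only [specMap, Finsupp.sum, Matrix.mulVec_sub, smul_sub, Matrix.mulVec_sum,
    Matrix.mulVec_smul, Finset.smul_sum]
  congr 1
  exact Finset.sum_congr rfl fun i _ => smul_comm _ _ _

lemma IsFactor.specNormSq_sub_sum {ι : Type*} {T q : ℕ} {p : ℝ → Matrix (Fin T) (Fin T) ℂ}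
    {b : ℝ → ℂ} {Θ : ℝ → Matrix (Fin T) (Fin q) ℂ} (hp : IsFactor p b Θ) {h : ℝ → Fin T → ℂ}
    {k : ι → ℝ → Fin T → ℂ} {x : VecL2 q} {v : ι → VecL2 q} (hx : IsRep (specMap b Θ h) x)
    (hv : ∀ i, IsRep (specMap b Θ (k i)) (v i)) (c : ι →₀ ℂ) :
    specNormSq p (fun w => h w - c.sum fun i z => z • k i w) =
      ENNReal.ofReal (‖x - c.sum fun i z => z • v i‖ ^ 2) := by
  rw [hp.specNormSq_eq, specMap_sub_sum, (hx.sub_sum hv c).ofReal_norm_sq_eq]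

/-! ### Closed spans -/

lemma eLpNorm_sub_sum {ι Ω : Type*} [MeasurableSpace Ω] {P : Measure Ω} {Y : Ω → ℂ}
    {W : ι → Ω → ℂ} {y : Lp ℂ 2 P} {v : ι → Lp ℂ 2 P} (hy : y =ᵐ[P] Y) (hv : ∀ i, v i =ᵐ[P] W i)
    (c : ι →₀ ℂ) : eLpNorm (fun ω => Y ω - c.sum fun i z => z * W i ω) 2 P =
      ENNReal.ofReal ‖y - c.sum fun i z => z • v i‖ := by
  rw [Lp.norm_def, ENNReal.ofReal_toReal (Lp.eLpNorm_ne_top _)]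
  refine eLpNorm_congr_ae ?_
  filter_upwards [hy, coeFn_sum_smul c.support c hv,
    Lp.coeFn_sub y (∑ i ∈ c.support, c i • v i)] with w h2 h3 h4
  simp only [Finsupp.sum]
  rw [h4, Pi.sub_apply, h2, h3]

lemma mem_topologicalClosure_span_iff {ι E : Type*} [NormedAddCommGroup E] [NormedSpace ℂ E]
    (v : ι → E) (x : E) :
    x ∈ (Submodule.span ℂ (Set.range v)).topologicalClosure ↔
      ∀ ε : ℝ, 0 < ε → ∃ c : ι →₀ ℂ, ‖x - c.sum fun i z => z • v i‖ < ε := by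
  rw [← SetLike.mem_coe, Submodule.topologicalClosure_coe, Metric.mem_closure_iff]
  simp only [SetLike.mem_coe, dist_eq_norm, ← Finsupp.range_linearCombination, LinearMap.mem_range,
    exists_exists_eq_and, Finsupp.linearCombination_apply]

/-- Reconciles the two kinds of ε in the definitions: `specNormSq` is a squared norm, `eLpNorm` is
not. Taking u below 1 as well as below δ ensures u² < δ. -/
lemma forall_ofReal_lt_iff {ι : Type*} (u v : ι → ℝ) (hu : ∀ i, 0 ≤ u i) :
    (∀ ε : ℝ, 0 < ε → ∃ c, u c < ε ∧ v c < ε) ↔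
      ∀ ε : ℝ≥0∞, 0 < ε → ∃ c, ENNReal.ofReal (u c ^ 2) < ε ∧ ENNReal.ofReal (v c) < ε := by
  constructor
  · intro h ε hε
    obtain ⟨δ, hδ, hδε⟩ : ∃ δ : ℝ, 0 < δ ∧ ENNReal.ofReal δ ≤ ε := by
      rcases eq_or_ne ε ⊤ with rfl | hε'
      · exact ⟨1, one_pos, le_top⟩
      · exact ⟨ε.toReal, ENNReal.toReal_pos hε.ne' hε', (ENNReal.ofReal_toReal hε').le⟩
    obtain ⟨c, h1, h2⟩ := h (min 1 δ) (by positivity)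
    have hc1 : u c ^ 2 < δ := by
      have := lt_of_lt_of_le h1 (min_le_left _ _)
      have h3 := lt_of_lt_of_le h1 (min_le_right _ _)
      nlinarith [hu c]
    exact ⟨c, ((ENNReal.ofReal_lt_ofReal_iff hδ).2 hc1).trans_le hδε,
      ((ENNReal.ofReal_lt_ofReal_iff hδ).2 (lt_of_lt_of_le h2 (min_le_right _ _))).trans_le hδε⟩
  · intro h ε hε
    obtain ⟨c, h1, h2⟩ := h (ENNReal.ofReal (min (ε ^ 2) ε)) (ENNReal.ofReal_pos.2 (by positivity))
    rw [ENNReal.ofReal_lt_ofReal_iff (by positivity)] at h1 h2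
    exact ⟨c, lt_of_pow_lt_pow_left₀ 2 hε.le (lt_of_lt_of_le h1 (min_le_left _ _)),
      lt_of_lt_of_le h2 (min_le_right _ _)⟩

lemma mem_topologicalClosure_span_prod_iff {ι E F : Type*} [NormedAddCommGroup E]
    [NormedSpace ℂ E] [NormedAddCommGroup F] [NormedSpace ℂ F] (v : ι → E) (z : ι → F) (x : E)
    (y : F) : (x, y) ∈ (Submodule.span ℂ (Set.range fun i => (v i, z i))).topologicalClosure ↔
      ∀ ε : ℝ, 0 < ε → ∃ c : ι →₀ ℂ, ‖x - c.sum fun i a => a • v i‖ < ε ∧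
        ‖y - c.sum fun i a => a • z i‖ < ε := by
  rw [mem_topologicalClosure_span_iff]
  refine forall₂_congr fun ε _ => exists_congr fun c => ?_
  have : (c.sum fun i a => a • (v i, z i)) = (c.sum fun i a => a • v i, c.sum fun i a => a • z i) := by
    simp [Finsupp.sum, Prod.ext_iff, Prod.fst_sum, Prod.snd_sum]
  rw [this, Prod.mk_sub_mk, Prod.norm_mk, max_lt_iff]

/-- Membership in `L₂⁰(p)` as membership in a closed span. -/
lemma IsFactor.memL20_iff {r T q : ℕ} {p : ℝ → Matrix (Fin T) (Fin T) ℂ} {b : ℝ → ℂ}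
    {Θ : ℝ → Matrix (Fin T) (Fin q) ℂ} (hp : IsFactor p b Θ) {μ : Fin r → ℤ} {s d : Fin r → ℕ}
    {h : ℝ → Fin T → ℂ} (hm : AEStronglyMeasurable h circ) {x : VecL2 q}
    (hx : IsRep (specMap b Θ h) x) {v : ℕ × Fin T → VecL2 q}
    (hv : ∀ i, IsRep (specMap b Θ (incrFun μ s d (-(i.1 : ℤ)) i.2)) (v i)) :
    MemL20 μ s d p h ↔ x ∈ (Submodule.span ℂ (Set.range v)).topologicalClosure := by
  rw [MemL20, mem_topologicalClosure_span_iff]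
  simp only [hm, true_and]
  have := forall_ofReal_lt_iff (fun c : ℕ × Fin T →₀ ℂ => ‖x - c.sum fun i z => z • v i‖)
    (fun _ => 0) (fun _ => norm_nonneg _)
  simp only [ENNReal.ofReal_zero] at this
  constructor
  · intro h1 ε hε
    obtain ⟨c, hc, -⟩ := this.2 (fun ε hε => by
      obtain ⟨c, hc⟩ := h1 ε hε
      exact ⟨c, by rwa [← hp.specNormSq_sub_sum hx hv], hε⟩) ε hε
    exact ⟨c, hc⟩
  · intro h1 ε hε
    obtain ⟨c, hc, -⟩ := this.1 (fun ε hε => by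
      obtain ⟨c, hc⟩ := h1 ε hε
      exact ⟨c, hc, hε⟩) ε hε
    exact ⟨c, by rwa [hp.specNormSq_sub_sum hx hv]⟩

/-- The functions `1_{[-π, t)} δ_l`. -/
def stepFun {T : ℕ} (i : Set.Ico (-π) π × Fin T) (w : ℝ) : Fin T → ℂ :=
  Pi.single i.2 ((Set.Ico (-π) (i.1 : ℝ)).indicator (fun _ => (1 : ℂ)) w)

/-- Stochastic integrals as elements of the closure of the integration relation of step
functions. -/
lemma IsFactor.isStochInt_iff {T q : ℕ} {Ω : Type*} [MeasurableSpace Ω] {P : Measure Ω}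
    {p : ℝ → Matrix (Fin T) (Fin T) ℂ} {b : ℝ → ℂ}
    {Θ : ℝ → Matrix (Fin T) (Fin q) ℂ} (hp : IsFactor p b Θ) {Z : ℝ → Fin T → Ω → ℂ}
    {h : ℝ → Fin T → ℂ} (hm : AEStronglyMeasurable h circ) {Y : Ω → ℂ} {x : VecL2 q}
    {y : Lp ℂ 2 P} (hx : IsRep (specMap b Θ h) x) (hy : y =ᵐ[P] Y)
    {v : Set.Ico (-π) π × Fin T → VecL2 q} {z : Set.Ico (-π) π × Fin T → Lp ℂ 2 P}
    (hv : ∀ i, IsRep (specMap b Θ (stepFun i)) (v i))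
    (hz : ∀ i, z i =ᵐ[P] fun ω => Z (i.1 : ℝ) i.2 ω - Z (-π) i.2 ω) :
    IsStochInt P p Z h Y ↔
      (x, y) ∈ (Submodule.span ℂ (Set.range fun i => (v i, z i))).topologicalClosure := by
  have hY : MemLp Y 2 P := (memLp_congr_ae hy).1 (Lp.memLp y)
  rw [IsStochInt, mem_topologicalClosure_span_prod_iff, forall_ofReal_lt_iff _ _
    (fun _ => norm_nonneg _)]
  simp only [hm, hY, true_and]
  refine forall₂_congr fun ε _ => exists_congr fun c => and_congr ?_ ?_
  · rw [← hp.specNormSq_sub_sum hx hv]; rfl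
  · rw [← eLpNorm_sub_sum hy hz]

/-! ### Consequences of a factorization with an analytic inverse -/

/-- Parseval after moving the shift to y. Only indices k ≥ 0 survive because x is Hardy; y may have
coefficients of both signs. -/
lemma hasSum_inner_mulEz {x : Lp ℂ 2 circ} (hx : x ∈ hardy) (y : Lp ℂ 2 circ) (m : ℕ) :
    HasSum (fun k : ℕ => conj (coef k x) * coef ((k + m : ℕ) : ℤ) y) (inner ℂ (mulEz m x) y) := by
  have h1 : inner ℂ (mulEz m x) y = inner ℂ x (mulEz (-m) y) := by
    rw [← (mulEz (-m)).inner_map_map]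
    congr 1
    ext1
    filter_upwards [coeFn_mulEz (-m) (mulEz m x), coeFn_mulEz m x] with w h1 h2
    rw [h1, h2, ← mul_assoc, ← ez_add]; simp
  rw [h1]
  have := hasSum_nat_of_mem_hardy hx (mulEz (-m) y)
  simpa only [coef_mulEz, sub_neg_eq_add, Nat.cast_add] using this

/-- Multiplication by e^{-iwm}, m ≥ 0, preserves the Hardy space, so the vanishing theorem applies
to e^{-iwm}F_l as well and kills all coefficients of nonnegative order. -/
lemma integral_conj_ez_mul_eq_zero {ι : Type*} [Fintype ι] {c : ι → ℕ → ℂ} {F N : ι → ℝ → ℂ}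
    (hF : ∀ l, IsL2Series (c l) (F l)) (hN : ∀ l, Integrable (N l) circ)
    (hN0 : ∀ l, ∀ k : ℕ, ∫ w, conj (ez k w) * N l w ∂circ = 0) {u : ℝ → ℂ}
    (hu : Integrable u circ) (h : ∀ᵐ w ∂circ, ∑ l, conj (F l w) * N l w = u w) (m : ℕ) :
    ∫ w, conj (ez m w) * u w ∂circ = 0 := by
  have hae : (fun w => ∑ l, conj (ez m w * F l w) * N l w) =ᵐ[circ] fun w => conj (ez m w) * u w := by
    filter_upwards [h] with w hw
    rw [← hw, Finset.mul_sum]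
    simp only [map_mul, mul_assoc]
  rw [← integral_congr_ae hae]
  refine integral_sum_conj_mul_eq_zero hN hN0 (f := fun l w => ez m w * F l w)
    (fun l => memLp_ez_mul m (hF l).1) (fun l => ?_) (Integrable.congr ?_ hae.symm)
  · rw [← mulEz_toLp m (hF l).1]
    exact mulEz_mem_hardy m (hF l).mem_hardy
  · exact hu.bdd_mul (c := 1) (continuous_ez m).star.aestronglyMeasurable
      (ae_of_all _ fun w => by simp)

lemma integrable_sum_conj_mul {n : ℕ} {F : Fin n → ℝ → ℂ} (hF : ∀ j, MemLp (F j) 2 circ)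
    (u : VecL2 n) : Integrable (fun w => ∑ j, conj (F j w) * u j w) circ :=
  integrable_finsetSum _ fun j _ => integrable_conj_mul (hF j) (Lp.memLp (u j))

lemma sum_conj_mul_sum {T q : ℕ} {A : Matrix (Fin T) (Fin q) ℂ} {B : Matrix (Fin q) (Fin T) ℂ}
    (h : B * A = 1) (u : Fin q → ℂ) (j : Fin q) :
    ∑ l, conj (B j l) * ∑ i, conj (A l i) * u i = u j := by
  have h1 : ∀ i, ∑ l, conj (B j l) * conj (A l i) = if j = i then 1 else 0 := fun i => by
    have := congrFun (congrFun h j) i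
    rw [Matrix.mul_apply, Matrix.one_apply] at this
    simp only [← map_mul, ← map_sum, this]
    split_ifs <;> simp
  simp only [Finset.mul_sum, ← mul_assoc]
  rw [Finset.sum_comm]
  simp only [← Finset.sum_mul, h1]
  simp

section Factor

variable {T q : ℕ} {θ : ℕ → Matrix (Fin T) (Fin q) ℂ} {Θ : ℝ → Matrix (Fin T) (Fin q) ℂ}
  {ψ : ℕ → Matrix (Fin q) (Fin T) ℂ} {Ψ : ℝ → Matrix (Fin q) (Fin T) ℂ}

lemma inner_rep_ez {u x : VecL2 q} {m : ℤ} {l : Fin T}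
    (hx : IsRep (fun w j => ez m w * Θ w l j) x) :
    inner ℂ x u = ∫ w, conj (ez m w) * ∑ j, conj (Θ w l j) * u j w ∂circ := by
  rw [hx.inner_eq (G := fun w j => u j w) fun j => ae_eq_refl _]
  congr 1; ext w
  rw [Finset.mul_sum]
  simp only [map_mul, mul_assoc]

/-- The Fourier coefficients of nonnegative order of `X` are determined by those of `X Θ*`. -/
lemma coef_eq_sum_inner (hΘ : ∀ l j, MemLp (fun w => Θ w l j) 2 circ)
    (hΨ : ∀ j l, IsL2Series (fun k => ψ k j l) (fun w => Ψ w j l))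
    (hinv : ∀ᵐ w ∂circ, Ψ w * Θ w = 1) {v : ℤ → Fin T → VecL2 q}
    (hv : ∀ m l, IsRep (fun w j => ez m w * Θ w l j) (v m l)) {X : VecL2 q}
    {C : Fin T → Lp ℂ 2 circ} (hC : ∀ (k : ℕ) l, inner ℂ (v k l) X = coef k (C l))
    (m : ℕ) (j : Fin q) :
    coef m (X j) = ∑ l, inner ℂ (mulEz m (hΨ j l).1.toLp) (C l) := by
  have hC1 : ∀ l, Integrable (C l) circ := fun l => (Lp.memLp (C l)).integrable (by norm_num)
  have hX1 : ∀ l, Integrable (fun w => ∑ j, conj (Θ w l j) * X j w) circ := fun l =>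
    integrable_sum_conj_mul (hΘ l) X
  have hΨC : ∀ l, Integrable (fun w => conj (Ψ w j l) * C l w) circ := fun l =>
    integrable_conj_mul (hΨ j l).1 (Lp.memLp (C l))
  have hez : ∀ (k : ℤ) {F : ℝ → ℂ}, Integrable F circ →
      Integrable (fun w => conj (ez k w) * F w) circ := fun k F hF =>
    hF.bdd_mul (c := 1) (continuous_ez k).star.aestronglyMeasurable (ae_of_all _ fun w => by simp)
  -- The functions Σ_j conj Θ_{lj} X_j − C_l have no coefficients of order k ≥ 0. Summed against
  -- conj Ψ_{jl} they give X_j − Σ_l conj Ψ_{jl} C_l, which is integrable even if the separate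
  -- triple products are not.
  have key := integral_conj_ez_mul_eq_zero (c := fun l k => ψ k j l) (F := fun l w => Ψ w j l)
    (N := fun l w => ∑ j, conj (Θ w l j) * X j w - C l w)
    (fun l => hΨ j l) (fun l => (hX1 l).sub (hC1 l))
    (fun l k => by
      simp only [mul_sub]
      rw [integral_sub (hez k (hX1 l)) (hez k (hC1 l)), ← inner_rep_ez (hv k l), hC,
        coef_eq_of_ae k (ae_eq_refl _), sub_self])
    (u := fun w => X j w - ∑ l, conj (Ψ w j l) * C l w)
    (((Lp.memLp (X j)).integrable (by norm_num)).sub (integrable_finsetSum _ fun l _ => hΨC l))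
    (by
      filter_upwards [hinv] with w hw
      simp only [mul_sub, Finset.sum_sub_distrib]
      rw [sum_conj_mul_sum hw fun i => X i w]) m
  simp only [mul_sub] at key
  rw [integral_sub (hez m ((Lp.memLp (X j)).integrable (by norm_num)))
    (hez m (integrable_finsetSum _ fun l _ => hΨC l)), sub_eq_zero] at key
  rw [coef_eq_of_ae m (ae_eq_refl _), key]
  simp only [Finset.mul_sum]
  rw [integral_finsetSum _ fun l _ => hez m (hΨC l)]
  refine Finset.sum_congr rfl fun l _ => ?_
  rw [mulEz_toLp, inner_eq_integral_of_ae (MemLp.coeFn_toLp _) (ae_eq_refl _)]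
  congr 1; ext w
  rw [map_mul, mul_assoc]

lemma eq_zero_of_sum_conj_mul (hinv : ∀ᵐ w ∂circ, Ψ w * Θ w = 1) {u : VecL2 q}
    (h : ∀ l, ∀ᵐ w ∂circ, ∑ j, conj (Θ w l j) * u j w = 0) : u = 0 := by
  ext j : 1
  rw [PiLp.zero_apply, Lp.eq_zero_iff_ae_eq_zero]
  filter_upwards [hinv, ae_all_iff.2 h] with w hw h'
  rw [← sum_conj_mul_sum hw fun i => u i w]
  simp [h']

/-- The trigonometric multiples of the rows of `Θ` span a dense subspace. -/
lemma closure_span_ez_eq_top (hΘ : ∀ l j, MemLp (fun w => Θ w l j) 2 circ)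
    (hinv : ∀ᵐ w ∂circ, Ψ w * Θ w = 1) {v : ℤ → Fin T → VecL2 q}
    (hv : ∀ m l, IsRep (fun w j => ez m w * Θ w l j) (v m l)) :
    (Submodule.span ℂ (Set.range fun i : ℤ × Fin T => v i.1 i.2)).topologicalClosure = ⊤ := by
  rw [Submodule.topologicalClosure_eq_top_iff, Submodule.eq_bot_iff]
  intro u hu
  -- Orthogonality of u to all shifts says that every Fourier coefficient of Σ_j conj Θ_{lj} u_j is
  -- zero; the left inverse Ψ then recovers u = 0.
  refine eq_zero_of_sum_conj_mul hinv fun l => ?_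
  refine ae_eq_zero_of_integral_ez_mul (integrable_sum_conj_mul (hΘ l) u) fun k => ?_
  have := (Submodule.mem_orthogonal _ _).1 hu _ (Submodule.subset_span ⟨(-k, l), rfl⟩)
  rw [inner_rep_ez (hv (-k) l)] at this
  simpa only [conj_ez, neg_neg] using this

/-- Step functions are dense in `L₂(p)`. -/
lemma closure_span_stepFun_eq_top {b : ℝ → ℂ} (hinv : ∀ᵐ w ∂circ, Ψ w * Θ w = 1)
    (hb : ∀ᵐ w ∂circ, b w ≠ 0)
    (hbΘ : ∀ l j, MemLp (fun w => b w * Θ w l j) 2 circ)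
    {v : Set.Ico (-π) π × Fin T → VecL2 q}
    (hv : ∀ i, IsRep (specMap b Θ (stepFun i)) (v i)) :
    (Submodule.span ℂ (Set.range v)).topologicalClosure = ⊤ := by
  rw [Submodule.topologicalClosure_eq_top_iff, Submodule.eq_bot_iff]
  intro u hu
  refine eq_zero_of_sum_conj_mul hinv fun l => ?_
  have h1 := ae_eq_zero_of_integral_Ico
    (integrable_sum_conj_mul (F := fun j w => b w * Θ w l j) (hbΘ l) u) fun t ht => by
      have := (Submodule.mem_orthogonal _ _).1 hu _ (Submodule.subset_span ⟨(⟨t, ht⟩, l), rfl⟩)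
      rw [(hv _).inner_eq (G := fun w j => u j w) fun j => ae_eq_refl _] at this
      rw [← this, ← integral_indicator measurableSet_Ico]
      congr 1; ext w
      unfold stepFun
      simp only [specMap_single]
      by_cases hw : w ∈ Set.Ico (-π) t <;> simp [hw]
  filter_upwards [h1, hb] with w hw hb
  simp only [map_mul, mul_assoc, ← Finset.mul_sum, Pi.zero_apply, mul_eq_zero, map_eq_zero] at hw
  exact hw.resolve_left hb

end Factor

/-! ### Series of shifted rows -/

/-- The class of `e^{-iwm}` times the `l`-th row of `M`. -/
def rowVec {T q : ℕ} {M : ℝ → Matrix (Fin T) (Fin q) ℂ}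
    (hM : ∀ l j, MemLp (fun w => M w l j) 2 circ) (m : ℤ) (l : Fin T) : VecL2 q :=
  WithLp.toLp 2 fun j => mulEz m (hM l j).toLp

lemma isRep_rowVec {T q : ℕ} {M : ℝ → Matrix (Fin T) (Fin q) ℂ}
    (hM : ∀ l j, MemLp (fun w => M w l j) 2 circ) (m : ℤ) (l : Fin T) :
    IsRep (fun w j => ez m w * M w l j) (rowVec hM m l) := fun j => by
  filter_upwards [coeFn_mulEz m (hM l j).toLp, (hM l j).coeFn_toLp] with w h1 h2
  change (mulEz m (hM l j).toLp : ℝ → ℂ) w = _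
  rw [h1, h2]

lemma isRep_rowVec_specMap {T q : ℕ} {M : ℝ → Matrix (Fin T) (Fin q) ℂ}
    (hM : ∀ l j, MemLp (fun w => M w l j) 2 circ) (m : ℤ) (l : Fin T) :
    IsRep (specMap (fun _ => 1) M fun w => Pi.single l (ez m w)) (rowVec hM m l) := fun j => by
  filter_upwards [isRep_rowVec hM m l j] with w h1
  rw [h1, specMap_single, one_mul]

@[simp] lemma rowVec_apply {T q : ℕ} {M : ℝ → Matrix (Fin T) (Fin q) ℂ}
    (hM : ∀ l j, MemLp (fun w => M w l j) 2 circ) (m : ℤ) (l : Fin T) (j : Fin q) :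
    rowVec hM m l j = mulEz m (hM l j).toLp := rfl

lemma norm_rowVec {T q : ℕ} {M : ℝ → Matrix (Fin T) (Fin q) ℂ}
    (hM : ∀ l j, MemLp (fun w => M w l j) 2 circ) (m : ℤ) (l : Fin T) :
    ‖rowVec hM m l‖ = ‖rowVec hM 0 l‖ := by
  simp only [PiLp.norm_eq_of_L2, rowVec_apply, LinearIsometry.norm_map]

lemma inner_rowVec_shift {T q : ℕ} {M : ℝ → Matrix (Fin T) (Fin q) ℂ}
    (hM : ∀ l j, MemLp (fun w => M w l j) 2 circ) (m k t : ℤ) (l p : Fin T) :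
    inner ℂ (rowVec hM (m + t) l) (rowVec hM k p) = inner ℂ (rowVec hM m l) (rowVec hM (k - t) p) := by
  rw [(isRep_rowVec hM _ _).inner_eq (isRep_rowVec hM _ _),
    (isRep_rowVec hM _ _).inner_eq (isRep_rowVec hM _ _)]
  congr 1; ext w
  refine Finset.sum_congr rfl fun j _ => ?_
  rw [sub_eq_add_neg, ez_add, ez_add, ← conj_ez]
  simp only [map_mul]; ring

lemma norm_le_vnorm {n : ℕ} (v : Fin n → ℂ) (i : Fin n) : ‖v i‖ ≤ vnorm v :=
  Real.le_sqrt_of_sq_le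
    (Finset.single_le_sum (f := fun i => ‖v i‖ ^ 2) (fun _ _ => by positivity) (Finset.mem_univ i))

lemma vnorm_sq {n : ℕ} (v : Fin n → ℂ) : vnorm v ^ 2 = ∑ i, ‖v i‖ ^ 2 :=
  Real.sq_sqrt (Finset.sum_nonneg fun _ _ => by positivity)

lemma summable_norm_of_summable_vnorm {n : ℕ} {a : ℕ → Fin n → ℂ}
    (ha : Summable fun k => vnorm (a k)) (i : Fin n) : Summable fun k => ‖a k i‖ :=
  ha.of_nonneg_of_le (fun _ => norm_nonneg _) fun _ => norm_le_vnorm _ _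

lemma summable_vnorm_sq_iff {n : ℕ} {a : ℕ → Fin n → ℂ} :
    (Summable fun k => vnorm (a k) ^ 2) ↔ ∀ i, Summable fun k => ‖a k i‖ ^ 2 := by
  simp only [vnorm_sq]
  refine ⟨fun h i => h.of_nonneg_of_le (fun _ => by positivity) fun k => ?_,
    fun h => summable_sum fun i _ => h i⟩
  exact Finset.single_le_sum (f := fun i => ‖a k i‖ ^ 2) (fun _ _ => by positivity)
    (Finset.mem_univ i)

section Synthesis

variable {T q : ℕ} {φ : ℕ → Matrix (Fin T) (Fin q) ℂ} {Φ : ℝ → Matrix (Fin T) (Fin q) ℂ}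

/-- The series `∑ₖ α(k)ᵀ e^{-iw e(k)} Φ`. -/
def synth (hΦ : ∀ l j, MemLp (fun w => Φ w l j) 2 circ) (e : ℕ → ℤ) (α : ℕ → Fin T → ℂ) :
    VecL2 q := ∑' k, ∑ p, α k p • rowVec hΦ (e k) p

lemma hasSum_smul_rowVec (hΦ : ∀ l j, MemLp (fun w => Φ w l j) 2 circ) (e : ℕ → ℤ) {α : ℕ → ℂ}
    (hα : Summable fun k => ‖α k‖) (p : Fin T) : Summable fun k => α k • rowVec hΦ (e k) p := by
  refine Summable.of_norm ?_
  simp only [norm_smul, norm_rowVec hΦ (e _)]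
  exact hα.mul_right _

lemma hasSum_synth (hΦ : ∀ l j, MemLp (fun w => Φ w l j) 2 circ) (e : ℕ → ℤ) {α : ℕ → Fin T → ℂ}
    (hα : ∀ p, Summable fun k => ‖α k p‖) :
    HasSum (fun k => ∑ p, α k p • rowVec hΦ (e k) p) (synth hΦ e α) :=
  (summable_sum fun p _ => hasSum_smul_rowVec hΦ e (hα p) p).hasSum

lemma synth_eq_sum (hΦ : ∀ l j, MemLp (fun w => Φ w l j) 2 circ) (e : ℕ → ℤ) {α : ℕ → Fin T → ℂ}
    (hα : ∀ p, Summable fun k => ‖α k p‖) :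
    synth hΦ e α = ∑ p, ∑' k, α k p • rowVec hΦ (e k) p :=
  Summable.tsum_finsetSum fun p _ => hasSum_smul_rowVec hΦ e (hα p) p

lemma synth_mem_closure (hΦ : ∀ l j, MemLp (fun w => Φ w l j) 2 circ) (e : ℕ → ℤ)
    {α : ℕ → Fin T → ℂ} (hα : ∀ p, Summable fun k => ‖α k p‖) :
    synth hΦ e α ∈ (Submodule.span ℂ
      (Set.range fun i : ℤ × Fin T => rowVec hΦ i.1 i.2)).topologicalClosure := by
  refine (Submodule.isClosed_topologicalClosure _).mem_of_tendsto (hasSum_synth hΦ e hα)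
    (Eventually.of_forall fun _ => Submodule.sum_mem _ fun k _ => Submodule.sum_mem _ fun p _ =>
      Submodule.smul_mem _ _ (Submodule.le_topologicalClosure _
        (Submodule.subset_span ⟨(e k, p), rfl⟩)))

lemma hasSum_synth_apply (hΦ : ∀ l j, MemLp (fun w => Φ w l j) 2 circ) (e : ℕ → ℤ)
    {α : ℕ → Fin T → ℂ} (hα : ∀ p, Summable fun k => ‖α k p‖) (j : Fin q) :
    HasSum (fun k => ∑ p, α k p • mulEz (e k) (hΦ p j).toLp) (synth hΦ e α j) := by
  have := (PiLp.proj (𝕜 := ℂ) 2 (fun _ : Fin q => Lp ℂ 2 circ) j).hasSum (hasSum_synth hΦ e hα)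
  simpa [Function.comp_def] using this

/-- Reversing the inner product puts g_{lp} under the integral instead of g_{pl}, at the price of
the conjugate that appears in G⁻ and G⁺. -/
lemma inner_rowVec_eq_gCoeff {g : ℝ → Matrix (Fin T) (Fin T) ℂ}
    (hg : IsFactor g (fun _ => 1) Φ) (hΦ : ∀ l j, MemLp (fun w => Φ w l j) 2 circ) (m k : ℤ)
    (l p : Fin T) :
    inner ℂ (rowVec hΦ m l) (rowVec hΦ k p) = mconj (gCoeff g (m - k)) l p := by
  rw [← inner_conj_symm,
    hg.inner_eq (isRep_rowVec_specMap hΦ k p) (isRep_rowVec_specMap hΦ m l), mconj,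
    Matrix.map_apply, gCoeff]
  congr 2; ext w
  rw [conj_ez, ← ez_add, mul_comm, neg_add_eq_sub]
  rfl

lemma hasSum_gCoeff_mulVec {g : ℝ → Matrix (Fin T) (Fin T) ℂ}
    (hg : IsFactor g (fun _ => 1) Φ) (hΦ : ∀ l j, MemLp (fun w => Φ w l j) 2 circ) (e : ℕ → ℤ)
    {α : ℕ → Fin T → ℂ} (hα : ∀ p, Summable fun k => ‖α k p‖) (m : ℤ) :
    HasSum (fun k => mconj (gCoeff g (m - e k)) *ᵥ α k)
      (fun l => inner ℂ (rowVec hΦ m l) (synth hΦ e α)) := by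
  rw [Pi.hasSum]
  intro l
  have := (innerSL ℂ (rowVec hΦ m l)).hasSum (hasSum_synth hΦ e hα)
  simpa [Function.comp_def, inner_sum, inner_smul_right, inner_rowVec_eq_gCoeff hg hΦ,
    Matrix.mulVec, dotProduct, mul_comm] using this

/-- With e(k) = k this evaluates Φ̃ and with e(k) = −k it evaluates Φ̃⁺: both operators list the
coefficients of order n ≥ 0 of a synthesized function. -/
lemma hasSum_blockApply_synth (hΦ : ∀ l j, MemLp (fun w => Φ w l j) 2 circ) (e : ℕ → ℤ)
    {α : ℕ → Fin T → ℂ} (hα : ∀ p, Summable fun k => ‖α k p‖)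
    {M : ℕ → ℕ → Matrix (Fin q) (Fin T) ℂ}
    (hM : ∀ n k j p, M n k j p = coef (n - e k) (hΦ p j).toLp) (n : ℕ) :
    HasSum (fun k => M n k *ᵥ α k) (fun j => coef n (synth hΦ e α j)) := by
  rw [Pi.hasSum]
  intro j
  have := (innerSL ℂ ((memLp_ez (n : ℤ)).toLp)).hasSum (hasSum_synth_apply hΦ e hα j)
  have h2 : ∀ (k : ℤ) x, inner ℂ ((memLp_ez (n : ℤ)).toLp) (mulEz k x) = coef (n - k) x :=
    fun k x => coef_mulEz n k x
  change HasSum _ (inner ℂ ((memLp_ez (n : ℤ)).toLp) (synth hΦ e α j))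
  simpa [Function.comp_def, inner_sum, inner_smul_right, h2, hM, Matrix.mulVec, dotProduct,
    mul_comm] using this

lemma coef_opTilde (hφ : ∀ l j, IsL2Series (fun k => φ k l j) (fun w => Φ w l j)) (n k : ℕ)
    (j : Fin q) (p : Fin T) :
    opTilde φ n k j p = coef ((n : ℤ) - (k : ℤ)) (hφ p j).1.toLp := by
  rw [opTilde]
  split_ifs with h
  · rw [Matrix.transpose_apply, ← Nat.cast_sub h, (hφ p j).coef]
  · rw [coef_of_mem_hardy (hφ p j).mem_hardy (by omega)]; rfl

lemma coef_opTildePlus (hφ : ∀ l j, IsL2Series (fun k => φ k l j) (fun w => Φ w l j)) (n k : ℕ)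
    (j : Fin q) (p : Fin T) :
    opTildePlus φ n k j p = coef ((n : ℤ) - (-(k : ℤ))) (hφ p j).1.toLp := by
  rw [opTildePlus, Matrix.transpose_apply, sub_neg_eq_add, ← Nat.cast_add, (hφ p j).coef]

/-- Since Φ has only coefficients of order n ≥ 0, pairing with e^{-iwm}Φ reads only the coefficients
of x of order at least m. Thus x need not be Hardy, which matters for the series over b_{-μ} with
its frequencies e^{iwk}. -/
lemma hasSum_mconj_mulVec (hφ : ∀ l j, IsL2Series (fun k => φ k l j) (fun w => Φ w l j))
    (x : VecL2 q) (m : ℕ) :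
    HasSum (fun n : ℕ => mconj (φ n) *ᵥ fun j => coef ((n + m : ℕ) : ℤ) (x j))
      (fun l => inner ℂ (rowVec (fun l j => (hφ l j).1) m l) x) := by
  rw [Pi.hasSum]
  intro l
  rw [PiLp.inner_apply]
  simp only [Matrix.mulVec, dotProduct]
  refine hasSum_sum fun j _ => ?_
  have := hasSum_inner_mulEz (hφ l j).mem_hardy (x j) m
  simp only [(hφ l j).coef] at this
  exact this

lemma synth_apply_mem_hardy (hφ : ∀ l j, IsL2Series (fun k => φ k l j) (fun w => Φ w l j))
    {α : ℕ → Fin T → ℂ} (hα : ∀ p, Summable fun k => ‖α k p‖) (j : Fin q) :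
    synth (fun l j => (hφ l j).1) (fun k => (k : ℤ)) α j ∈ hardy :=
  isClosed_hardy.mem_of_tendsto (hasSum_synth_apply (fun l j => (hφ l j).1) (fun k => (k : ℤ)) hα j)
    (Eventually.of_forall fun _ => Submodule.sum_mem _ fun k _ => Submodule.sum_mem _ fun p _ =>
      Submodule.smul_mem _ _ (mulEz_mem_hardy k (hφ p j).mem_hardy))

end Synthesis

/-- Application of the adjoint of a lower triangular Toeplitz matrix. -/
lemma hasSum_blockAdj_opTilde {m n : ℕ} {c : ℕ → Matrix (Fin m) (Fin n) ℂ} {y : ℕ → Fin n → ℂ}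
    {l : ℕ} {S : Fin m → ℂ} (h : HasSum (fun k => mconj (c k) *ᵥ y (k + l)) S) :
    HasSum (fun k => blockAdj (opTilde c) l k *ᵥ y k) S := by
  rw [← Function.Injective.hasSum_iff (add_left_injective l)]
  · convert h using 2 with k
    simp only [Function.comp_apply, blockAdj, opTilde, Nat.le_add_left, if_true,
      Nat.add_sub_cancel]
    rfl
  · intro k hk
    have : ¬ l ≤ k := fun h => hk ⟨k - l, by simp; omega⟩
    simp [blockAdj, opTilde, this]

/-! ### The transformed coefficients -/

/-- Extension of a sequence by zero to negative indices. -/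
def zext (a : ℕ → ℂ) (k : ℤ) : ℂ := if 0 ≤ k then a k.toNat else 0

/-- Extending a by zero removes the cutoff max{m, 0}, so the summation range no longer depends on m.
-/
lemma aNeg_apply {r T : ℕ} (μ s d : Fin r → ℕ) (a : ℕ → Fin T → ℂ) (m : ℤ) (p : Fin T) :
    aNeg μ s d a m p = ∑ t ∈ Finset.range (nGamma μ s d + 1),
      (eGamma μ s d t : ℂ) * zext (fun k => a k p) (m + t) := by
  have h1 : aNeg μ s d a m p = ∑ l ∈ Finset.Icc m (m + (nGamma μ s d : ℤ)),
      (eGamma μ s d (l - m).toNat : ℂ) * zext (fun k => a k p) l := by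
    rw [← Finset.sum_subset (s₁ := Finset.Icc (max m 0) (m + (nGamma μ s d : ℤ)))
      (Finset.Icc_subset_Icc_left (le_max_left _ _))]
    · rw [aNeg, Finset.sum_apply]
      refine Finset.sum_congr rfl fun l hl => ?_
      have : 0 ≤ l := (le_max_right _ _).trans (Finset.mem_Icc.1 hl).1
      simp [zext, this]
    · intro l hl hl'
      have : ¬ 0 ≤ l := fun h => hl' (by simp only [Finset.mem_Icc] at *; omega)
      simp [zext, this]
  rw [h1]
  refine Finset.sum_nbij' (fun l => (l - m).toNat) (fun t => m + t) ?_ ?_ ?_ ?_ ?_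
  · intro l hl; simp only [Finset.mem_Icc, Finset.mem_range] at *; omega
  · intro t ht; simp only [Finset.mem_Icc, Finset.mem_range] at *; omega
  · intro l hl; simp only [Finset.mem_Icc] at *; omega
  · intro t ht; omega
  · intro l hl
    simp only [Finset.mem_Icc] at hl
    rw [Int.toNat_of_nonneg (by omega), add_sub_cancel]

lemma aNeg_eq_zero {r T : ℕ} (μ s d : Fin r → ℕ) (a : ℕ → Fin T → ℂ) {m : ℤ}
    (hm : m + nGamma μ s d < 0) : aNeg μ s d a m = 0 := by
  rw [aNeg, Finset.Icc_eq_empty (by omega), Finset.sum_empty]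

lemma bMinus_succ {r T : ℕ} (μ s d : Fin r → ℕ) (a : ℕ → Fin T → ℂ) (k : ℕ) :
    bMinus μ s d a (k + 1) = aNeg μ s d a (-(k + 1 : ℤ)) := by
  rw [bMinus]
  split_ifs with h
  · push_cast; rfl
  · rw [aNeg_eq_zero]; omega

lemma summable_norm_aMinus {r T : ℕ} (μ s d : Fin r → ℕ) {a : ℕ → Fin T → ℂ}
    (ha : ∀ p, Summable fun k => ‖a k p‖) (p : Fin T) :
    Summable fun k => ‖aMinus μ s d a k p‖ := by
  refine Summable.of_nonneg_of_le (fun _ => norm_nonneg _) (fun k => ?_)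
    (summable_sum (s := Finset.range (nGamma μ s d + 1)) fun t _ =>
      ((summable_nat_add_iff t).2 (ha p)).mul_left ‖(eGamma μ s d t : ℂ)‖)
  rw [aMinus, aNeg_apply]
  refine (norm_sum_le _ _).trans (Finset.sum_le_sum fun t _ => ?_)
  rw [norm_mul]
  have : (0 : ℤ) ≤ k + t := by positivity
  rw [zext, if_pos this, show ((k : ℤ) + t).toNat = k + t by omega]

lemma summable_norm_bMinus {r T : ℕ} (μ s d : Fin r → ℕ) (a : ℕ → Fin T → ℂ) (p : Fin T) :
    Summable fun k => ‖bMinus μ s d a k p‖ := by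
  refine summable_of_ne_finset_zero (s := Finset.range (nGamma μ s d + 1)) fun k hk => ?_
  have : ¬ (1 ≤ k ∧ k ≤ nGamma μ s d) := fun h => hk (Finset.mem_range.2 (by omega))
  simp [bMinus, this]

/-- a_{-μ} is the correlation of e_γ with a; the substitution k = m + t for each of the finitely
many t passes the shifts to R. -/
lemma hasSum_aNeg_smul {r T : ℕ} {E : Type*} [NormedAddCommGroup E] [NormedSpace ℂ E]
    (μ s d : Fin r → ℕ) (a : ℕ → Fin T → ℂ) (p : Fin T) (R : ℤ → E)
    (hR : ∀ t : ℤ, Summable fun k : ℕ => a k p • R (k - t)) :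
    HasSum (fun m : ℤ => aNeg μ s d a m p • R m)
      (∑ t ∈ Finset.range (nGamma μ s d + 1), (eGamma μ s d t : ℂ) • ∑' k : ℕ, a k p • R (k - t)) := by
  simp only [aNeg_apply, Finset.sum_smul, mul_smul]
  refine hasSum_sum fun t _ => HasSum.const_smul _ ?_
  have h1 : HasSum (fun k : ℤ => zext (fun k => a k p) k • R (k - t)) (∑' k : ℕ, a k p • R (k - t)) := by
    refine (Function.Injective.hasSum_iff (f := fun k : ℤ => zext (fun k => a k p) k • R (k - t))
      (g := fun n : ℕ => (n : ℤ)) Nat.cast_injective ?_).1 ?_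
    · intro k hk
      have : ¬ 0 ≤ k := fun h => hk ⟨k.toNat, by simp; omega⟩
      simp [zext, this]
    · convert (hR t).hasSum using 2 with k
      simp [zext]
  have h2 := (Equiv.addRight (t : ℤ)).hasSum_iff.2 h1
  simpa [Function.comp_def] using h2

/-- The left side is the series of a multiplied by conj χ_μ, which lowers orders by at most n(γ).
Terms of order ≥ 0 collect to a_{-μ}, the finitely many of negative order to b_{-μ}. -/
lemma sum_smul_synth {r T q : ℕ} {Φ : ℝ → Matrix (Fin T) (Fin q) ℂ} (μ s d : Fin r → ℕ)
    {a : ℕ → Fin T → ℂ} (ha : ∀ p, Summable fun k => ‖a k p‖)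
    (hΦ : ∀ l j, MemLp (fun w => Φ w l j) 2 circ) :
    ∑ t ∈ Finset.range (nGamma μ s d + 1), (eGamma μ s d t : ℂ) • synth hΦ (fun k => k - t) a =
      synth hΦ (fun k => k) (aMinus μ s d a) + synth hΦ (fun k => -k) (bMinus μ s d a) := by
  simp only [synth_eq_sum hΦ _ ha, synth_eq_sum hΦ _ (summable_norm_aMinus μ s d ha),
    synth_eq_sum hΦ _ (summable_norm_bMinus μ s d a), Finset.smul_sum]
  rw [Finset.sum_comm, ← Finset.sum_add_distrib]
  refine Finset.sum_congr rfl fun p _ => ?_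
  have h1 := hasSum_aNeg_smul μ s d a p (fun m => rowVec hΦ m p)
    fun t => hasSum_smul_rowVec hΦ _ (ha p) p
  refine h1.unique ?_
  have h2 := (hasSum_smul_rowVec hΦ (fun k => -k) (summable_norm_bMinus μ s d a p) p).hasSum
  -- The zeroth term of b_{-μ} is zero by convention; dropping it matches the enumeration −(k+1) of
  -- the negative integers.
  rw [← hasSum_nat_add_iff' 1] at h2
  have hb0 : bMinus μ s d a 0 p = 0 := by simp [bMinus]
  rw [Finset.sum_range_one, hb0, zero_smul, sub_zero] at h2
  refine HasSum.of_nat_of_neg_add_one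
    (hasSum_smul_rowVec hΦ (fun k => k) (summable_norm_aMinus μ s d ha p) p).hasSum ?_
  have h3 : (fun k : ℕ => bMinus μ s d a (k + 1) p • rowVec hΦ (-((k + 1 : ℕ) : ℤ)) p) =
      fun k : ℕ => aNeg μ s d a (-(k + 1 : ℤ)) p • rowVec hΦ (-(k + 1 : ℤ)) p := by
    funext k
    rw [bMinus_succ]; push_cast; rfl
  exact h3 ▸ h2

/-! ### Increments of stationary sequences -/

/-- The v i need not have dense span here, so the isometry on their closed span is preceded by the
orthogonal projection. This serves Φ, for which no left inverse is given. -/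
lemma exists_clm_of_gram {ι E F : Type*} [NormedAddCommGroup E] [InnerProductSpace ℂ E]
    [CompleteSpace E] [NormedAddCommGroup F] [InnerProductSpace ℂ F] [CompleteSpace F] (v : ι → E)
    (y : ι → F) (hgram : ∀ i j, inner ℂ (v i) (v j) = inner ℂ (y i) (y j)) :
    ∃ W : E →L[ℂ] F, (∀ i, W (v i) = y i) ∧
      ∀ x ∈ (Submodule.span ℂ (Set.range v)).topologicalClosure,
      ∀ z ∈ (Submodule.span ℂ (Set.range v)).topologicalClosure,
        inner ℂ (W x) (W z) = inner ℂ x z := by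
  obtain ⟨K, hK⟩ : ∃ K, K = (Submodule.span ℂ (Set.range v)).topologicalClosure := ⟨_, rfl⟩
  have hvK : ∀ i, v i ∈ K := fun i =>
    hK ▸ Submodule.le_topologicalClosure _ (Submodule.subset_span ⟨i, rfl⟩)
  have hKc : IsClosed (K : Set E) := hK ▸ Submodule.isClosed_topologicalClosure _
  have : CompleteSpace K := hKc.completeSpace_coe
  obtain ⟨U, hU⟩ := exists_linearIsometry_of_gram (fun i => (⟨v i, hvK i⟩ : K)) y hgram (by
    rw [Submodule.topologicalClosure_eq_top_iff, Submodule.eq_bot_iff]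
    rintro ⟨x, hx⟩ hx'
    have h1 : K ≤ LinearMap.ker (innerSL ℂ x).toLinearMap := by
      rw [hK]
      refine Submodule.topologicalClosure_minimal _ ?_ (innerSL ℂ x).isClosed_ker
      rw [Submodule.span_le]
      rintro _ ⟨i, rfl⟩
      have := (Submodule.mem_orthogonal' _ _).1 hx' ⟨v i, hvK i⟩ (Submodule.subset_span ⟨i, rfl⟩)
      simpa using this
    have h2 : inner ℂ x x = 0 := by simpa using h1 hx
    exact Subtype.ext (inner_self_eq_zero.1 h2))
  have hUK : ∀ x (hx : x ∈ K), U (K.orthogonalProjectionOnto x) = U ⟨x, hx⟩ := fun x hx => by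
    congr 1
    exact Submodule.orthogonalProjectionOnto_mem_subspace_eq_self (K := K) ⟨x, hx⟩
  refine ⟨U.toContinuousLinearMap.comp K.orthogonalProjectionOnto, fun i => ?_, fun x hx z hz => ?_⟩
  · rw [← hU i]; exact hUK _ (hvK i)
  · rw [← hK] at hx hz
    change inner ℂ (U (K.orthogonalProjectionOnto x)) (U (K.orthogonalProjectionOnto z)) = _
    rw [hUK x hx, hUK z hz, U.inner_map_map]
    rfl

lemma cexp_eq_ez (w : ℝ) (m : ℤ) : Complex.exp (Complex.I * w * (m : ℂ)) = ez (-m) w := by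
  rw [ez]; push_cast; ring_nf

/-- A stationary sequence is the image of the rows of a factor of its spectral density. -/
lemma exists_spectral_map {Ω : Type*} [MeasurableSpace Ω] {P : Measure Ω} {T q : ℕ}
    {η : ℤ → Fin T → Ω → ℂ} {g : ℝ → Matrix (Fin T) (Fin T) ℂ}
    {Φ : ℝ → Matrix (Fin T) (Fin q) ℂ} (hη : HasSpectralDensity P η g)
    (hg : IsFactor g (fun _ => 1) Φ) (hΦ : ∀ l j, MemLp (fun w => Φ w l j) 2 circ) :
    ∃ W : VecL2 q →L[ℂ] Lp ℂ 2 P, (∀ m l, W (rowVec hΦ m l) = (hη.memLp (-m) l).toLp) ∧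
      ∀ x ∈ (Submodule.span ℂ
        (Set.range fun i : ℤ × Fin T => rowVec hΦ i.1 i.2)).topologicalClosure,
      ∀ z ∈ (Submodule.span ℂ
        (Set.range fun i : ℤ × Fin T => rowVec hΦ i.1 i.2)).topologicalClosure,
        inner ℂ (W x) (W z) = inner ℂ x z := by
  obtain ⟨W, h1, h2⟩ := exists_clm_of_gram (fun i : ℤ × Fin T => rowVec hΦ i.1 i.2)
    (fun i => (hη.memLp (-i.1) i.2).toLp) (by
      rintro ⟨m, l⟩ ⟨k, p⟩
      rw [hg.inner_eq (isRep_rowVec_specMap hΦ m l) (isRep_rowVec_specMap hΦ k p),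
        inner_eq_integral_of_ae (MemLp.coeFn_toLp _) (MemLp.coeFn_toLp _)]
      have := hη.covariance (-m) (m - k) p l
      rw [show -m + (m - k) = -k by ring] at this
      refine (integral_congr_ae (ae_of_all _ fun w => ?_)).trans
        (this.symm.trans (integral_congr_ae (ae_of_all _ fun ω => mul_comm _ _)))
      rw [cexp_eq_ez, conj_ez, ← ez_add]
      congr 2; ring)
  exact ⟨W, fun m l => h1 (m, l), h2⟩

/-- The row of `Φ` multiplied by `e^{-iwm} χ_ν`. -/
def incrRow {r T q : ℕ} {Φ : ℝ → Matrix (Fin T) (Fin q) ℂ} (ν : Fin r → ℤ) (s d : Fin r → ℕ)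
    (hΦ : ∀ l j, MemLp (fun w => Φ w l j) 2 circ) (m : ℤ) (l : Fin T) : VecL2 q :=
  ∑ t ∈ Fintype.piFinset (fun i => Finset.range (d i + 1)),
    incrCoef d t • rowVec hΦ (m + ∑ i, ν i * (s i : ℤ) * (t i : ℤ)) l

lemma isRep_sum_smul {ι : Type*} {n : ℕ} (t : Finset ι) (c : ι → ℂ) {G : ι → ℝ → Fin n → ℂ}
    {v : ι → VecL2 n} (hv : ∀ i, IsRep (G i) (v i)) :
    IsRep (fun w => ∑ i ∈ t, c i • G i w) (∑ i ∈ t, c i • v i) := by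
  intro j
  have h1 : (∑ i ∈ t, c i • v i) j = ∑ i ∈ t, c i • v i j := by simp
  rw [h1]
  filter_upwards [coeFn_sum_smul t c (fun i => hv i j)] with w h3
  rw [h3]; simp

lemma isRep_incrRow {r T q : ℕ} {Φ : ℝ → Matrix (Fin T) (Fin q) ℂ} (ν : Fin r → ℤ)
    (s d : Fin r → ℕ) (hΦ : ∀ l j, MemLp (fun w => Φ w l j) 2 circ) (m : ℤ) (l : Fin T) :
    IsRep (specMap (fun _ => 1) Φ fun w => Pi.single l (ez m w * chi ν s d w))
      (incrRow ν s d hΦ m l) := fun j => by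
  filter_upwards [isRep_sum_smul (Fintype.piFinset (fun i => Finset.range (d i + 1)))
    (incrCoef d) (fun t => isRep_rowVec hΦ (m + ∑ i, ν i * (s i : ℤ) * (t i : ℤ)) l) j] with w h1
  rw [incrRow, h1, specMap_single, chi_eq_sum, Finset.sum_apply, one_mul, Finset.mul_sum,
    Finset.sum_mul]
  refine Finset.sum_congr rfl fun t _ => ?_
  rw [Pi.smul_apply, ez_add, smul_eq_mul]
  ring

lemma incrRow_eq_sum_eGamma {r T q : ℕ} {Φ : ℝ → Matrix (Fin T) (Fin q) ℂ} (μ s d : Fin r → ℕ)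
    (hΦ : ∀ l j, MemLp (fun w => Φ w l j) 2 circ) (m : ℤ) (l : Fin T) :
    incrRow (fun i => (μ i : ℤ)) s d hΦ m l = ∑ t ∈ Finset.range (nGamma μ s d + 1),
      (eGamma μ s d t : ℂ) • rowVec hΦ (m + t) l := by
  ext j : 1
  apply Lp.ext
  filter_upwards [isRep_incrRow (fun i => (μ i : ℤ)) s d hΦ m l j,
    isRep_sum_smul (Finset.range (nGamma μ s d + 1)) (fun t => (eGamma μ s d t : ℂ))
      (fun t => isRep_rowVec hΦ (m + t) l) j] with w h1 h2
  rw [h1, h2, specMap_single, chi_eq_sum_eGamma, Finset.sum_apply, one_mul, Finset.mul_sum,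
    Finset.sum_mul]
  refine Finset.sum_congr rfl fun t _ => ?_
  rw [Pi.smul_apply, ez_add, smul_eq_mul]
  ring

lemma incrRow_mem_span {r T q : ℕ} {Φ : ℝ → Matrix (Fin T) (Fin q) ℂ} (ν : Fin r → ℤ)
    (s d : Fin r → ℕ) (hΦ : ∀ l j, MemLp (fun w => Φ w l j) 2 circ) (m : ℤ) (l : Fin T) :
    incrRow ν s d hΦ m l ∈ (Submodule.span ℂ
      (Set.range fun i : ℤ × Fin T => rowVec hΦ i.1 i.2)).topologicalClosure :=
  Submodule.sum_mem _ fun _ _ => Submodule.smul_mem _ _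
    (Submodule.le_topologicalClosure _ (Submodule.subset_span ⟨(_, l), rfl⟩))

/-! ### Increments of the observed sequence -/

lemma tendstoInMeasure_add {Ω : Type*} [MeasurableSpace Ω] {P : Measure Ω} {f g : ℕ → Ω → ℂ}
    {F G : Ω → ℂ} (hf : TendstoInMeasure P f atTop F) (hg : TendstoInMeasure P g atTop G) :
    TendstoInMeasure P (fun n ω => f n ω + g n ω) atTop (fun ω => F ω + G ω) := by
  rw [tendstoInMeasure_iff_norm] at *
  intro ε hε
  have h1 := (hf (ε / 2) (by positivity)).add (hg (ε / 2) (by positivity))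
  rw [add_zero] at h1
  refine tendsto_of_tendsto_of_tendsto_of_le_of_le tendsto_const_nhds h1 (fun _ => zero_le)
    fun n => ?_
  refine (measure_mono fun ω hω => ?_).trans (measure_union_le _ _)
  by_contra h
  simp only [Set.mem_union, Set.mem_ofPred_eq, not_or, not_le] at h hω
  have := norm_add_le (f n ω - F ω) (g n ω - G ω)
  rw [show f n ω - F ω + (g n ω - G ω) = f n ω + g n ω - (F ω + G ω) by ring] at this
  linarith [h.1, h.2]

lemma gmIncr_add {r : ℕ} {Ω : Type*} (ν : Fin r → ℤ) (s d : Fin r → ℕ) (x y : ℤ → Ω → ℂ) (m : ℤ)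
    (ω : Ω) : gmIncr ν s d (fun k ω => x k ω + y k ω) m ω =
      gmIncr ν s d x m ω + gmIncr ν s d y m ω := by
  simp only [gmIncr, mul_add, Finset.sum_add_distrib]

/-- The scalar symbol `e^{iwm} χ_ν / β` of an increment. -/
def incrScalar {r : ℕ} (ν : Fin r → ℤ) (s d : Fin r → ℕ) (m : ℤ) (w : ℝ) : ℂ :=
  ez (-m) w * (chi ν s d w / beta s d w)

lemma incrFun_eq {r T : ℕ} (ν : Fin r → ℤ) (s d : Fin r → ℕ) (m : ℤ) (l : Fin T) :
    incrFun ν s d m l = fun w => Pi.single l (incrScalar ν s d m w) := by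
  funext w
  rw [incrFun, incrScalar, cexp_eq_ez]

lemma aestronglyMeasurable_incrScalar {r : ℕ} (ν : Fin r → ℤ) (s d : Fin r → ℕ) (m : ℤ) :
    AEStronglyMeasurable (incrScalar ν s d m) circ :=
  (continuous_ez _).aestronglyMeasurable.mul (aestronglyMeasurable_chi_div_beta ν s d)

lemma exists_norm_incrScalar_le {r : ℕ} (ν : Fin r → ℤ) {s : Fin r → ℕ} (hs : ∀ i, 0 < s i)
    (d : Fin r → ℕ) (m : ℤ) : ∃ C : ℝ, ∀ w, ‖incrScalar ν s d m w‖ ≤ C := by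
  obtain ⟨C, -, h⟩ := exists_norm_chi_div_beta_le ν hs d
  exact ⟨C, fun w => by rw [incrScalar, norm_mul, norm_ez, one_mul]; exact h w⟩

lemma aestronglyMeasurable_single {T : ℕ} {m : ℝ → ℂ} (hm : AEStronglyMeasurable m circ)
    (l : Fin T) : AEStronglyMeasurable (fun w => (Pi.single l (m w) : Fin T → ℂ)) circ :=
  (continuous_single l).comp_aestronglyMeasurable hm

lemma aestronglyMeasurable_incrFun {r T : ℕ} (ν : Fin r → ℤ) (s d : Fin r → ℕ) (m : ℤ)
    (l : Fin T) : AEStronglyMeasurable (incrFun ν s d m l) circ := by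
  rw [incrFun_eq]
  exact aestronglyMeasurable_single (aestronglyMeasurable_incrScalar ν s d m) l

lemma integrable_pDensity {r T : ℕ} (s d : Fin r → ℕ) {f g : ℝ → Matrix (Fin T) (Fin T) ℂ}
    (hf : IsDensity f) (hg : IsDensity g) (i j : Fin T) :
    Integrable (fun w => pDensity s d f g w i j) circ := by
  obtain ⟨C, hC⟩ := isCompact_Icc (a := -π) (b := π) |>.exists_bound_of_continuousOn
    (continuous_beta s d).continuousOn
  refine (hf.integrable i j).add ((hg.integrable i j).bdd_mul (c := C ^ 2) ?_ ?_)
  · exact (Complex.continuous_ofReal.comp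
      ((continuous_beta s d).norm.pow 2)).aestronglyMeasurable
  · filter_upwards [ae_mem_Ico] with w hw
    rw [Complex.norm_real, norm_pow, norm_norm]
    gcongr
    exact hC w (Set.Ico_subset_Icc_self hw)

section Observed

variable {Ω : Type*} [MeasurableSpace Ω] {P : Measure Ω} {r T q : ℕ} {s d : Fin r → ℕ}
  {ξ η : ℤ → Fin T → Ω → ℂ} {f g : ℝ → Matrix (Fin T) (Fin T) ℂ}

lemma memLp_gmIncr_of_memLp {x : ℤ → Ω → ℂ} (hx : ∀ m, MemLp (x m) 2 P) (ν : Fin r → ℤ)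
    (s d : Fin r → ℕ) (m : ℤ) : MemLp (gmIncr ν s d x m) 2 P :=
  memLp_finsetSum _ fun t _ => (hx _).const_mul (incrCoef d t)

lemma toLp_gmIncr_eq {Φ : ℝ → Matrix (Fin T) (Fin q) ℂ} (hη : HasSpectralDensity P η g)
    (hΦ : ∀ l j, MemLp (fun w => Φ w l j) 2 circ) {W : VecL2 q →L[ℂ] Lp ℂ 2 P}
    (hW : ∀ m l, W (rowVec hΦ m l) = (hη.memLp (-m) l).toLp) (ν : Fin r → ℤ) (m : ℤ) (l : Fin T) :
    W (incrRow ν s d hΦ (-m) l) =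
      (memLp_gmIncr_of_memLp (fun k => hη.memLp k l) ν s d m).toLp := by
  apply Lp.ext
  rw [incrRow, map_sum]
  simp only [map_smul, hW]
  refine (coeFn_sum_smul _ _ fun t => MemLp.coeFn_toLp _).trans
    (EventuallyEq.trans ?_ (MemLp.coeFn_toLp _).symm)
  refine ae_of_all _ fun ω => ?_
  simp only [gmIncr_eq]
  refine Finset.sum_congr rfl fun t _ => ?_
  congr 2; ring_nf

lemma memLp_gmIncr_add (hξ : HasGMSpectralDensity P s d ξ f) (hη : HasSpectralDensity P η g)
    {ν : Fin r → ℤ} (hν : IsStep ν) (m : ℤ) (l : Fin T) :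
    MemLp (gmIncr ν s d (fun k ω => ξ k l ω + η k l ω) m) 2 P := by
  have : gmIncr ν s d (fun k ω => ξ k l ω + η k l ω) m =
      fun ω => gmIncr ν s d (fun k => ξ k l) m ω + gmIncr ν s d (fun k => η k l) m ω :=
    funext fun ω => gmIncr_add _ _ _ _ _ _ _
  rw [this]
  exact (hξ.memLp ν hν m l).add (memLp_gmIncr_of_memLp (fun k => hη.memLp k l) ν s d m)

/-- The increments of the observed sequence as elements of `L₂(Ω)`. -/
def obsIncr (hξ : HasGMSpectralDensity P s d ξ f) (hη : HasSpectralDensity P η g)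
    (i : {ν : Fin r → ℤ // IsStep ν} × ℤ × Fin T) : Lp ℂ 2 P :=
  (memLp_gmIncr_add hξ hη i.1.2 i.2.1 i.2.2).toLp

lemma obsIncr_eq_add (hξ : HasGMSpectralDensity P s d ξ f) (hη : HasSpectralDensity P η g)
    (i : {ν : Fin r → ℤ // IsStep ν} × ℤ × Fin T) :
    obsIncr hξ hη i = (hξ.memLp i.1 i.1.2 i.2.1 i.2.2).toLp +
      (memLp_gmIncr_of_memLp (fun k => hη.memLp k i.2.2) i.1 s d i.2.1).toLp := by
  rw [obsIncr, ← MemLp.toLp_add]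
  exact MemLp.toLp_congr _ _ (ae_of_all _ fun ω => gmIncr_add _ _ _ _ _ _ _)

lemma inner_gmIncr_eq_zero (hξ : HasGMSpectralDensity P s d ξ f) (hη : HasSpectralDensity P η g)
    (huncorr : ∀ ν : Fin r → ℤ, IsStep ν → ∀ (m k : ℤ) (i j : Fin T),
      ∫ ω, gmIncr ν s d (fun n => ξ n i) m ω * conj (η k j ω) ∂P = 0)
    {Φ : ℝ → Matrix (Fin T) (Fin q) ℂ} (hΦ : ∀ l j, MemLp (fun w => Φ w l j) 2 circ)
    {W : VecL2 q →L[ℂ] Lp ℂ 2 P} (hW : ∀ m l, W (rowVec hΦ m l) = (hη.memLp (-m) l).toLp)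
    {ν : Fin r → ℤ} (hν : IsStep ν) (m : ℤ) (l : Fin T) {x : VecL2 q}
    (hx : x ∈ (Submodule.span ℂ
        (Set.range fun i : ℤ × Fin T => rowVec hΦ i.1 i.2)).topologicalClosure) :
    inner ℂ (hξ.memLp ν hν m l).toLp (W x) = 0 := by
  have hle : (Submodule.span ℂ
        (Set.range fun i : ℤ × Fin T => rowVec hΦ i.1 i.2)).topologicalClosure ≤
      LinearMap.ker ((innerSL ℂ (hξ.memLp ν hν m l).toLp).comp W).toLinearMap := by
    refine Submodule.topologicalClosure_minimal _ ?_
      ((innerSL ℂ (hξ.memLp ν hν m l).toLp).comp W).isClosed_ker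
    rw [Submodule.span_le]
    rintro _ ⟨⟨k, j⟩, rfl⟩
    change inner ℂ (hξ.memLp ν hν m l).toLp (W (rowVec hΦ k j)) = 0
    rw [hW, inner_eq_integral_of_ae (MemLp.coeFn_toLp _) (MemLp.coeFn_toLp _)]
    have := congrArg conj (huncorr ν hν m (-k) l j)
    rw [← integral_conj] at this
    simpa using this
  exact hle hx

/-- The Gram matrix of the increments of the observed sequence. -/
lemma inner_obsIncr (hs : ∀ i, 0 < s i) (hξ : HasGMSpectralDensity P s d ξ f)
    (hη : HasSpectralDensity P η g)
    (huncorr : ∀ ν : Fin r → ℤ, IsStep ν → ∀ (m k : ℤ) (i j : Fin T),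
      ∫ ω, gmIncr ν s d (fun n => ξ n i) m ω * conj (η k j ω) ∂P = 0)
    {Φ : ℝ → Matrix (Fin T) (Fin q) ℂ} (hΦ : ∀ l j, MemLp (fun w => Φ w l j) 2 circ)
    (hg : IsFactor g (fun _ => 1) Φ)
    (i j : {ν : Fin r → ℤ // IsStep ν} × ℤ × Fin T) :
    inner ℂ (obsIncr hξ hη i) (obsIncr hξ hη j) =
      ∫ w, conj (incrScalar i.1 s d i.2.1 w) * incrScalar j.1 s d j.2.1 w *
        pDensity s d f g w j.2.2 i.2.2 ∂circ := by
  obtain ⟨⟨ν₁, hν₁⟩, m₁, l₁⟩ := i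
  obtain ⟨⟨ν₂, hν₂⟩, m₂, l₂⟩ := j
  -- Increments of η are images of rows of Φ multiplied by χ_ν, so their covariances are integrals
  -- against g; the cross terms with ξ vanish.
  obtain ⟨W, hW, hWi⟩ := exists_spectral_map hη hg hΦ
  simp only [obsIncr_eq_add, inner_add_left, inner_add_right]
  rw [← toLp_gmIncr_eq hη hΦ hW, ← toLp_gmIncr_eq hη hΦ hW,
    inner_gmIncr_eq_zero hξ hη huncorr hΦ hW hν₁ m₁ l₁ (incrRow_mem_span _ _ _ _ _ _),
    ← inner_conj_symm (W _) ((hξ.memLp ν₂ hν₂ m₂ l₂).toLp),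
    inner_gmIncr_eq_zero hξ hη huncorr hΦ hW hν₂ m₂ l₂ (incrRow_mem_span _ _ _ _ _ _),
    map_zero, add_zero, zero_add,
    hWi _ (incrRow_mem_span _ _ _ _ _ _) _ (incrRow_mem_span _ _ _ _ _ _),
    hg.inner_eq (isRep_incrRow ν₁ s d hΦ (-m₁) l₁) (isRep_incrRow ν₂ s d hΦ (-m₂) l₂),
    inner_eq_integral_of_ae (MemLp.coeFn_toLp _) (MemLp.coeFn_toLp _)]
  have hstr := hξ.structural ν₂ ν₁ hν₂ hν₁ m₁ (m₂ - m₁) l₂ l₁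
  rw [show m₁ + (m₂ - m₁) = m₂ by ring] at hstr
  have h1 : ∫ ω, conj (gmIncr ν₁ s d (fun k => ξ k l₁) m₁ ω) *
      gmIncr ν₂ s d (fun k => ξ k l₂) m₂ ω ∂P =
      ∫ w, conj (incrScalar ν₁ s d m₁ w) * incrScalar ν₂ s d m₂ w * f w l₂ l₁ ∂circ := by
    simp only [mul_comm (conj _)]
    rw [hstr]
    congr 1; ext w
    rw [cexp_eq_ez, incrScalar, incrScalar, map_mul, conj_ez,
      show -(m₂ - m₁) = - -m₁ + -m₂ by ring, ez_add, map_div₀, Complex.ofReal_pow,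
      ← Complex.mul_conj']
    rw [div_eq_mul_inv, div_eq_mul_inv, div_eq_mul_inv, mul_inv]
    ring
  rw [h1, ← integral_add]
  -- Off the zeros of β, conj χ₁ χ₂ g equals conj(χ₁/β)(χ₂/β)|β|²g. This is the origin of the
  -- summand |β|²g in p.
  · refine integral_congr_ae ?_
    filter_upwards [ae_beta_ne_zero hs d] with w hw
    have hw' : conj (beta s d w) ≠ 0 := (map_ne_zero _).2 hw
    rw [pDensity, Matrix.add_apply, Matrix.smul_apply, mul_add, smul_eq_mul, Complex.ofReal_pow,
      ← Complex.mul_conj']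
    congr 1
    simp only [incrScalar, map_mul, map_div₀]
    field_simp
  · obtain ⟨C₁, hC₁⟩ := exists_norm_incrScalar_le ν₁ hs d m₁
    obtain ⟨C₂, hC₂⟩ := exists_norm_incrScalar_le ν₂ hs d m₂
    refine (hξ.isDensity.integrable l₂ l₁).bdd_mul (c := C₁ * C₂)
      ((aestronglyMeasurable_incrScalar ν₁ s d m₁).star.mul
        (aestronglyMeasurable_incrScalar ν₂ s d m₂)) (ae_of_all _ fun w => ?_)
    rw [norm_mul, RCLike.norm_conj]
    exact mul_le_mul (hC₁ w) (hC₂ w) (norm_nonneg _) ((norm_nonneg _).trans (hC₁ w))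
  · have hc : Continuous fun w => conj (ez (-m₁) w * chi ν₁ s d w) * (ez (-m₂) w * chi ν₂ s d w) :=
      (Complex.continuous_conj.comp ((continuous_ez _).mul (continuous_chi _ _ _))).mul
        ((continuous_ez _).mul (continuous_chi _ _ _))
    obtain ⟨C, hC⟩ := isCompact_Icc (a := -π) (b := π) |>.exists_bound_of_continuousOn
      hc.continuousOn
    refine (hη.isDensity.integrable l₂ l₁).bdd_mul (c := C) hc.aestronglyMeasurable ?_
    filter_upwards [ae_mem_Ico] with w hw
    exact hC w (Set.Ico_subset_Icc_self hw)

end Observed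

/-! ### The spectral process -/

/-- The points x with (x, U x) in `K` form a closed subspace. This is used in both directions: from
step functions to increments when Z is constructed, and from increments to general integrals when Z
is arbitrary. -/
lemma mem_of_graph {ι E F : Type*} [NormedAddCommGroup E] [NormedSpace ℂ E]
    [NormedAddCommGroup F] [NormedSpace ℂ F] (U : E →L[ℂ] F) {K : Submodule ℂ (E × F)}
    (hK : IsClosed (K : Set (E × F))) {v : ι → E} (h : ∀ i, (v i, U (v i)) ∈ K) {x : E}
    (hx : x ∈ (Submodule.span ℂ (Set.range v)).topologicalClosure) : (x, U x) ∈ K := by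
  have hle : (Submodule.span ℂ (Set.range v)).topologicalClosure ≤
      K.comap ((ContinuousLinearMap.id ℂ E).prod U).toLinearMap := by
    refine Submodule.topologicalClosure_minimal _ ?_
      (hK.preimage ((ContinuousLinearMap.id ℂ E).prod U).continuous)
    rw [Submodule.span_le]
    rintro _ ⟨i, rfl⟩
    exact h i
  exact hle hx

/-- The function `1_{[-π, t)}`. -/
def stepScalar (t : ℝ) (w : ℝ) : ℂ := (Set.Ico (-π) t).indicator (fun _ => (1 : ℂ)) w

lemma aestronglyMeasurable_stepScalar (t : ℝ) : AEStronglyMeasurable (stepScalar t) circ :=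
  (aestronglyMeasurable_const).indicator measurableSet_Ico

lemma norm_stepScalar_le (t w : ℝ) : ‖stepScalar t w‖ ≤ 1 := by
  unfold stepScalar
  by_cases h : w ∈ Set.Ico (-π) t <;> simp [h]

lemma stepScalar_sub {t₁ t₂ : ℝ} (h1 : -π ≤ t₁) (h : t₁ ≤ t₂) (w : ℝ) :
    stepScalar t₂ w - stepScalar t₁ w = (Set.Ico t₁ t₂).indicator (fun _ => (1 : ℂ)) w := by
  unfold stepScalar
  simp only [Set.indicator, Set.mem_Ico]
  split_ifs <;> first | simp; done | (exfalso; grind)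

lemma IsRep.sub_single {T q : ℕ} {b : ℝ → ℂ} {Θ : ℝ → Matrix (Fin T) (Fin q) ℂ} {l : Fin T}
    {m n : ℝ → ℂ} {x y : VecL2 q} (hx : IsRep (specMap b Θ fun w => Pi.single l (m w)) x)
    (hy : IsRep (specMap b Θ fun w => Pi.single l (n w)) y) :
    IsRep (specMap b Θ fun w => Pi.single l (m w - n w)) (x - y) := by
  intro j
  filter_upwards [hx j, hy j, Lp.coeFn_sub (x j) (y j)] with w h1 h2 h3
  rw [PiLp.sub_apply, h3, Pi.sub_apply, h1, h2]
  simp only [specMap_single]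
  ring

/-- An isometric copy of `L₂(p)` in `L₂(Ω)` containing the increments defines a spectral
process. -/
lemma exists_isSpectralProcess {Ω : Type*} [MeasurableSpace Ω] {P : Measure Ω} {r T q : ℕ}
    {s d : Fin r → ℕ} {ζ : ℤ → Fin T → Ω → ℂ} {p : ℝ → Matrix (Fin T) (Fin T) ℂ} {b : ℝ → ℂ}
    {Θ : ℝ → Matrix (Fin T) (Fin q) ℂ} {Ψ : ℝ → Matrix (Fin q) (Fin T) ℂ} (hp : IsFactor p b Θ)
    (hinv : ∀ᵐ w ∂circ, Ψ w * Θ w = 1) (hb : ∀ᵐ w ∂circ, b w ≠ 0)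
    (U : VecL2 q →ₗᵢ[ℂ] Lp ℂ 2 P)
    {v : {ν : Fin r → ℤ // IsStep ν} × ℤ × Fin T → VecL2 q}
    (hv : ∀ i, IsRep (specMap b Θ (incrFun i.1 s d i.2.1 i.2.2)) (v i))
    (hU : ∀ i, U (v i) =ᵐ[P] gmIncr i.1 s d (fun k => ζ k i.2.2) i.2.1) :
    ∃ Z, IsSpectralProcess P s d ζ p Z := by
  have hmem : ∀ (t : ℝ) (l : Fin T) (j : Fin q),
      MemLp (fun w => specMap b Θ (fun w => Pi.single l (stepScalar t w)) w j) 2 circ := fun t l =>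
    hp.memLp_specMap_single l (aestronglyMeasurable_stepScalar t) (norm_stepScalar_le t)
  obtain ⟨S, hS⟩ : ∃ S : ℝ → Fin T → VecL2 q,
      ∀ t l, IsRep (specMap b Θ fun w => Pi.single l (stepScalar t w)) (S t l) :=
    ⟨fun t l => toVecL2 _ (hmem t l), fun t l => isRep_toVecL2 _ _⟩
  have hS0 : ∀ l, S (-π) l = 0 := fun l => by
    ext j : 1
    apply Lp.ext
    filter_upwards [hS (-π) l j, Lp.coeFn_zero ℂ 2 circ] with w h1 h2
    rw [PiLp.zero_apply, h1, h2, specMap_single]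
    simp [stepScalar]
  -- Z(t) is the image of the indicator of [-π, t); the isometry turns disjointness of intervals
  -- into uncorrelated increments.
  let Z : ℝ → Fin T → Ω → ℂ := fun t l => U (S t l)
  have hZ : ∀ t₁ t₂ l, U (S t₂ l - S t₁ l) =ᵐ[P] fun ω => Z t₂ l ω - Z t₁ l ω := fun t₁ t₂ l => by
    rw [map_sub]; exact Lp.coeFn_sub _ _
  have hcov : ∀ t₁ t₂ t₃ t₄, -π ≤ t₁ → t₁ ≤ t₂ → -π ≤ t₃ → t₃ ≤ t₄ → ∀ i j,
      ∫ ω, (Z t₂ i ω - Z t₁ i ω) * conj (Z t₄ j ω - Z t₃ j ω) ∂P =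
        ∫ w in Set.Ico t₃ t₄ ∩ Set.Ico t₁ t₂, p w i j ∂circ := by
    intro t₁ t₂ t₃ t₄ h1 h2 h3 h4 i j
    simp only [mul_comm _ (conj _)]
    rw [← inner_eq_integral_of_ae (hZ t₃ t₄ j) (hZ t₁ t₂ i), U.inner_map_map,
      hp.inner_eq ((hS t₄ j).sub_single (hS t₃ j)) ((hS t₂ i).sub_single (hS t₁ i)),
      ← integral_indicator (measurableSet_Ico.inter measurableSet_Ico)]
    congr 1; ext w
    rw [stepScalar_sub h1 h2, stepScalar_sub h3 h4]
    by_cases ha : w ∈ Set.Ico t₃ t₄ <;> by_cases hb : w ∈ Set.Ico t₁ t₂ <;> simp [ha, hb]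
  refine ⟨Z, ⟨fun t₁ _ t₂ _ i => (memLp_congr_ae (hZ t₁ t₂ i)).1 (Lp.memLp _), ?_, ?_, ?_⟩⟩
  · intro t₁ t₂ h1 h2 _ i j
    rw [hcov t₁ t₂ t₁ t₂ h1 h2.le h1 h2.le, Set.inter_self]
  · intro t₁ t₂ t₃ t₄ h1 h2 h3 h4 _ i j
    rw [hcov t₁ t₂ t₃ t₄ h1 h2.le ((h1.trans h2.le).trans h3) h4.le]
    have : Set.Ico t₃ t₄ ∩ Set.Ico t₁ t₂ = ∅ := by
      ext w; simp only [Set.mem_inter_iff, Set.mem_Ico, Set.mem_empty_iff_false]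
      constructor
      · rintro ⟨⟨h5, -⟩, ⟨-, h6⟩⟩; linarith
      · simp
    rw [this]; simp
  · intro ν hν m l
    have hstep : ∀ i : Set.Ico (-π) π × Fin T, IsRep (specMap b Θ (stepFun i)) (S i.1 i.2) :=
      fun i => hS i.1 i.2
    rw [hp.isStochInt_iff (aestronglyMeasurable_incrFun ν s d m l) (hx := hv (⟨ν, hν⟩, m, l))
      (hy := hU (⟨ν, hν⟩, m, l)) hstep (z := fun i => U (S i.1 i.2)) (fun i => by
        have := hZ (-π) i.1 i.2
        rwa [hS0, sub_zero] at this)]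
    refine mem_of_graph U.toContinuousLinearMap (Submodule.isClosed_topologicalClosure _)
      (v := fun i : Set.Ico (-π) π × Fin T => S i.1 i.2) (fun i : Set.Ico (-π) π × Fin T =>
        Submodule.le_topologicalClosure _ (Submodule.subset_span (Set.mem_range_self i))) ?_
    -- Density of step functions puts the whole graph of `U` inside the closed integration relation.
    rw [closure_span_stepFun_eq_top hinv hb ?_ hstep]
    · trivial
    · intro l j
      have := hp.memLp_specMap_single l (m := fun _ => 1) aestronglyMeasurable_const (C := 1)
        (fun _ => by simp) j
      simpa only [specMap_single, one_mul] using this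

/-! ### Optimal estimates -/

lemma norm_sub_sq_of_mem {E : Type*} [NormedAddCommGroup E] [InnerProductSpace ℂ E]
    {K : Submodule ℂ E} {A Y Y' : E} (hY : Y ∈ K) (hY' : Y' ∈ K)
    (horth : ∀ x ∈ K, inner ℂ x (Y - A) = 0) :
    ‖Y' - A‖ ^ 2 = ‖Y - A‖ ^ 2 + ‖Y' - Y‖ ^ 2 := by
  have h := horth _ (K.sub_mem hY' hY)
  have := norm_add_sq_eq_norm_sq_add_norm_sq_of_inner_eq_zero (Y' - Y) (Y - A) h
  rw [sub_add_sub_cancel] at this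
  rw [sq, sq, sq, this, add_comm]

lemma exists_linearEstimate_iff {Ω : Type*} [MeasurableSpace Ω] {P : Measure Ω} {r T : ℕ}
    {μ : Fin r → ℤ} {s d : Fin r → ℕ} {ζ : ℤ → Fin T → Ω → ℂ} {v : ℕ × Fin T → Lp ℂ 2 P}
    (hv : ∀ i, v i =ᵐ[P] gmIncr μ s d (fun k => ζ k i.2) (-(i.1 : ℤ))) {Y : Ω → ℂ} {y : Lp ℂ 2 P}
    (hy : y =ᵐ[P] Y) :
    (∀ ε : ℝ≥0∞, 0 < ε → ∃ c : (ℕ × Fin T) →₀ ℂ, eLpNorm (fun ω => Y ω - c.sum fun kl z =>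
        z * gmIncr μ s d (fun k => ζ k kl.2) (-(kl.1 : ℤ)) ω) 2 P < ε) ↔
      y ∈ (Submodule.span ℂ (Set.range v)).topologicalClosure := by
  rw [mem_topologicalClosure_span_iff]
  have := forall_ofReal_lt_iff (fun _ => 0)
    (fun c : ℕ × Fin T →₀ ℂ => ‖y - c.sum fun i z => z • v i‖) (fun _ => le_rfl)
  simp only [ne_eq, OfNat.ofNat_ne_zero, not_false_eq_true, zero_pow, ENNReal.ofReal_zero] at this
  have h2 : ∀ c : ℕ × Fin T →₀ ℂ, eLpNorm (fun ω => Y ω - c.sum fun kl z =>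
      z * gmIncr μ s d (fun k => ζ k kl.2) (-(kl.1 : ℤ)) ω) 2 P =
        ENNReal.ofReal ‖y - c.sum fun i z => z • v i‖ := fun c => eLpNorm_sub_sum hy hv c
  simp only [h2]
  constructor
  · intro h ε hε
    obtain ⟨c, -, hc⟩ := this.2 (fun ε hε => by
      obtain ⟨c, hc⟩ := h ε hε
      exact ⟨c, hε, hc⟩) ε hε
    exact ⟨c, hc⟩
  · intro h ε hε
    obtain ⟨c, -, hc⟩ := this.1 (fun ε hε => by
      obtain ⟨c, hc⟩ := h ε hε
      exact ⟨c, hε, hc⟩) ε hε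
    exact ⟨c, hc⟩

lemma eLpNorm_eq_ofReal_norm {Ω : Type*} [MeasurableSpace Ω] {P : Measure Ω} {Y : Ω → ℂ}
    {y : Lp ℂ 2 P} (hy : y =ᵐ[P] Y) : eLpNorm Y 2 P = ENNReal.ofReal ‖y‖ := by
  rw [Lp.norm_def, ENNReal.ofReal_toReal (Lp.eLpNorm_ne_top _)]
  exact (eLpNorm_congr_ae hy).symm

/-- The projection of `Aη` on the observed increments gives the optimal estimate. -/
lemma isOptimalEstimate_of_orthogonal {Ω : Type*} [MeasurableSpace Ω] {P : Measure Ω} {r T : ℕ}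
    {μ : Fin r → ℤ} {s d : Fin r → ℕ} {ζ : ℤ → Fin T → Ω → ℂ} {v : ℕ × Fin T → Lp ℂ 2 P}
    (hv : ∀ i, v i =ᵐ[P] gmIncr μ s d (fun k => ζ k i.2) (-(i.1 : ℤ))) (Aξ : Ω → ℂ)
    {A Y : Lp ℂ 2 P} (hY : Y ∈ (Submodule.span ℂ (Set.range v)).topologicalClosure)
    (horth : ∀ x ∈ (Submodule.span ℂ (Set.range v)).topologicalClosure, inner ℂ x (Y - A) = 0) :
    IsOptimalEstimate P μ s d ζ Aξ (fun ω => Aξ ω + A ω) (fun ω => Aξ ω + A ω - Y ω) := by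
  -- Aξ itself need not be square integrable: it cancels in the error, which is Y' − A with A in the
  -- role of Aη.
  have herr : ∀ (Y' : Lp ℂ 2 P) (B : Ω → ℂ), (B =ᵐ[P] fun ω => Aξ ω + A ω - Y' ω) →
      ⇑(Y' - A) =ᵐ[P] fun ω => Aξ ω - B ω := by
    intro Y' B hB
    filter_upwards [hB, Lp.coeFn_sub Y' A] with ω h1 h2
    rw [h1, h2, Pi.sub_apply]; ring
  refine ⟨⟨Y, Lp.memLp Y, (exists_linearEstimate_iff hv (ae_eq_refl _)).2 hY, ae_eq_refl _⟩,
    (memLp_congr_ae (herr Y _ (ae_eq_refl _))).1 (Lp.memLp _), ?_⟩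
  rintro B ⟨Y', hY'm, hY', hB⟩
  have hy' : hY'm.toLp ∈ (Submodule.span ℂ (Set.range v)).topologicalClosure :=
    (exists_linearEstimate_iff hv hY'm.coeFn_toLp).1 hY'
  have hB' : B =ᵐ[P] fun ω => Aξ ω + A ω - (hY'm.toLp : Lp ℂ 2 P) ω := by
    filter_upwards [hB, hY'm.coeFn_toLp] with ω h1 h2
    rw [h1, h2]
  rw [eLpNorm_eq_ofReal_norm (herr Y _ (ae_eq_refl _)), eLpNorm_eq_ofReal_norm (herr _ B hB')]
  have key := norm_sub_sq_of_mem hY hy' horth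
  constructor
  · refine ENNReal.ofReal_le_ofReal (le_of_sq_le_sq ?_ (norm_nonneg _))
    rw [key]; nlinarith [sq_nonneg ‖hY'm.toLp - Y‖]
  · intro h
    rw [ENNReal.ofReal_eq_ofReal_iff (norm_nonneg _) (norm_nonneg _)] at h
    rw [h] at key
    have h0 : hY'm.toLp = Y := by
      rw [← sub_eq_zero, ← norm_eq_zero]
      exact pow_eq_zero_iff two_ne_zero |>.1 (by linarith)
    rw [h0] at hB'
    exact hB'

/-! ### The optimal estimate -/

lemma hasSum_vnorm_sq_coef {n : ℕ} {x : VecL2 n} (hx : ∀ j, x j ∈ hardy) :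
    HasSum (fun k : ℕ => vnorm (fun j => coef k (x j)) ^ 2) (‖x‖ ^ 2) := by
  simp only [vnorm_sq, PiLp.norm_sq_eq_of_L2]
  exact hasSum_sum fun j _ => hasSum_norm_sq_of_mem_hardy (hx j)

lemma hasSum_psiBarC {T q : ℕ} {ψ : ℕ → Matrix (Fin q) (Fin T) ℂ}
    {Ψ : ℝ → Matrix (Fin q) (Fin T) ℂ}
    (hψ : ∀ j l, IsL2Series (fun k => ψ k j l) (fun w => Ψ w j l)) {c : ℕ → Fin T → ℂ}
    {C : Fin T → Lp ℂ 2 circ} (hC : ∀ l (k : ℕ), coef k (C l) = c k l) (m : ℕ) :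
    HasSum (fun k => mconj (ψ k) *ᵥ c (k + m))
      (fun j => ∑ l, inner ℂ (mulEz m (hψ j l).1.toLp) (C l)) := by
  rw [Pi.hasSum]
  intro j
  simp only [Matrix.mulVec, dotProduct]
  refine hasSum_sum fun l _ => ?_
  have := hasSum_inner_mulEz (hψ j l).mem_hardy (C l) m
  simp only [(hψ j l).coef, hC] at this
  exact this

lemma blockApply_opTilde {T q : ℕ} (φ : ℕ → Matrix (Fin T) (Fin q) ℂ) (α : ℕ → Fin T → ℂ) (n : ℕ) :
    blockApply (opTilde φ) α n = ∑ k ∈ Finset.range (n + 1), (φ (n - k))ᵀ *ᵥ α k := by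
  rw [blockApply, tsum_eq_sum (s := Finset.range (n + 1))]
  · refine Finset.sum_congr rfl fun k hk => ?_
    rw [opTilde, if_pos (by have := Finset.mem_range.1 hk; omega)]
  · intro k hk
    rw [Finset.mem_range] at hk
    rw [opTilde, if_neg (by omega), Matrix.zero_mulVec]

lemma inner_rowVec_synth_shift {T q : ℕ} {Φ : ℝ → Matrix (Fin T) (Fin q) ℂ}
    (hΦ : ∀ l j, MemLp (fun w => Φ w l j) 2 circ) {α : ℕ → Fin T → ℂ}
    (hα : ∀ p, Summable fun k => ‖α k p‖) (m t : ℤ) (l : Fin T) :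
    inner ℂ (rowVec hΦ (m + t) l) (synth hΦ (fun k => k) α) =
      inner ℂ (rowVec hΦ m l) (synth hΦ (fun k => k - t) α) := by
  have h1 := (innerSL ℂ (rowVec hΦ (m + t) l)).hasSum (hasSum_synth hΦ (fun k => k) hα)
  have h2 := (innerSL ℂ (rowVec hΦ m l)).hasSum (hasSum_synth hΦ (fun k => k - t) hα)
  have h3 : (fun k : ℕ => innerSL ℂ (rowVec hΦ (m + t) l) (∑ p, α k p • rowVec hΦ k p)) =
      fun k : ℕ => innerSL ℂ (rowVec hΦ m l) (∑ p, α k p • rowVec hΦ ((k : ℤ) - t) p) := by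
    funext k
    simp [inner_rowVec_shift]
  rw [h3] at h1
  exact h1.unique h2

/-- χ_μ is moved from the row to the series of a as its conjugate; e_γ is real, so no conjugate
remains on it. -/
lemma inner_incrRow_synth {r T q : ℕ} {Φ : ℝ → Matrix (Fin T) (Fin q) ℂ} (μ s d : Fin r → ℕ)
    {a : ℕ → Fin T → ℂ} (ha : ∀ p, Summable fun k => ‖a k p‖)
    (hΦ : ∀ l j, MemLp (fun w => Φ w l j) 2 circ) (m : ℤ) (l : Fin T) :
    inner ℂ (incrRow (fun i => (μ i : ℤ)) s d hΦ m l) (synth hΦ (fun k => k) a) =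
      inner ℂ (rowVec hΦ m l) (synth hΦ (fun k => k) (aMinus μ s d a)) +
      inner ℂ (rowVec hΦ m l) (synth hΦ (fun k => -k) (bMinus μ s d a)) := by
  rw [← inner_add_right, ← sum_smul_synth μ s d ha hΦ, incrRow_eq_sum_eGamma, sum_inner, inner_sum]
  refine Finset.sum_congr rfl fun t _ => ?_
  rw [inner_smul_left, inner_smul_right, inner_rowVec_synth_shift hΦ ha]
  simp

/-- All shifts of a row have the same norm, so Σ‖a(k)‖ < ∞ gives absolute convergence of the series
in L₂(Ω), hence convergence in probability. -/
lemma isFunctional_spectral {Ω : Type*} [MeasurableSpace Ω] {P : Measure Ω}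
    {T q : ℕ} {η : ℤ → Fin T → Ω → ℂ} {g : ℝ → Matrix (Fin T) (Fin T) ℂ}
    {Φ : ℝ → Matrix (Fin T) (Fin q) ℂ} (hη : HasSpectralDensity P η g)
    (hΦ : ∀ l j, MemLp (fun w => Φ w l j) 2 circ) {W : VecL2 q →L[ℂ] Lp ℂ 2 P}
    (hW : ∀ m l, W (rowVec hΦ m l) = (hη.memLp (-m) l).toLp) {a : ℕ → Fin T → ℂ}
    (ha : ∀ p, Summable fun k => ‖a k p‖) :
    IsFunctional P a η (W (synth hΦ (fun k => k) a)) := by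
  have h := (W.hasSum (hasSum_synth hΦ (fun k => k) ha)).tendsto_sum_nat
  refine (tendstoInMeasure_of_tendsto_Lp h).congr_left fun N => ?_
  simp only [map_sum, map_smul, hW]
  rw [← Finset.sum_product' (Finset.range N) Finset.univ
    fun k p => a k p • (hη.memLp (-(k : ℤ)) p).toLp]
  refine (coeFn_sum_smul _ (fun i : ℕ × Fin T => a i.1 i.2)
    fun i : ℕ × Fin T => (hη.memLp (-(i.1 : ℤ)) i.2).coeFn_toLp).trans (ae_of_all _ fun ω => ?_)
  exact Finset.sum_product' (Finset.range N) Finset.univ fun k p => a k p * η (-(k : ℤ)) p ω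

lemma inner_eq_zero_of_mem_closure_span {ι E : Type*} [NormedAddCommGroup E]
    [InnerProductSpace ℂ E] {v : ι → E} {x y : E}
    (hx : x ∈ (Submodule.span ℂ (Set.range v)).topologicalClosure)
    (h : ∀ i, inner ℂ (v i) y = 0) : inner ℂ x y = 0 := by
  have hle : (Submodule.span ℂ (Set.range v)).topologicalClosure ≤
      LinearMap.ker (innerSL ℂ y).toLinearMap := by
    refine Submodule.topologicalClosure_minimal _ ?_ (innerSL ℂ y).isClosed_ker
    rw [Submodule.span_le]
    rintro _ ⟨i, rfl⟩
    have := h i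
    rw [← inner_conj_symm, map_eq_zero] at this
    simpa using this
  have := hle hx
  rw [← inner_conj_symm, map_eq_zero]
  simpa using this

lemma map_mem_closure_span {ι E F : Type*} [NormedAddCommGroup E] [NormedSpace ℂ E]
    [NormedAddCommGroup F] [NormedSpace ℂ F] (U : E →L[ℂ] F) {v : ι → E} {x : E}
    (hx : x ∈ (Submodule.span ℂ (Set.range v)).topologicalClosure) :
    U x ∈ (Submodule.span ℂ (Set.range fun i => U (v i))).topologicalClosure := by
  have hle : (Submodule.span ℂ (Set.range v)).topologicalClosure ≤
      (Submodule.span ℂ (Set.range fun i => U (v i))).topologicalClosure.comap U.toLinearMap := by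
    refine Submodule.topologicalClosure_minimal _ ?_
      ((Submodule.isClosed_topologicalClosure _).preimage U.continuous)
    rw [Submodule.span_le]
    rintro _ ⟨i, rfl⟩
    exact Submodule.le_topologicalClosure _ (Submodule.subset_span ⟨i, rfl⟩)
  exact hle hx

/-- The projection of `A` on the closed span of `U (v i)`, pulled back by the isometry `U`. -/
lemma exists_projection {ι E F : Type*} [NormedAddCommGroup E] [InnerProductSpace ℂ E]
    [CompleteSpace E] [NormedAddCommGroup F] [InnerProductSpace ℂ F] [CompleteSpace F]
    (U : E →ₗᵢ[ℂ] F) (v : ι → E) (A : F) :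
    ∃ X ∈ (Submodule.span ℂ (Set.range v)).topologicalClosure,
      ∀ i, inner ℂ (v i) X = inner ℂ (U (v i)) A := by
  obtain ⟨K, hK⟩ : ∃ K, K = (Submodule.span ℂ (Set.range v)).topologicalClosure := ⟨_, rfl⟩
  have hKc : IsClosed (K : Set E) := hK ▸ Submodule.isClosed_topologicalClosure _
  have : CompleteSpace K := hKc.completeSpace_coe
  rw [← hK]
  let B := ContinuousLinearMap.adjoint U.toContinuousLinearMap A
  refine ⟨K.starProjection B, K.starProjection_apply_mem _, fun i => ?_⟩
  have hv : v i ∈ K := hK ▸ Submodule.le_topologicalClosure _ (Submodule.subset_span ⟨i, rfl⟩)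
  have h1 := Submodule.inner_right_of_mem_orthogonal hv (K.sub_starProjection_mem_orthogonal B)
  rw [inner_sub_right, sub_eq_zero] at h1
  rw [← h1]
  exact ContinuousLinearMap.adjoint_inner_right _ _ _

/-! ### The isometry of the observed model and the normal equations. -/

section Main

variable {Ω : Type*} [MeasurableSpace Ω] {P : Measure Ω} {r T q q' : ℕ} {μ s d : Fin r → ℕ}
  {ξ η : ℤ → Fin T → Ω → ℂ} {f g : ℝ → Matrix (Fin T) (Fin T) ℂ}
  {θ : ℕ → Matrix (Fin T) (Fin q) ℂ} {Θ : ℝ → Matrix (Fin T) (Fin q) ℂ}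
  {φ : ℕ → Matrix (Fin T) (Fin q') ℂ} {Φ : ℝ → Matrix (Fin T) (Fin q') ℂ}
  {ψ : ℕ → Matrix (Fin q) (Fin T) ℂ} {Ψ : ℝ → Matrix (Fin q) (Fin T) ℂ}

lemma isStep_natCast (hμ : ∀ i, 0 < μ i) : IsStep fun i => (μ i : ℤ) :=
  Or.inl fun i => Nat.cast_pos.2 (hμ i)

lemma CanonicalFactorizations.isFactor_g
    (hfact : CanonicalFactorizations (fun i => (μ i : ℤ)) s d f g θ Θ φ Φ ψ Ψ)
    (hg : IsDensity g) : IsFactor g (fun _ => 1) Φ where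
  integrable := hg.integrable
  measurable_scalar := aestronglyMeasurable_const
  measurable i j := (hfact.series_phi i j).1.1
  fact := by filter_upwards [hfact.fact_g] with w hw; simp [hw]

lemma CanonicalFactorizations.isFactor_p
    (hfact : CanonicalFactorizations (fun i => (μ i : ℤ)) s d f g θ Θ φ Φ ψ Ψ)
    (hμ : ∀ i, 0 < μ i) (hs : ∀ i, 0 < s i) (hf : IsDensity f) (hg : IsDensity g) :
    IsFactor (pDensity s d f g) (fun w => beta s d w / chi (fun i => (μ i : ℤ)) s d w) Θ where
  integrable := integrable_pDensity s d hf hg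
  measurable_scalar := ((continuous_beta s d).measurable.div
    (continuous_chi _ s d).measurable).aestronglyMeasurable
  measurable i j := (hfact.series_theta i j).1.1
  fact := by
    filter_upwards [hfact.fact_p, ae_beta_ne_zero hs d,
      ae_chi_ne_zero (isStep_natCast hμ).ne_zero hs d] with w h1 h2 h3
    rw [← h1, smul_smul, ← Complex.ofReal_mul, norm_div, div_pow]
    have h2' : ‖beta s d w‖ ≠ 0 := norm_ne_zero_iff.2 h2
    have h3' : ‖chi (fun i => (μ i : ℤ)) s d w‖ ≠ 0 := norm_ne_zero_iff.2 h3
    rw [div_mul_div_comm, mul_comm, div_self (by positivity), Complex.ofReal_one, one_smul]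

/-- The image of `e^{iwm} χ_ν β⁻¹ δ_l` under the isometry `h ↦ Θᵀ (β / χ_μ) h`. -/
lemma exists_incrVec
    (hfact : CanonicalFactorizations (fun i => (μ i : ℤ)) s d f g θ Θ φ Φ ψ Ψ)
    (hμ : ∀ i, 0 < μ i) (hs : ∀ i, 0 < s i) (hf : IsDensity f) (hg : IsDensity g) :
    ∃ v : {ν : Fin r → ℤ // IsStep ν} × ℤ × Fin T → VecL2 q,
      ∀ i, IsRep (specMap (fun w => beta s d w / chi (fun i => (μ i : ℤ)) s d w) Θ
        (incrFun i.1 s d i.2.1 i.2.2)) (v i) := by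
  have hp := hfact.isFactor_p hμ hs hf hg
  have hmem : ∀ (i : {ν : Fin r → ℤ // IsStep ν} × ℤ × Fin T) (j : Fin q), MemLp (fun w =>
      specMap (fun w => beta s d w / chi (fun i => (μ i : ℤ)) s d w) Θ
        (incrFun i.1 s d i.2.1 i.2.2) w j) 2 circ := fun i => by
    obtain ⟨C, hC⟩ := exists_norm_incrScalar_le i.1 hs d i.2.1
    rw [incrFun_eq]
    exact hp.memLp_specMap_single _ (aestronglyMeasurable_incrScalar _ s d _) hC
  exact ⟨fun i => toVecL2 _ (hmem i), fun i => isRep_toVecL2 _ _⟩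

/-- The scalar β/χ_μ cancels χ_μ/β. This is the reason for that choice of b: increments with step μ
become pure shifts of rows of Θ. -/
lemma eq_rowVec_of_isRep_incrFun (hμ : ∀ i, 0 < μ i) (hs : ∀ i, 0 < s i)
    (hΘ : ∀ l j, MemLp (fun w => Θ w l j) 2 circ) {m : ℤ} {l : Fin T} {x : VecL2 q}
    (hx : IsRep (specMap (fun w => beta s d w / chi (fun i => (μ i : ℤ)) s d w) Θ
        (incrFun (fun i => (μ i : ℤ)) s d m l)) x) :
    x = rowVec hΘ (-m) l := by
  ext j : 1
  apply Lp.ext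
  filter_upwards [hx j, isRep_rowVec hΘ (-m) l j,
    ae_beta_ne_zero hs d, ae_chi_ne_zero (isStep_natCast hμ).ne_zero hs d] with w h1 h2 h3 h4
  rw [h1, h2, incrFun_eq, specMap_single, incrScalar]
  field_simp

/-- The isometry between `L₂(p)` and the space of the observed increments. -/
lemma exists_isometry_obsIncr
    (hfact : CanonicalFactorizations (fun i => (μ i : ℤ)) s d f g θ Θ φ Φ ψ Ψ)
    (hμ : ∀ i, 0 < μ i) (hs : ∀ i, 0 < s i) (hξ : HasGMSpectralDensity P s d ξ f)
    (hη : HasSpectralDensity P η g)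
    (huncorr : ∀ ν : Fin r → ℤ, IsStep ν → ∀ (m k : ℤ) (i j : Fin T),
      ∫ ω, gmIncr ν s d (fun n => ξ n i) m ω * conj (η k j ω) ∂P = 0)
    (hΘ : ∀ l j, MemLp (fun w => Θ w l j) 2 circ)
    {v : {ν : Fin r → ℤ // IsStep ν} × ℤ × Fin T → VecL2 q}
    (hv : ∀ i, IsRep (specMap (fun w => beta s d w / chi (fun i => (μ i : ℤ)) s d w) Θ
        (incrFun i.1 s d i.2.1 i.2.2)) (v i)) :
    ∃ U : VecL2 q →ₗᵢ[ℂ] Lp ℂ 2 P, ∀ i, U (v i) = obsIncr hξ hη i := by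
  have hp := hfact.isFactor_p hμ hs hξ.isDensity hη.isDensity
  have hg := hfact.isFactor_g hη.isDensity
  have hv' : ∀ i, IsRep (specMap (fun w => beta s d w / chi (fun i => (μ i : ℤ)) s d w) Θ
      fun w => Pi.single i.2.2 (incrScalar i.1 s d i.2.1 w)) (v i) := fun i => by
    rw [← incrFun_eq]; exact hv i
  refine exists_linearIsometry_of_gram v (obsIncr hξ hη) (fun i j => ?_) ?_
  · rw [inner_obsIncr hs hξ hη huncorr (fun l j => (hfact.series_phi l j).1) hg]
    exact hp.inner_eq (hv' i) (hv' j)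
  -- The increments with the single step μ, at all times, already span a dense subspace.
  · rw [eq_top_iff, ← closure_span_ez_eq_top hΘ hfact.left_inv (isRep_rowVec hΘ)]
    refine Submodule.topologicalClosure_mono (Submodule.span_mono ?_)
    rintro _ ⟨⟨m, l⟩, rfl⟩
    have h := hv (⟨fun i => (μ i : ℤ), isStep_natCast hμ⟩, -m, l)
    refine ⟨(⟨fun i => (μ i : ℤ), isStep_natCast hμ⟩, -m, l), ?_⟩
    rw [eq_rowVec_of_isRep_incrFun hμ hs hΘ h, neg_neg]

/-- The cross covariances of `Aη` with the observed increments. -/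
lemma inner_obsIncr_synth (hμ : ∀ i, 0 < μ i) (hξ : HasGMSpectralDensity P s d ξ f)
    (hη : HasSpectralDensity P η g)
    (huncorr : ∀ ν : Fin r → ℤ, IsStep ν → ∀ (m k : ℤ) (i j : Fin T),
      ∫ ω, gmIncr ν s d (fun n => ξ n i) m ω * conj (η k j ω) ∂P = 0)
    (hΦ : ∀ l j, MemLp (fun w => Φ w l j) 2 circ) {W : VecL2 q' →L[ℂ] Lp ℂ 2 P}
    (hW : ∀ m l, W (rowVec hΦ m l) = (hη.memLp (-m) l).toLp)
    (hWi : ∀ x ∈ (Submodule.span ℂ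
        (Set.range fun i : ℤ × Fin T => rowVec hΦ i.1 i.2)).topologicalClosure,
      ∀ z ∈ (Submodule.span ℂ
        (Set.range fun i : ℤ × Fin T => rowVec hΦ i.1 i.2)).topologicalClosure,
        inner ℂ (W x) (W z) = inner ℂ x z)
    {a : ℕ → Fin T → ℂ} (ha : ∀ p, Summable fun k => ‖a k p‖) (m : ℤ) (l : Fin T) :
    inner ℂ (obsIncr hξ hη (⟨_, isStep_natCast hμ⟩, -m, l)) (W (synth hΦ (fun k => k) a)) =
      inner ℂ (rowVec hΦ m l) (synth hΦ (fun k => k) (aMinus μ s d a)) +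
      inner ℂ (rowVec hΦ m l) (synth hΦ (fun k => -k) (bMinus μ s d a)) := by
  rw [obsIncr_eq_add, inner_add_left, inner_gmIncr_eq_zero hξ hη huncorr hΦ hW (isStep_natCast hμ)
    (-m) l (synth_mem_closure hΦ _ ha), zero_add, ← toLp_gmIncr_eq hη hΦ hW,
    hWi _ (incrRow_mem_span _ _ _ _ _ _) _ (synth_mem_closure hΦ _ ha), neg_neg,
    inner_incrRow_synth μ s d ha hΦ]


lemma integral_norm_sq_eq_norm_sq {y : Lp ℂ 2 P} {Y : Ω → ℂ} (hy : y =ᵐ[P] Y) :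
    ∫ ω, ‖Y ω‖ ^ 2 ∂P = ‖y‖ ^ 2 := by
  have h := inner_self_eq_norm_sq_to_K (𝕜 := ℂ) y
  rw [inner_eq_integral_of_ae hy hy] at h
  simp only [Complex.conj_mul', ← Complex.ofReal_pow] at h
  rw [integral_complex_ofReal] at h
  change _ = ((‖y‖ : ℝ) : ℂ) ^ 2 at h
  rw [← Complex.ofReal_pow] at h
  exact Complex.ofReal_injective h

lemma IsFunctional.add {a : ℕ → Fin T → ℂ} {A B : Ω → ℂ} (hA : IsFunctional P a ξ A)
    (hB : IsFunctional P a η B) :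
    IsFunctional P a (fun m i ω => ξ m i ω + η m i ω) (fun ω => A ω + B ω) := by
  have h := tendstoInMeasure_add hA hB
  simpa only [IsFunctional, ← Finset.sum_add_distrib, ← mul_add] using h

/-- Stochastic integrals with respect to a spectral process are the values of the isometry. -/
lemma IsSpectralProcess.isStochInt {ζ : ℤ → Fin T → Ω → ℂ}
    {p : ℝ → Matrix (Fin T) (Fin T) ℂ} {Z : ℝ → Fin T → Ω → ℂ}
    (hZ : IsSpectralProcess P s d ζ p Z) {b : ℝ → ℂ} (hp : IsFactor p b Θ)
    (U : VecL2 q →L[ℂ] Lp ℂ 2 P)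
    {v : {ν : Fin r → ℤ // IsStep ν} × ℤ × Fin T → VecL2 q}
    (hv : ∀ i, IsRep (specMap b Θ (incrFun i.1 s d i.2.1 i.2.2)) (v i))
    (hU : ∀ i, U (v i) =ᵐ[P] gmIncr i.1 s d (fun k => ζ k i.2.2) i.2.1)
    {h : ℝ → Fin T → ℂ} (hm : AEStronglyMeasurable h circ) {X : VecL2 q}
    (hx : IsRep (specMap b Θ h) X)
    (hX : X ∈ (Submodule.span ℂ (Set.range v)).topologicalClosure) :
    IsStochInt P p Z h (U X) := by
  have hmem : ∀ (i : Set.Ico (-π) π × Fin T) (j : Fin q),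
      MemLp (fun w => specMap b Θ (stepFun i) w j) 2 circ := fun i =>
    hp.memLp_specMap_single i.2 (aestronglyMeasurable_stepScalar i.1) (norm_stepScalar_le i.1)
  have hstep : ∀ i, IsRep (specMap b Θ (stepFun i)) (toVecL2 _ (hmem i)) := fun i =>
    isRep_toVecL2 _ _
  have hπ : -π ∈ Set.Ico (-π) π := ⟨le_rfl, by linarith [Real.pi_pos]⟩
  have hz : ∀ i : Set.Ico (-π) π × Fin T, (hZ.memLp (-π) hπ i.1 i.1.2 i.2).toLp =ᵐ[P]
      fun ω => Z (i.1 : ℝ) i.2 ω - Z (-π) i.2 ω := fun i => MemLp.coeFn_toLp _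
  rw [hp.isStochInt_iff hm hx (ae_eq_refl _) hstep hz]
  -- By `representation` the closed integration relation of an arbitrary Z contains every pair (v i,
  -- U (v i)). Integrals are therefore determined by the increments, and one Y serves all Z.
  refine mem_of_graph U (Submodule.isClosed_topologicalClosure _) ?_ hX
  rintro ⟨⟨ν, hν⟩, m, l⟩
  have hi := hZ.representation ν hν m l
  have h1 := hv (⟨ν, hν⟩, m, l)
  have h2 := hU (⟨ν, hν⟩, m, l)
  exact (hp.isStochInt_iff (aestronglyMeasurable_incrFun ν s d m l) h1 h2 hstep hz).1 hi

lemma aestronglyMeasurable_characteristic (μ : Fin r → ℤ) (s d : Fin r → ℕ)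
    (hΨ : ∀ i l, AEStronglyMeasurable (fun w => Ψ w i l) circ) (X : VecL2 q) :
    AEStronglyMeasurable
      (fun w => (chi μ s d w / beta s d w) • ((Ψ w)ᵀ *ᵥ fun i => (X i : ℝ → ℂ) w)) circ := by
  refine (aemeasurable_pi_lambda _ fun l => ?_).aestronglyMeasurable
  refine AEStronglyMeasurable.aemeasurable ?_
  refine (aestronglyMeasurable_chi_div_beta μ s d).mul ?_
  simp only [Matrix.mulVec, dotProduct]
  exact Finset.aestronglyMeasurable_fun_sum _ fun i _ => (hΨ i l).mul (Lp.aestronglyMeasurable _)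

/-- (β/χ_μ) Θᵀ (χ_μ/β) Ψᵀ X = (ΨΘ)ᵀ X = X, so this h is the preimage of X in L₂(p). -/
lemma isRep_specMap_characteristic
    (hfact : CanonicalFactorizations (fun i => (μ i : ℤ)) s d f g θ Θ φ Φ ψ Ψ)
    (hμ : ∀ i, 0 < μ i) (hs : ∀ i, 0 < s i) (X : VecL2 q) :
    IsRep (specMap (fun w => beta s d w / chi (fun i => (μ i : ℤ)) s d w) Θ
      (fun w => (chi (fun i => (μ i : ℤ)) s d w / beta s d w) •
        ((Ψ w)ᵀ *ᵥ fun i => (X i : ℝ → ℂ) w))) X := by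
  intro j
  filter_upwards [hfact.left_inv, ae_beta_ne_zero hs d,
    ae_chi_ne_zero (isStep_natCast hμ).ne_zero hs d] with w h1 h2 h3
  rw [specMap, Matrix.mulVec_smul, Matrix.mulVec_mulVec, ← Matrix.transpose_mul, h1,
    Matrix.transpose_one, Matrix.one_mulVec, smul_smul, div_mul_div_cancel₀ h3, div_self h2,
    one_smul]

/-- The normal equations only determine coefficients of order ≥ 0; this shows that X has no others.
-/
lemma mem_hardy_of_mem_closure (hθ : ∀ l j, IsL2Series (fun k => θ k l j) (fun w => Θ w l j))
    {X : VecL2 q} (hX : X ∈ (Submodule.span ℂ (Set.range fun i : ℕ × Fin T =>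
      rowVec (fun l j => (hθ l j).1) i.1 i.2)).topologicalClosure) (j : Fin q) : X j ∈ hardy := by
  let pr := PiLp.proj (𝕜 := ℂ) 2 (fun _ : Fin q => Lp ℂ 2 circ) j
  have hle : (Submodule.span ℂ (Set.range fun i : ℕ × Fin T =>
      rowVec (fun l j => (hθ l j).1) i.1 i.2)).topologicalClosure ≤ hardy.comap pr.toLinearMap := by
    refine Submodule.topologicalClosure_minimal _ ?_ (isClosed_hardy.preimage pr.continuous)
    rw [Submodule.span_le]
    rintro _ ⟨i, rfl⟩
    exact mulEz_mem_hardy i.1 (hθ i.2 j).mem_hardy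
  exact hle hX

/-- Pythagoras, with 0 as the competing element of `K`. -/
lemma integral_norm_sq_error {Aξ : Ω → ℂ} {A Y : Lp ℂ 2 P} {K : Submodule ℂ (Lp ℂ 2 P)}
    (hY : Y ∈ K) (horth : ∀ x ∈ K, inner ℂ x (Y - A) = 0) :
    ∫ ω, ‖Aξ ω - (Aξ ω + A ω - Y ω)‖ ^ 2 ∂P = ‖A‖ ^ 2 - ‖Y‖ ^ 2 := by
  have h : ⇑(Y - A) =ᵐ[P] fun ω => Aξ ω - (Aξ ω + A ω - Y ω) := by
    filter_upwards [Lp.coeFn_sub Y A] with ω h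
    rw [h, Pi.sub_apply]; ring
  have := norm_sub_sq_of_mem hY K.zero_mem horth
  rw [zero_sub, zero_sub, norm_neg, norm_neg] at this
  rw [integral_norm_sq_eq_norm_sq h, this]
  ring


/-- The optimal estimate in terms of the normal equations for the class `X` of the vector
function `β χ⁻¹ Θᵀ h`. -/
lemma exists_optimalEstimate
    (hfact : CanonicalFactorizations (fun i => (μ i : ℤ)) s d f g θ Θ φ Φ ψ Ψ)
    (hμ : ∀ i, 0 < μ i) (hs : ∀ i, 0 < s i) (hξ : HasGMSpectralDensity P s d ξ f)
    (hη : HasSpectralDensity P η g)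
    (huncorr : ∀ ν : Fin r → ℤ, IsStep ν → ∀ (m k : ℤ) (i j : Fin T),
      ∫ ω, gmIncr ν s d (fun n => ξ n i) m ω * conj (η k j ω) ∂P = 0)
    {a : ℕ → Fin T → ℂ} (ha : ∀ p, Summable fun k => ‖a k p‖)
    (hΘ : ∀ l j, MemLp (fun w => Θ w l j) 2 circ) (hΦ : ∀ l j, MemLp (fun w => Φ w l j) 2 circ)
    (Aξ : Ω → ℂ) :
    (∃ Z, IsSpectralProcess P s d (fun m i ω => ξ m i ω + η m i ω) (pDensity s d f g) Z) ∧
    ∃ (X : VecL2 q) (A Y : Lp ℂ 2 P),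
      X ∈ (Submodule.span ℂ
        (Set.range fun i : ℕ × Fin T => rowVec hΘ i.1 i.2)).topologicalClosure ∧
      (∀ (m : ℕ) l, inner ℂ (rowVec hΘ m l) X =
        inner ℂ (rowVec hΦ m l) (synth hΦ (fun k => k) (aMinus μ s d a)) +
        inner ℂ (rowVec hΦ m l) (synth hΦ (fun k => -k) (bMinus μ s d a))) ∧
      IsFunctional P a η A ∧ ‖A‖ = ‖synth hΦ (fun k => k) a‖ ∧ ‖Y‖ = ‖X‖ ∧
      (∀ h, AEStronglyMeasurable h circ →
        IsRep (specMap (fun w => beta s d w / chi (fun i => (μ i : ℤ)) s d w) Θ h) X →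
        MemL20 (fun i => (μ i : ℤ)) s d (pDensity s d f g) h ∧
        ∀ Z, IsSpectralProcess P s d (fun m i ω => ξ m i ω + η m i ω) (pDensity s d f g) Z →
          IsStochInt P (pDensity s d f g) Z h Y) ∧
      IsOptimalEstimate P (fun i => (μ i : ℤ)) s d (fun m i ω => ξ m i ω + η m i ω) Aξ
        (fun ω => Aξ ω + A ω) (fun ω => Aξ ω + A ω - Y ω) ∧
      ∫ ω, ‖Aξ ω - (Aξ ω + A ω - Y ω)‖ ^ 2 ∂P = ‖A‖ ^ 2 - ‖Y‖ ^ 2 := by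
  have hp := hfact.isFactor_p hμ hs hξ.isDensity hη.isDensity
  have hg := hfact.isFactor_g hη.isDensity
  have hstep := isStep_natCast hμ
  have hb : ∀ᵐ w ∂circ, beta s d w / chi (fun i => (μ i : ℤ)) s d w ≠ 0 := by
    filter_upwards [ae_beta_ne_zero hs d, ae_chi_ne_zero hstep.ne_zero hs d] with w h1 h2
    exact div_ne_zero h1 h2
  obtain ⟨v, hv⟩ := exists_incrVec hfact hμ hs hξ.isDensity hη.isDensity
  obtain ⟨U, hU⟩ := exists_isometry_obsIncr hfact hμ hs hξ hη huncorr hΘ hv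
  obtain ⟨W, hW, hWi⟩ := exists_spectral_map hη hg hΦ
  have hUv : ∀ i, U (v i) =ᵐ[P]
      gmIncr i.1 s d (fun k ω => ξ k i.2.2 ω + η k i.2.2 ω) i.2.1 := fun i => by
    rw [hU]; exact MemLp.coeFn_toLp _
  have hvrow : ∀ i : ℕ × Fin T, v (⟨fun i => (μ i : ℤ), hstep⟩, -(i.1 : ℤ), i.2) =
      rowVec hΘ i.1 i.2 := fun i => by
    have h := hv (⟨fun i => (μ i : ℤ), hstep⟩, -(i.1 : ℤ), i.2)
    rw [eq_rowVec_of_isRep_incrFun hμ hs hΘ h, neg_neg]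
  have hrowrep : ∀ i : ℕ × Fin T,
      IsRep (specMap (fun w => beta s d w / chi (fun i => (μ i : ℤ)) s d w) Θ
        (incrFun (fun i => (μ i : ℤ)) s d (-(i.1 : ℤ)) i.2)) (rowVec hΘ i.1 i.2) := fun i => by
    rw [← hvrow]; exact hv (⟨fun i => (μ i : ℤ), hstep⟩, -(i.1 : ℤ), i.2)
  have hUrow : ∀ i : ℕ × Fin T, U (rowVec hΘ i.1 i.2) =
      obsIncr hξ hη (⟨fun i => (μ i : ℤ), hstep⟩, -(i.1 : ℤ), i.2) := fun i => by
    rw [← hvrow, hU]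
  have hUrow' : ∀ i : ℕ × Fin T, U (rowVec hΘ i.1 i.2) =ᵐ[P]
      gmIncr (fun i => (μ i : ℤ)) s d (fun k ω => ξ k i.2 ω + η k i.2 ω) (-(i.1 : ℤ)) := fun i => by
    rw [hUrow]; exact MemLp.coeFn_toLp _
  refine ⟨exists_isSpectralProcess hp hfact.left_inv hb U hv hUv, ?_⟩
  obtain ⟨A, hA⟩ : ∃ A, A = W (synth hΦ (fun k => k) a) := ⟨_, rfl⟩
  -- `X` is the pullback by `U` of the projection of Aη, and `hXi` are the normal equations.
  obtain ⟨X, hX, hXi⟩ := exists_projection U (fun i : ℕ × Fin T => rowVec hΘ i.1 i.2) A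
  have hUX : U X ∈ (Submodule.span ℂ
      (Set.range fun i : ℕ × Fin T => U (rowVec hΘ i.1 i.2))).topologicalClosure :=
    map_mem_closure_span U.toContinuousLinearMap hX
  have horth : ∀ x ∈ (Submodule.span ℂ
      (Set.range fun i : ℕ × Fin T => U (rowVec hΘ i.1 i.2))).topologicalClosure,
      inner ℂ x (U X - A) = 0 := fun x hx =>
    inner_eq_zero_of_mem_closure_span hx fun i => by
      rw [inner_sub_right, U.inner_map_map, hXi, sub_self]
  refine ⟨X, A, U X, hX, fun m l => ?_, ?_, ?_, U.norm_map X, fun h hm hh => ⟨?_, fun Z hZ => ?_⟩,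
    isOptimalEstimate_of_orthogonal (ζ := fun m i ω => ξ m i ω + η m i ω) hUrow' Aξ hUX horth,
    integral_norm_sq_error hUX horth⟩
  · rw [hXi (m, l), hUrow (m, l), hA]
    exact inner_obsIncr_synth hμ hξ hη huncorr hΦ hW hWi ha m l
  · rw [hA]
    exact isFunctional_spectral hη hΦ hW ha
  · have hmem := synth_mem_closure hΦ (fun k => (k : ℤ)) ha
    rw [hA, norm_eq_sqrt_re_inner (𝕜 := ℂ), hWi _ hmem _ hmem, ← norm_eq_sqrt_re_inner]
  · exact (hp.memL20_iff hm hh hrowrep).2 hX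
  · refine hZ.isStochInt hp U.toContinuousLinearMap hv hUv hm hh ?_
    refine Submodule.topologicalClosure_mono (Submodule.span_mono ?_) hX
    rintro _ ⟨i, rfl⟩
    exact ⟨_, hvrow i⟩

end Main

end GMFilter

end

/-! ### Identification of the coefficients and of the error. -/

theorem mainTheorem1 {Ω : Type*} [MeasurableSpace Ω] (P : Measure Ω) [IsProbabilityMeasure P]
    {r T q q' : ℕ} (μ s d : Fin r → ℕ) (hμ : ∀ i, 0 < μ i) (hs : ∀ i, 0 < s i)
    (ξ η : ℤ → Fin T → Ω → ℂ) (f g : ℝ → Matrix (Fin T) (Fin T) ℂ)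
    (hξ : HasGMSpectralDensity P s d ξ f) (hη : HasSpectralDensity P η g)
    -- `η` is uncorrelated with (the increments of) `ξ`
    (huncorr : ∀ ν : Fin r → ℤ, IsStep ν → ∀ (m k : ℤ) (i j : Fin T),
      ∫ ω, gmIncr ν s d (fun n => ξ n i) m ω * conj (η k j ω) ∂P = 0)
    (a : ℕ → Fin T → ℂ) (ha₁ : Summable fun k => vnorm (a k))
    (ha₂ : Summable fun k : ℕ => ((k : ℝ) + 1) * vnorm (a k) ^ 2)
    (θ : ℕ → Matrix (Fin T) (Fin q) ℂ) (Θ : ℝ → Matrix (Fin T) (Fin q) ℂ)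
    (φ : ℕ → Matrix (Fin T) (Fin q') ℂ) (Φ : ℝ → Matrix (Fin T) (Fin q') ℂ)
    (ψ : ℕ → Matrix (Fin q) (Fin T) ℂ) (Ψ : ℝ → Matrix (Fin q) (Fin T) ℂ)
    (hfact : CanonicalFactorizations (fun i => (μ i : ℤ)) s d f g θ Θ φ Φ ψ Ψ)
    -- `a_{-μ̄}` and `b_{-μ̄}` lie in the domains of the operators `G⁻` and `G⁺` in `ℓ₂`
    (hGminus : Summable fun m => vnorm (blockApply (opGminus g) (aMinus μ s d a) m) ^ 2)
    (hGplus : Summable fun m => vnorm (blockApply (opGplus g) (bMinus μ s d a) m) ^ 2)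
    -- the functional `Aξ` is well defined
    (Aξ : Ω → ℂ) (hAξ : IsFunctional P a ξ Aξ) :
    let ζ : ℤ → Fin T → Ω → ℂ := fun m i ω => ξ m i ω + η m i ω
    let p : ℝ → Matrix (Fin T) (Fin T) ℂ := pDensity s d f g
    let χ : ℝ → ℂ := chi (fun i => (μ i : ℤ)) s d
    let aμ : ℕ → Fin T → ℂ := aMinus μ s d a
    let bμ : ℕ → Fin T → ℂ := bMinus μ s d a
    let cMinus : ℕ → Fin T → ℂ := fun m => ∑' k : ℕ, mconj (gCoeff g ((m : ℤ) - k)) *ᵥ aμ k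
    let cPlus : ℕ → Fin T → ℂ := fun m => ∑' k : ℕ, mconj (gCoeff g ((m : ℤ) + k)) *ᵥ bμ k
    let x : ℕ → Fin q → ℂ := fun m => psiBarC ψ cMinus m + psiBarC ψ cPlus m
    -- the series in the formulas converge
    (∀ m : ℕ, Summable fun k : ℕ => mconj (gCoeff g ((m : ℤ) - k)) *ᵥ aμ k) ∧
    (∀ m : ℕ, Summable fun k : ℕ => mconj (ψ k) *ᵥ cMinus (k + m)) ∧
    (∀ m : ℕ, Summable fun k : ℕ => mconj (ψ k) *ᵥ cPlus (k + m)) ∧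
    BlockSummable (blockAdj (opTilde ψ)) (blockApply (opGminus g) aμ) ∧
    BlockSummable (blockAdj (opTilde ψ)) (blockApply (opGplus g) bμ) ∧
    BlockSummable (blockAdj (opTilde φ)) (blockApply (opTilde φ) aμ) ∧
    BlockSummable (blockAdj (opTilde φ)) (blockApply (opTildePlus φ) bμ) ∧
    (Summable fun m => vnorm (x m) ^ 2) ∧
    (Summable fun k => vnorm (blockApply (opTilde φ) a k) ^ 2) ∧
    -- the expressions of `c⁻` and `c⁺` through `φ`
    (∀ m : ℕ,
      HasSum (fun l : ℕ => mconj (φ l) *ᵥ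
        ∑ k ∈ Finset.range (l + m + 1), (φ (l + m - k))ᵀ *ᵥ aμ k) (cMinus m) ∧
      HasSum (fun l : ℕ => mconj (φ l) *ᵥ blockApply (opTilde φ) aμ (l + m)) (cMinus m) ∧
      cMinus m = blockApply (blockAdj (opTilde φ)) (blockApply (opTilde φ) aμ) m) ∧
    (∀ m : ℕ,
      HasSum (fun l : ℕ => mconj (φ l) *ᵥ ∑' k : ℕ, (φ (l + m + k))ᵀ *ᵥ bμ k) (cPlus m) ∧
      HasSum (fun l : ℕ => mconj (φ l) *ᵥ blockApply (opTildePlus φ) bμ (l + m)) (cPlus m) ∧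
      cPlus m = blockApply (blockAdj (opTilde φ)) (blockApply (opTildePlus φ) bμ) m) ∧
    -- the two forms of the coefficients of the spectral characteristic agree
    (∀ m, x m = blockApply (blockAdj (opTilde ψ)) (blockApply (opGminus g) aμ) m +
      blockApply (blockAdj (opTilde ψ)) (blockApply (opGplus g) bμ) m) ∧
    -- the spectral process of `ξ + η` exists
    (∃ Z, IsSpectralProcess P s d ζ p Z) ∧
    -- the optimal estimate and its mean square error
    ∃ (Aζ : Ω → ℂ) (X : ℝ → Fin q → ℂ),
      IsFunctional P a ζ Aζ ∧
      (∀ i, IsL2Series (fun m => x m i) (fun w => X w i)) ∧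
      let h : ℝ → Fin T → ℂ := fun w => (χ w / beta s d w) • ((Ψ w)ᵀ *ᵥ X w)
      MemL20 (fun i => (μ i : ℤ)) s d p h ∧
      ∀ Z, IsSpectralProcess P s d ζ p Z → ∃ Y : Ω → ℂ,
        IsStochInt P p Z h Y ∧
        IsOptimalEstimate P (fun i => (μ i : ℤ)) s d ζ Aξ Aζ (fun ω => Aζ ω - Y ω) ∧
        ∫ ω, ‖Aξ ω - (Aζ ω - Y ω)‖ ^ 2 ∂P =
          ∑' k, vnorm (blockApply (opTilde φ) a k) ^ 2 - ∑' m, vnorm (x m) ^ 2 := by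
  intro ζ p χ aμ bμ cMinus cPlus x
  have hφ := hfact.series_phi
  have hψ := hfact.series_psi
  have hΦ : ∀ l j, MemLp (fun w => Φ w l j) 2 circ := fun l j => (hφ l j).1
  have hg := hfact.isFactor_g hη.isDensity
  have ha := fun p => summable_norm_of_summable_vnorm ha₁ p
  have haμ : ∀ p, Summable fun k => ‖aμ k p‖ := summable_norm_aMinus μ s d ha
  have hbμ : ∀ p, Summable fun k => ‖bμ k p‖ := summable_norm_bMinus μ s d a
  -- `Am` + `Ap` is conj χ_μ times the series Σ a(k)ᵀ e^{-iwk} Φ, which is `S`. Pairing `Am` and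
  -- `Ap` with the shifted rows of Φ yields c⁻ and c⁺.
  obtain ⟨Am, hAm⟩ : ∃ Am, Am = synth hΦ (fun k => (k : ℤ)) aμ := ⟨_, rfl⟩
  obtain ⟨Ap, hAp⟩ : ∃ Ap, Ap = synth hΦ (fun k => -(k : ℤ)) bμ := ⟨_, rfl⟩
  obtain ⟨S, hS⟩ : ∃ S, S = synth hΦ (fun k => (k : ℤ)) a := ⟨_, rfl⟩
  -- the sequences `c⁻` and `c⁺`
  have hcm : ∀ m : ℕ, HasSum (fun k : ℕ => mconj (gCoeff g ((m : ℤ) - k)) *ᵥ aμ k)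
      (fun l => inner ℂ (rowVec hΦ m l) Am) := fun m => by
    rw [hAm]; exact hasSum_gCoeff_mulVec hg hΦ (fun k => (k : ℤ)) haμ m
  have hcp : ∀ m : ℕ, HasSum (fun k : ℕ => mconj (gCoeff g ((m : ℤ) + k)) *ᵥ bμ k)
      (fun l => inner ℂ (rowVec hΦ m l) Ap) := fun m => by
    rw [hAp]
    simpa only [sub_neg_eq_add] using hasSum_gCoeff_mulVec hg hΦ (fun k => -(k : ℤ)) hbμ m
  have hcMinus : ∀ m, cMinus m = fun l => inner ℂ (rowVec hΦ m l) Am := fun m => (hcm m).tsum_eq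
  have hcPlus : ∀ m, cPlus m = fun l => inner ℂ (rowVec hΦ m l) Ap := fun m => (hcp m).tsum_eq
  have htm : ∀ n, blockApply (opTilde φ) aμ n = fun j => coef n (Am j) := fun n => by
    rw [hAm]
    exact (hasSum_blockApply_synth hΦ (fun k => (k : ℤ)) haμ (coef_opTilde hφ) n).tsum_eq
  have htp : ∀ n, blockApply (opTildePlus φ) bμ n = fun j => coef n (Ap j) := fun n => by
    rw [hAp]
    exact (hasSum_blockApply_synth hΦ (fun k => -(k : ℤ)) hbμ (coef_opTildePlus hφ) n).tsum_eq
  have hts : ∀ n, blockApply (opTilde φ) a n = fun j => coef n (S j) := fun n => by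
    rw [hS]
    exact (hasSum_blockApply_synth hΦ (fun k => (k : ℤ)) ha (coef_opTilde hφ) n).tsum_eq
  have hφm : ∀ m : ℕ, HasSum (fun l : ℕ => mconj (φ l) *ᵥ blockApply (opTilde φ) aμ (l + m))
      (cMinus m) := fun m => by
    simp only [htm, hcMinus]; exact hasSum_mconj_mulVec hφ Am m
  have hφp : ∀ m : ℕ, HasSum (fun l : ℕ => mconj (φ l) *ᵥ blockApply (opTildePlus φ) bμ (l + m))
      (cPlus m) := fun m => by
    simp only [htp, hcPlus]; exact hasSum_mconj_mulVec hφ Ap m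
  have hφm' := fun m => hasSum_blockAdj_opTilde (hφm m)
  have hφp' := fun m => hasSum_blockAdj_opTilde (hφp m)
  -- the coefficients of the spectral characteristic
  have hCM : ∀ l, ∃ C ∈ hardy, ∀ k : ℕ, coef k C = cMinus k l := fun l =>
    exists_mem_hardy_of_summable (summable_vnorm_sq_iff.1 hGminus l)
  have hCP : ∀ l, ∃ C ∈ hardy, ∀ k : ℕ, coef k C = cPlus k l := fun l =>
    exists_mem_hardy_of_summable (summable_vnorm_sq_iff.1 hGplus l)
  choose CM _ hCM using hCM
  choose CP _ hCP using hCP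
  have hxm := hasSum_psiBarC hψ hCM
  have hxp := hasSum_psiBarC hψ hCP
  have hxm' := fun m => hasSum_blockAdj_opTilde (hxm m)
  have hxp' := fun m => hasSum_blockAdj_opTilde (hxp m)
  have hΘ : ∀ l j, MemLp (fun w => Θ w l j) 2 circ := fun l j => (hfact.series_theta l j).1
  obtain ⟨hZ, X, A, Y, hX, hXi, hA, hAn, hYn, hh, hopt, herr⟩ :=
    exists_optimalEstimate hfact hμ hs hξ hη huncorr ha hΘ hΦ Aξ
  have hXh := mem_hardy_of_mem_closure hfact.series_theta hX
  have hx : ∀ m : ℕ, x m = fun j => coef m (X j) := fun m => by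
    funext j
    -- By the normal equations `CM` + `CP` carries the coefficients of order ≥ 0 of conj Θ X;
    -- inverting with conj Ψ identifies those of X with x.
    have hC : ∀ (k : ℕ) l, inner ℂ (rowVec hΘ k l) X = coef k (CM l + CP l) := fun k l => by
      rw [hXi, coef_add, hCM, hCP, hcMinus, hcPlus, hAm, hAp]
    rw [coef_eq_sum_inner hΘ hψ hfact.left_inv (isRep_rowVec hΘ) hC m j]
    simp only [inner_add_right, Finset.sum_add_distrib]
    exact congrFun (congrArg₂ (· + ·) (hxm m).tsum_eq (hxp m).tsum_eq) j
  have hxn : HasSum (fun m => vnorm (x m) ^ 2) (‖X‖ ^ 2) := by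
    simp only [hx]; exact hasSum_vnorm_sq_coef hXh
  have hSn : HasSum (fun k => vnorm (blockApply (opTilde φ) a k) ^ 2) (‖S‖ ^ 2) := by
    simp only [hts]
    exact hasSum_vnorm_sq_coef fun j => by rw [hS]; exact synth_apply_mem_hardy hφ ha j
  refine ⟨fun m => (hcm m).summable, fun m => (hxm m).summable, fun m => (hxp m).summable,
    fun m => (hxm' m).summable, fun m => (hxp' m).summable, fun m => (hφm' m).summable,
    fun m => (hφp' m).summable, hxn.summable, hSn.summable,
    fun m => ⟨?_, hφm m, (hφm' m).tsum_eq.symm⟩, fun m => ⟨hφp m, hφp m, (hφp' m).tsum_eq.symm⟩,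
    fun m => congrArg₂ (· + ·) ((hxm m).tsum_eq.trans (hxm' m).tsum_eq.symm)
      ((hxp m).tsum_eq.trans (hxp' m).tsum_eq.symm), hZ,
    fun ω => Aξ ω + A ω, fun w i => X i w, hAξ.add hA, fun i => ?_, ?_⟩
  · simpa only [blockApply_opTilde] using hφm m
  · simp only [hx]
    exact isL2Series_of_mem_hardy (hXh i)
  · obtain ⟨h1, h2⟩ := hh _ (aestronglyMeasurable_characteristic _ s d
      (fun i l => (hψ i l).1.1) X) (isRep_specMap_characteristic hfact hμ hs X)
    refine ⟨h1, fun Z hZ => ⟨Y, h2 Z hZ, hopt, ?_⟩⟩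
    -- ‖A‖ = ‖S‖ and ‖Y‖ = ‖X‖ by the isometries, and Parseval in the Hardy space turns both norms
    -- into the stated series.
    rw [herr, hAn, ← hS, hYn, hxn.tsum_eq, hSn.tsum_eq]
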